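/- **Conventions.** For an open interval $U\subseteq\mathbb R$, an integer $k\ge 1$ and $p\in\{1,2\}$, $W^{k,p}(U)$ is the Sobolev space of real functions on $U$ whose weak derivatives of order $\le k$ exist and lie in $L^p(U)$, with norm $\|u\|_{W^{k,p}(U)}=\max_{0\le j\le k}\|u^{(j)}\|_{L^p(U)}$; on a compact interval, $W^{k,p}$ means $W^{k,p}$ of its interior. Elements of $W^{\sigma,2}$ with $\sigma\ge1$ are identified with their continuous representatives. The probability density function (PDF) $p_\omega$ of a Borel probability measure $\omega$ on $\mathbb R$ that is absolutely continuous with respect to Lebesgue measure is its Radon–Nikodym derivative. For $n\ge 1$ the Gauss–Lobatto points of order $n$ are $\pm1$ together with the roots of the derivative of the Legendre polynomial of degree $n$. **Theorem.** Let $\Omega=[-1,1]$, let $m\ge 1$ and $\sigma\ge 2m+4$ be integers, and let $\kappa>0$ and $M$ be real numbers. There is a constant $C$, depending only on $m$, $\sigma$, $\kappa$ and $M$, with the following property. Let $f\in W^{\sigma,2}(\Omega)$ be real-valued with $\|f\|_{W^{\sigma,2}(\Omega)}\le M$ and $|f'|\ge\kappa$ on $\Omega$, put $A=f(\Omega)$,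 and let $d\varrho(\alpha)=r(\alpha)\,d\alpha$ be a probability measure on $\Omega$ with $r\ge0$ and $r\in W^{m,1}(\Omega)$. For $n\ge1$ let $g_n$ be the polynomial interpolant of $f$ at the Gauss–Lobatto points of order $n$, and let $\mu=f_*\varrho$ and $\nu_n=(g_n)_*\varrho$ be the pushforward measures. Then $\mu$ and every $\nu_n$, $n\ge1$, are absolutely continuous with respect to Lebesgue measure, $p_\mu\in W^{m,1}(A)$, and for every $n\ge 1$ $$\|p_\mu-p_{\nu_n}\|_{L^1(\mathbb R)}\;\le\; C\,\|p_\mu\|_{W^{m,1}(A)}^{\frac1{m+1}}\,\|f\|_{W^{\sigma,2}(\Omega)}^{\frac1{m+1}}\,n^{-\frac{m}{m+1}\left(\sigma-\frac56\right)} .$$ -/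

import Mathlib

open MeasureTheory Set
open scoped ContDiff

/-- `v` is the weak (distributional) derivative of order `j` of `u` on the open set `U ⊆ ℝ`:
both are locally integrable on `U` and
`∫_U u φ^(j) = (-1)^j ∫_U v φ` for every test function `φ ∈ C_c^∞(U)`. -/
def HasWeakDerivOn (U : Set ℝ) (j : ℕ) (u v : ℝ → ℝ) : Prop :=
  LocallyIntegrableOn u U volume ∧ LocallyIntegrableOn v U volume ∧
    ∀ φ : ℝ → ℝ, ContDiff ℝ ∞ φ → HasCompactSupport φ → tsupport φ ⊆ U →
      ∫ x in U, u x * iteratedDeriv j φ x = (-1) ^ j * ∫ x in U, v x * φ x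

/-- The Sobolev norm `max_{j ≤ k} ‖D^j u‖_{L^p(U)}` on an open set `U ⊆ ℝ`, as an extended
nonnegative real. Weak derivatives are unique up to null sets, so the infimum runs over
families that all give the same value; it is `⊤` if some weak derivative of order at most `k`
does not exist. -/
noncomputable def sobolevENorm (U : Set ℝ) (k : ℕ) (p : ENNReal) (u : ℝ → ℝ) : ENNReal :=
  ⨅ (v : ℕ → ℝ → ℝ) (_ : ∀ j ≤ k, HasWeakDerivOn U j u (v j)),
    (Finset.range (k + 1)).sup fun j => eLpNorm (v j) p (volume.restrict U)

/-- Membership in the Sobolev space `W^{k,p}(U)`. -/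
def MemSobolevOn (U : Set ℝ) (k : ℕ) (p : ENNReal) (u : ℝ → ℝ) : Prop :=
  sobolevENorm U k p u < ⊤

/-- The Sobolev norm as a real number (meaningful for members of `W^{k,p}(U)`). -/
noncomputable def sobolevNorm (U : Set ℝ) (k : ℕ) (p : ENNReal) (u : ℝ → ℝ) : ℝ :=
  (sobolevENorm U k p u).toReal

/-- The Legendre polynomial of degree `n` on `[-1,1]`, by Rodrigues' formula (normalized by the
value `1` at `1`; the normalization does not affect the roots of its derivative). -/
noncomputable def legendrePoly (n : ℕ) : Polynomial ℝ :=
  Polynomial.C (1 / (2 ^ n * (n.factorial : ℝ))) *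
    Polynomial.derivative^[n] ((Polynomial.X ^ 2 - 1) ^ n)

/-- The Gauss-Lobatto points of order `n ≥ 1`: the endpoints `-1, 1` together with the roots of
the derivative of the Legendre polynomial of degree `n`. -/
noncomputable def gaussLobattoNodes (n : ℕ) : Finset ℝ :=
  {-1, 1} ∪ (Polynomial.derivative (legendrePoly n)).roots.toFinset

/-- The polynomial interpolant of `f` at the Gauss-Lobatto points of order `n`. -/
noncomputable def gaussLobattoInterpolant (n : ℕ) (f : ℝ → ℝ) : ℝ → ℝ :=
  fun x => (Lagrange.interpolate (gaussLobattoNodes n) id f).eval x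

/-- The measure `dϱ(α) = r(α) dα` on `[-1,1]`, viewed as a measure on `ℝ`
(for `r` nonnegative almost everywhere on `[-1,1]`). -/
noncomputable def inputMeasure (r : ℝ → ℝ) : Measure ℝ :=
  (volume.restrict (Icc (-1) 1)).withDensity fun α => ENNReal.ofReal (r α)

/-- The probability density function of a finite measure on `ℝ` that is absolutely continuous
with respect to Lebesgue measure: its Radon-Nikodym derivative. -/
noncomputable def pdfOf (μ : Measure ℝ) : ℝ → ℝ :=
  fun y => (μ.rnDeriv volume y).toReal

/-!
# Densities of images under Gauss-Lobatto interpolants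

Write `δ = sup |f - g_n|` and let `D` be the difference of the densities of `μ` and `ν_n`. For large
`n` both `f` and `g_n` are diffeomorphisms of `[-1,1]` onto the same interval `A`, because `±1` are
nodes and the derivatives are close, so both densities live on `A` and are given by the change of
variables formula (`pushDensity`). Two facts about `D` are combined.

* `D` is small in a weak norm: its antiderivative `H` vanishing at the end points of `A` satisfies
  `‖H‖₁ ≤ δ`. This is the dual description of the transport distance: integrating `D` against a
  `1`-Lipschitz function `S` gives `∫ (S ∘ f - S ∘ g_n) dϱ`, and `S` is chosen with `S' = sign H`
  (`IsPrimitiveOn.integral_abs_le_of_lipschitz`).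
* `D` is bounded in a strong norm: `‖D‖_{W^{m,1}(A)} ≤ C ‖p_μ‖_{W^{m,1}(A)}`, since `p_μ` determines
  `r` and `r` determines the density of `ν_n`, and both changes of variables have derivatives
  bounded uniformly in `n` (`exists_sobolevBound_of_pushDensity`, `exists_sobolevBound_pushDensity`).

The inequality of Landau–Kolmogorov type `exists_integral_abs_deriv_le`, applied to `H`, gives
`‖D‖₁ ≤ C (h⁻¹ δ + h ^ m ‖p_μ‖)` for all small scales `h`, and the best `h` (`exists_scale`)
produces the exponents `m / (m + 1)` of `δ` and `1 / (m + 1)` of `‖p_μ‖`.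

What remains is the interpolation error, `exists_interpolation_bounds`. The derivative `f'` is
expanded in Legendre polynomials. Through the self-adjoint form of the ultraspherical differential
equation, `legendre_ode_selfAdjoint`, the regularity `f ∈ H^σ` becomes decay of the coefficients
(`IsSobolevChain.tail_le`, `IsSobolevChain.coeff_le`). The low frequencies are interpolated exactly.
On the high frequencies, interpolation is bounded from `ℓ²` of the interior nodes to the uniform
norm by Fejér's inequality `∑ ℓ_i² ≤ 1` (`sum_lobattoBasis_sq_le`), and the `ℓ²` norm is at most an
integral because the nodes are separated by at least `1 / (n + 1)` in the hyperbolic distance of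
`(-1,1)` (`artanh_sub_artanh_ge`, `sum_sq_le_of_separated`). This gives `δ ≤ C n ^ (-(σ - 1/2))`,
which is stronger than the required `C n ^ (-(σ - 5/6))`. An inequality of Markov type
(`abs_iterate_derivative_le`) then controls the derivatives of `g_n` up to order `m + 1`; this is
where `σ ≥ 2 m + 4` enters.

For the finitely many remaining `n` the left side is at most two, while the norm of `p_μ` is at
least one. Throughout, the norm of `f` is at least `κ` (`le_sobolevNorm`), so its power on the right
side is bounded below. Decreasing `f` are reduced to increasing ones by the reflection `x ↦ -x`.
Every `ν_n`, also for small `n`, is absolutely continuous: `g_n` is a polynomial with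
`g_n (-1) = f (-1) ≠ f 1 = g_n 1`, and nonconstant polynomials pull null sets back to null sets
(`volume_preimage_eval_eq_zero`).
-/

/-! ### Legendre polynomials -/

section Legendre
open Polynomial

lemma iterate_derivative_succ_X_mul (n : ℕ) (p : ℝ[X]) :
    derivative^[n + 1] (X * p) = X * derivative^[n + 1] p + C ((n : ℝ) + 1) * derivative^[n] p := by
  induction n with
  | zero => simp; ring
  | succ n ih =>
    rw [Function.iterate_succ_apply', ih, Function.iterate_succ_apply' _ (n + 1),
      derivative_add, derivative_mul, derivative_C_mul, derivative_X, one_mul,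
      ← Function.iterate_succ_apply' derivative n]
    push_cast
    simp only [map_add, map_one]
    ring

/-- The ultraspherical differential equation satisfied by the `j`-th derivative of a Legendre
polynomial. -/
lemma legendre_ode (k j : ℕ) :
    (1 - X ^ 2) * derivative^[j + 2] (legendrePoly k)
      - C (2 * ((j : ℝ) + 1)) * X * derivative^[j + 1] (legendrePoly k)
      + C ((k : ℝ) * (k + 1) - j * (j + 1)) * derivative^[j] (legendrePoly k) = 0 := by
  set U : ℝ[X] := (X ^ 2 - 1) ^ k with hU
  have h1 : X * (X * derivative U) - derivative U = C (2 * (k : ℝ)) * (X * U) := by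
    rcases k with _ | k
    · simp [hU]
    · rw [hU, derivative_pow_succ]
      simp only [derivative_sub, derivative_X_pow, derivative_one]
      simp only [map_add, map_mul, map_natCast, map_one, Nat.cast_add, Nat.cast_one]
      simp [show (C (2 : ℝ) : ℝ[X]) = 2 from rfl]
      ring
  have h2 := congrArg (fun p => derivative^[k + j + 1] p) h1
  simp only [iterate_derivative_sub, iterate_derivative_C_mul] at h2
  rw [iterate_derivative_succ_X_mul, iterate_derivative_succ_X_mul,
    iterate_derivative_succ_X_mul, ← Function.iterate_succ_apply derivative] at h2
  have h3 : C (((k + j : ℕ) : ℝ) + 1) * derivative^[k + j] (X * derivative U)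
      = C (((k + j : ℕ) : ℝ) + 1) * (X * derivative^[k + j + 1] U
        + C ((k + j : ℕ) : ℝ) * derivative^[k + j] U) := by
    rcases (k + j) with _ | i
    · simp
    · rw [iterate_derivative_succ_X_mul, ← Function.iterate_succ_apply derivative,
        ← Function.iterate_succ_apply derivative]
      simp
  rw [h3, ← Function.iterate_succ_apply derivative] at h2
  have hT : ∀ i, derivative^[i] (legendrePoly k)
      = C (1 / (2 ^ k * (k.factorial : ℝ))) * derivative^[k + i] U := by
    intro i
    rw [legendrePoly, iterate_derivative_C_mul, add_comm k i, Function.iterate_add_apply]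
  rw [hT, hT, hT]
  have e1 : k + (j + 2) = (k + j + 1).succ := by omega
  have e2 : k + (j + 1) = (k + j).succ := by omega
  rw [e1, e2]
  simp only [map_sub, map_mul, map_add, map_one, map_natCast, Nat.cast_add, map_ofNat,
    Nat.succ_eq_add_one] at h2 ⊢
  linear_combination (-C (1 / (2 ^ k * (k.factorial : ℝ)))) * h2

/-- The ultraspherical differential equation in self-adjoint form. -/
lemma legendre_ode_selfAdjoint (k j : ℕ) :
    derivative ((1 - X ^ 2) ^ (j + 1) * derivative^[j + 1] (legendrePoly k))
      = - (C ((k : ℝ) * (k + 1) - j * (j + 1)) * ((1 - X ^ 2) ^ j *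
        derivative^[j] (legendrePoly k))) := by
  have h := legendre_ode k j
  rw [derivative_mul, derivative_pow_succ, ← Function.iterate_succ_apply' derivative]
  simp only [derivative_sub, derivative_X_pow, derivative_one]
  simp only [map_sub, map_mul, map_add, map_one, map_natCast, map_ofNat,
    Nat.succ_eq_add_one] at h ⊢
  have e : j + 1 + 1 = j + 2 := rfl
  rw [e]
  simp only [Nat.cast_ofNat, Nat.add_one_sub_one, pow_one, zero_sub]
  linear_combination ((1 - X ^ 2) ^ j) * h

lemma legendrePoly_eval_one (k : ℕ) : (legendrePoly k).eval 1 = 1 := by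
  have : derivative^[k] ((X ^ 2 - 1 : ℝ[X]) ^ k) = derivative^[k] ((X - C 1) ^ k * (X + C 1) ^ k) := by
    rw [← mul_pow]; congr 2; simp; ring
  rw [legendrePoly, this, iterate_derivative_mul, eval_mul, eval_finsetSum, eval_C,
    Finset.sum_eq_single 0]
  · rw [Nat.sub_zero, iterate_derivative_X_sub_pow_self]
    have : (k.factorial : ℝ) ≠ 0 := by positivity
    simp
    norm_num
    field_simp
  · intro i hi hi0
    rw [iterate_derivative_X_sub_pow]
    have : 0 < k - (k - i) := by simp at hi; omega
    simp only [eval_smul, eval_mul, eval_pow, eval_sub, eval_X, eval_C, sub_self,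
      zero_pow this.ne', smul_zero, zero_mul]
  · simp

lemma legendrePoly_comp_neg (k : ℕ) : (legendrePoly k).comp (-X) = (-1) ^ k * legendrePoly k := by
  have h : ∀ n (p : ℝ[X]), (derivative^[n] p).comp (-X) = (-1) ^ n * derivative^[n] (p.comp (-X)) := by
    intro n
    induction n with
    | zero => simp
    | succ n ih =>
      intro p
      rw [Function.iterate_succ_apply, ih, Function.iterate_succ_apply, derivative_comp]
      simp only [derivative_neg, derivative_X]
      rw [show (-1 : ℝ[X]) * (derivative p).comp (-X) = C (-1) * (derivative p).comp (-X) by simp,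
        iterate_derivative_C_mul]
      simp [pow_succ]
  rw [legendrePoly, mul_comp, h]
  simp
  ring

lemma legendrePoly_eval_neg (k : ℕ) (x : ℝ) :
    (legendrePoly k).eval (-x) = (-1) ^ k * (legendrePoly k).eval x := by
  have := congrArg (eval x) (legendrePoly_comp_neg k)
  simpa [eval_comp] using this

lemma legendrePoly_deriv_eval_neg (k j : ℕ) (x : ℝ) :
    (derivative^[j] (legendrePoly k)).eval (-x)
      = (-1) ^ (k + j) * (derivative^[j] (legendrePoly k)).eval x := by
  induction j generalizing x with
  | zero => simpa using legendrePoly_eval_neg k x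
  | succ j ih =>
    rw [Function.iterate_succ_apply']
    have h1 : (derivative^[j] (legendrePoly k)).comp (-X)
        = (-1) ^ (k + j) * derivative^[j] (legendrePoly k) := by
      apply Polynomial.funext
      intro y
      simpa [eval_comp] using ih y
    have h2 := congrArg derivative h1
    rw [derivative_comp, show ((-1 : ℝ[X])) ^ (k + j) = C ((-1) ^ (k + j)) by simp,
      derivative_C_mul] at h2
    have h3 := congrArg (eval x) h2
    simp [eval_comp] at h3
    rw [← add_assoc, pow_succ]
    linarith

lemma natDegree_legendrePoly_le (k : ℕ) : (legendrePoly k).natDegree ≤ k := by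
  rw [legendrePoly]
  refine (natDegree_C_mul_le _ _).trans ((natDegree_iterate_derivative _ _).trans ?_)
  have : ((X ^ 2 - 1 : ℝ[X]) ^ k).natDegree ≤ 2 * k := by
    refine natDegree_pow_le.trans ?_
    have : (X ^ 2 - 1 : ℝ[X]).natDegree ≤ 2 := by compute_degree
    nlinarith
  omega

lemma legendrePoly_deriv_eq_zero {k j : ℕ} (h : k < j) : derivative^[j] (legendrePoly k) = 0 :=
  iterate_derivative_eq_zero ((natDegree_legendrePoly_le k).trans_lt h)

lemma legendrePoly_deriv_eval_one_succ (k j : ℕ) :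
    2 * ((j : ℝ) + 1) * (derivative^[j + 1] (legendrePoly k)).eval 1
      = (k * (k + 1) - j * (j + 1)) * (derivative^[j] (legendrePoly k)).eval 1 := by
  have := congrArg (eval 1) (legendre_ode k j)
  simp only [one_pow, eval_add, eval_sub, eval_mul, eval_one, eval_pow, eval_X, sub_self,
    zero_mul, eval_C, mul_one, eval_zero] at this
  linarith

lemma legendrePoly_deriv_eval_one (k j : ℕ) :
    0 ≤ (derivative^[j] (legendrePoly k)).eval 1 ∧
      (derivative^[j] (legendrePoly k)).eval 1 ≤ (k : ℝ) ^ (2 * j) := by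
  induction j with
  | zero => simp [legendrePoly_eval_one]
  | succ j ih =>
    rcases lt_or_ge j k with hjk | hjk
    · have h := legendrePoly_deriv_eval_one_succ k j
      set a := (derivative^[j + 1] (legendrePoly k)).eval 1
      set b := (derivative^[j] (legendrePoly k)).eval 1
      have hj : (0 : ℝ) ≤ j := by positivity
      have hk : (j : ℝ) + 1 ≤ k := by exact_mod_cast hjk
      have hl : (0 : ℝ) ≤ k * (k + 1) - j * (j + 1) := by nlinarith
      have ha : 0 ≤ 2 * ((j : ℝ) + 1) * a := by rw [h]; exact mul_nonneg hl ih.1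
      have ha' : 0 ≤ a := by
        by_contra hc
        push Not at hc
        nlinarith
      refine ⟨ha', ?_⟩
      have h1 : (k * (k + 1) - j * (j + 1)) * b ≤ (2 * k ^ 2) * b :=
        mul_le_mul_of_nonneg_right (by nlinarith) ih.1
      have h2 : a ≤ (k : ℝ) ^ 2 * b := by nlinarith
      calc a ≤ (k : ℝ) ^ 2 * b := h2
        _ ≤ (k : ℝ) ^ 2 * k ^ (2 * j) := by gcongr; exact ih.2
        _ = _ := by ring
    · rw [legendrePoly_deriv_eq_zero (by omega)]
      simp

/-- On `[-1,1]` every derivative of a Legendre polynomial is largest at `1`: the function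
`T² + (1-x²) T'²/λ` built from the differential equation is monotone away from `0`. -/
lemma legendrePoly_deriv_abs_le (k j : ℕ) {x : ℝ} (hx : x ∈ Icc (-1 : ℝ) 1) :
    |(derivative^[j] (legendrePoly k)).eval x| ≤ (k : ℝ) ^ (2 * j) := by
  -- it suffices to treat nonnegative arguments
  suffices H : ∀ x ∈ Icc (0 : ℝ) 1,
      |(derivative^[j] (legendrePoly k)).eval x| ≤ (k : ℝ) ^ (2 * j) by
    rcases le_total 0 x with h | h
    · exact H x ⟨h, hx.2⟩
    · have := H (-x) ⟨by linarith, by linarith [hx.1]⟩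
      rwa [legendrePoly_deriv_eval_neg, abs_mul, abs_pow, abs_neg, abs_one, one_pow,
        one_mul] at this
  intro x hx
  rcases lt_trichotomy j k with hjk | hjk | hjk
  · set T := derivative^[j] (legendrePoly k) with hT
    set l : ℝ := k * (k + 1) - j * (j + 1) with hl
    have hlpos : 0 < l := by
      have hk : (j : ℝ) + 1 ≤ k := by exact_mod_cast hjk
      have hj : (0 : ℝ) ≤ j := by positivity
      rw [hl]; nlinarith
    set Φ : ℝ[X] := T ^ 2 + C (1 / l) * ((1 - X ^ 2) * derivative T ^ 2) with hΦ
    have hode := legendre_ode k j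
    rw [Function.iterate_succ_apply', Function.iterate_succ_apply', ← hT, ← hl] at hode
    have hd : ∀ y, (derivative Φ).eval y
        = (2 * (2 * j + 1) / l) * y * ((derivative T).eval y) ^ 2 := by
      intro y
      have h0 := congrArg (eval y) hode
      simp at h0
      rw [hΦ]
      simp only [derivative_add, derivative_mul, derivative_sq, derivative_C, derivative_sub,
        derivative_one, derivative_X, eval_add, eval_mul, eval_C, eval_sub, eval_one, eval_pow,
        eval_X, eval_zero]
      field_simp
      linear_combination (2 * eval y (derivative T)) * h0
    have hmono : MonotoneOn (fun y => Φ.eval y) (Icc 0 1) := by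
      apply monotoneOn_of_deriv_nonneg (convex_Icc 0 1) Φ.continuous.continuousOn
        Φ.differentiable.differentiableOn
      intro y hy
      rw [interior_Icc] at hy
      rw [Polynomial.deriv, hd]
      have := hy.1
      positivity
    have h1 := hmono hx (right_mem_Icc.2 zero_le_one) hx.2
    have h2 : Φ.eval 1 = (T.eval 1) ^ 2 := by simp [hΦ]
    have h3 : (T.eval x) ^ 2 ≤ Φ.eval x := by
      have : 0 ≤ 1 - x ^ 2 := by nlinarith [hx.1, hx.2]
      have h : 0 ≤ 1 / l * ((1 - x ^ 2) * (derivative T).eval x ^ 2) := by positivity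
      simp only [hΦ, eval_add, eval_pow, eval_mul, eval_C, eval_sub, eval_one, eval_X]
      linarith
    simp only at h1
    rw [h2] at h1
    have h4 := sq_le_sq.1 (h3.trans h1)
    refine h4.trans ?_
    rw [abs_of_nonneg (legendrePoly_deriv_eval_one k j).1]
    exact (legendrePoly_deriv_eval_one k j).2
  · have hdeg : (derivative^[j] (legendrePoly k)).natDegree ≤ 0 := by
      refine (natDegree_iterate_derivative _ _).trans ?_
      have := natDegree_legendrePoly_le k
      omega
    rw [eq_C_of_natDegree_le_zero hdeg]
    have h := legendrePoly_deriv_eval_one k j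
    rw [eq_C_of_natDegree_le_zero hdeg] at h
    simp only [eval_C] at h ⊢
    rw [abs_of_nonneg h.1]
    exact h.2
  · rw [legendrePoly_deriv_eq_zero hjk]
    simp

end Legendre

/-! ### Orthogonality of Legendre polynomials -/

section LegendreOrthogonality
open Polynomial

/-- Integration of polynomials over `[-1,1]`, as a linear functional. -/
noncomputable def polyIntegral : ℝ[X] →ₗ[ℝ] ℝ where
  toFun p := ∫ x in (-1 : ℝ)..1, p.eval x
  map_add' p q := by
    simp only [eval_add]
    exact intervalIntegral.integral_add (p.continuous.intervalIntegrable _ _)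
      (q.continuous.intervalIntegrable _ _)
  map_smul' c p := by
    simp only [eval_smul, RingHom.id_apply]
    exact intervalIntegral.integral_smul c _

lemma polyIntegral_apply (p : ℝ[X]) : polyIntegral p = ∫ x in (-1 : ℝ)..1, p.eval x := rfl

lemma polyIntegral_C_mul (c : ℝ) (p : ℝ[X]) : polyIntegral (C c * p) = c * polyIntegral p := by
  rw [← smul_eq_C_mul, map_smul, smul_eq_mul]

lemma polyIntegral_derivative (p : ℝ[X]) :
    polyIntegral (derivative p) = p.eval 1 - p.eval (-1) :=
  intervalIntegral.integral_eq_sub_of_hasDerivAt (fun x _ => p.hasDerivAt x)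
    ((derivative p).continuous.intervalIntegrable _ _)

lemma polyIntegral_nonneg {p : ℝ[X]} (h : ∀ x ∈ Icc (-1 : ℝ) 1, 0 ≤ p.eval x) :
    0 ≤ polyIntegral p :=
  intervalIntegral.integral_nonneg (by norm_num) h

lemma polyIntegral_mono {p q : ℝ[X]} (h : ∀ x ∈ Icc (-1 : ℝ) 1, p.eval x ≤ q.eval x) :
    polyIntegral p ≤ polyIntegral q :=
  intervalIntegral.integral_mono_on (by norm_num) (p.continuous.intervalIntegrable _ _)
    (q.continuous.intervalIntegrable _ _) h

/-- Passing to the next ultraspherical weight multiplies inner products of derivatives of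
Legendre polynomials by the eigenvalue. -/
lemma polyIntegral_weight_succ (k j : ℕ) (q : ℝ[X]) :
    polyIntegral ((1 - X ^ 2) ^ (j + 1) * derivative^[j + 1] (legendrePoly k) * derivative q)
      = ((k : ℝ) * (k + 1) - j * (j + 1)) *
        polyIntegral ((1 - X ^ 2) ^ j * derivative^[j] (legendrePoly k) * q) := by
  have h := polyIntegral_derivative
    ((1 - X ^ 2) ^ (j + 1) * derivative^[j + 1] (legendrePoly k) * q)
  rw [derivative_mul, legendre_ode_selfAdjoint] at h
  simp only [eval_mul, eval_pow, eval_sub, eval_one, eval_X] at h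
  rw [neg_mul, mul_assoc, map_add, map_neg, polyIntegral_C_mul,
    show (1 : ℝ) - 1 ^ 2 = 0 by norm_num, show (1 : ℝ) - (-1) ^ 2 = 0 by norm_num,
    zero_pow (Nat.succ_ne_zero j)] at h
  linarith

lemma polyIntegral_legendre_mul_of_ne {k l : ℕ} (h : k ≠ l) :
    polyIntegral (legendrePoly k * legendrePoly l) = 0 := by
  have h1 := polyIntegral_weight_succ k 0 (legendrePoly l)
  have h2 := polyIntegral_weight_succ l 0 (legendrePoly k)
  simp only [Function.iterate_zero, id, Function.iterate_one, zero_add, pow_zero, one_mul,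
    Nat.cast_zero, zero_mul, sub_zero] at h1 h2
  rw [mul_right_comm, h2, mul_comm (legendrePoly l)] at h1
  have h3 : ((l : ℝ) - k) * (l + k + 1) * polyIntegral (legendrePoly k * legendrePoly l) = 0 := by
    linear_combination h1
  have h4 : ((l : ℝ) - k) ≠ 0 := sub_ne_zero.2 (by exact_mod_cast h.symm)
  have h5 : ((l : ℝ) + k + 1) ≠ 0 := by positivity
  simpa [h4, h5] using h3

lemma legendrePoly_deriv_eval_one_pos {k j : ℕ} (h : j ≤ k) :
    0 < (derivative^[j] (legendrePoly k)).eval 1 := by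
  induction j with
  | zero => simp [legendrePoly_eval_one]
  | succ j ih =>
    have h1 := legendrePoly_deriv_eval_one_succ k j
    have h2 := ih (by omega)
    have hk : (j : ℝ) + 1 ≤ k := by exact_mod_cast h
    have hj : (0 : ℝ) ≤ j := by positivity
    have hl : (0 : ℝ) < k * (k + 1) - j * (j + 1) := by nlinarith
    have : 0 < 2 * ((j : ℝ) + 1) * (derivative^[j + 1] (legendrePoly k)).eval 1 := by
      rw [h1]; positivity
    exact (pos_iff_pos_of_mul_pos this).1 (by positivity)

lemma legendrePoly_coeff_ne_zero (k : ℕ) : (legendrePoly k).coeff k ≠ 0 := by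
  intro h
  have h1 := legendrePoly_deriv_eval_one_pos (le_refl k)
  have h2 : (legendrePoly k).degree < k := by
    rw [degree_lt_iff_coeff_zero]
    intro m hm
    rcases hm.eq_or_lt with rfl | hm
    · exact h
    · exact coeff_eq_zero_of_natDegree_lt ((natDegree_legendrePoly_le k).trans_lt hm)
  rw [iterate_derivative_eq_zero_of_degree_lt h2] at h1
  simp at h1

lemma exists_eq_sum_legendre (n : ℕ) (p : ℝ[X]) (hp : p.degree < n) :
    ∃ c : ℕ → ℝ, p = ∑ k ∈ Finset.range n, C (c k) * legendrePoly k := by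
  induction n generalizing p with
  | zero =>
    refine ⟨0, ?_⟩
    simpa using hp
  | succ n ih =>
    obtain ⟨c, hc⟩ := ih (p - C (p.coeff n / (legendrePoly n).coeff n) * legendrePoly n) (by
      rw [degree_lt_iff_coeff_zero] at hp ⊢
      intro m hm
      rw [coeff_sub, coeff_C_mul]
      rcases hm.eq_or_lt with rfl | hm
      · field_simp [legendrePoly_coeff_ne_zero n]
        simp
      · rw [coeff_eq_zero_of_natDegree_lt ((natDegree_legendrePoly_le n).trans_lt hm), hp m hm]
        simp)
    refine ⟨Function.update c n (p.coeff n / (legendrePoly n).coeff n), ?_⟩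
    rw [Finset.sum_range_succ, Function.update_self]
    rw [sub_eq_iff_eq_add] at hc
    conv_lhs => rw [hc]
    congr 1
    refine Finset.sum_congr rfl fun k hk => ?_
    rw [Function.update_of_ne (Finset.mem_range.1 hk).ne]

lemma polyIntegral_mul_legendre_of_degree_lt {n : ℕ} {p : ℝ[X]} (hp : p.degree < n) :
    polyIntegral (p * legendrePoly n) = 0 := by
  obtain ⟨c, rfl⟩ := exists_eq_sum_legendre n p hp
  rw [Finset.sum_mul, map_sum]
  refine Finset.sum_eq_zero fun k hk => ?_
  rw [mul_assoc, polyIntegral_C_mul,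
    polyIntegral_legendre_mul_of_ne (Finset.mem_range.1 hk).ne, mul_zero]

lemma polyIntegral_legendre_mul_self (k : ℕ) :
    ((k : ℝ) + 1 / 2) * polyIntegral (legendrePoly k * legendrePoly k) = 1 := by
  set P := legendrePoly k with hP
  -- `x P' - k P` has degree less than `k`, hence is orthogonal to `P`
  have h1 : polyIntegral ((X * derivative P - C (k : ℝ) * P) * P) = 0 := by
    apply polyIntegral_mul_legendre_of_degree_lt
    rw [degree_lt_iff_coeff_zero]
    intro m hm
    rw [coeff_sub, coeff_C_mul]
    rcases m with _ | m
    · have : k = 0 := by omega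
      subst this; simp
    · rw [coeff_X_mul, coeff_derivative]
      rcases hm.eq_or_lt with hm | hm
      · rw [hm]; push_cast; ring
      · rw [hP, coeff_eq_zero_of_natDegree_lt ((natDegree_legendrePoly_le k).trans_lt hm)]
        simp
  have h2 := polyIntegral_derivative (X * (P * P))
  simp only [derivative_mul, derivative_X, eval_mul, eval_X, one_mul] at h2
  rw [sub_mul, map_sub, mul_assoc (C _), polyIntegral_C_mul] at h1
  have h3 : (P.eval 1) = 1 := legendrePoly_eval_one k
  have h4 : (P.eval (-1)) * (P.eval (-1)) = 1 := by
    rw [hP, legendrePoly_eval_neg, legendrePoly_eval_one, mul_one, ← mul_pow]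
    simp
  rw [h4, h3, show P * P + X * (derivative P * P + P * derivative P)
      = P * P + (X * derivative P * P + X * derivative P * P) by ring, map_add, map_add] at h2
  linarith

/-- The eigenvalue product relating the weighted and unweighted norms of a Legendre
polynomial. -/
noncomputable def legendreWeight (k j : ℕ) : ℝ :=
  ∏ i ∈ Finset.range j, ((k : ℝ) * (k + 1) - i * (i + 1))

lemma polyIntegral_weight_eq (k l j : ℕ) :
    polyIntegral ((1 - X ^ 2) ^ j * derivative^[j] (legendrePoly k) *
      derivative^[j] (legendrePoly l)) =
      legendreWeight k j * polyIntegral (legendrePoly k * legendrePoly l) := by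
  induction j with
  | zero => simp [legendreWeight]
  | succ j ih =>
    rw [Function.iterate_succ_apply' derivative j (legendrePoly l), polyIntegral_weight_succ, ih,
      legendreWeight, legendreWeight, Finset.prod_range_succ]
    ring

lemma eq_sum_legendre (n : ℕ) (p : ℝ[X]) (hp : p.degree < n) :
    p = ∑ k ∈ Finset.range n,
      C (((k : ℝ) + 1 / 2) * polyIntegral (p * legendrePoly k)) * legendrePoly k := by
  obtain ⟨c, hc⟩ := exists_eq_sum_legendre n p hp
  conv_lhs => rw [hc]
  refine Finset.sum_congr rfl fun k hk => ?_
  have : polyIntegral (p * legendrePoly k)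
      = c k * polyIntegral (legendrePoly k * legendrePoly k) := by
    conv_lhs => rw [hc]
    rw [Finset.sum_mul, map_sum, Finset.sum_eq_single k]
    · rw [mul_assoc, polyIntegral_C_mul]
    · intro l _ hl
      rw [mul_assoc, polyIntegral_C_mul, polyIntegral_legendre_mul_of_ne hl, mul_zero]
    · exact fun h => absurd hk h
  rw [this, mul_left_comm, polyIntegral_legendre_mul_self, mul_one]

end LegendreOrthogonality

/-! ### Gauss-Lobatto nodes -/

section Nodes
open Polynomial

/-- Rolle's theorem with location: between `k + 1` zeros there are `k` critical points. -/
lemma exists_finset_roots_derivative {a b : ℝ} (p : ℝ[X]) (k : ℕ) (s : Finset ℝ)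
    (hs : ∀ x ∈ s, x ∈ Icc a b ∧ p.eval x = 0) (hc : s.card = k + 1) :
    ∃ t : Finset ℝ, (∀ x ∈ t, x ∈ Ioo a b ∧ (derivative p).eval x = 0) ∧ t.card = k := by
  let z := s.orderEmbOfFin hc
  have hz : ∀ i, z i ∈ Icc a b ∧ p.eval (z i) = 0 := fun i => hs _ (s.orderEmbOfFin_mem hc i)
  have hlt : ∀ i : Fin k, z i.castSucc < z i.succ := fun i => z.strictMono Fin.castSucc_lt_succ
  have hex : ∀ i : Fin k, ∃ c ∈ Ioo (z i.castSucc) (z i.succ), (derivative p).eval c = 0 := by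
    intro i
    obtain ⟨c, hc, h⟩ := exists_deriv_eq_zero (hlt i) p.continuous.continuousOn
      ((hz _).2.trans (hz _).2.symm)
    exact ⟨c, hc, by rwa [Polynomial.deriv] at h⟩
  choose c hc1 hc2 using hex
  have hcm : StrictMono c := by
    intro i j hij
    have : z i.succ ≤ z j.castSucc := z.monotone (by
      have : (i : ℕ) < j := hij
      rw [Fin.le_def, Fin.val_succ, Fin.val_castSucc]; omega)
    exact ((hc1 i).2.trans_le this).trans (hc1 j).1
  refine ⟨Finset.univ.image c, ?_, ?_⟩
  · intro x hx
    obtain ⟨i, -, rfl⟩ := Finset.mem_image.1 hx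
    exact ⟨⟨(hz _).1.1.trans_lt (hc1 i).1, (hc1 i).2.trans_le (hz _).1.2⟩, hc2 i⟩
  · rw [Finset.card_image_of_injective _ hcm.injective]
    simp

/-- The `j`-th derivative of `(X² - 1) ^ n` has at least `j` distinct zeros in `(-1,1)`: Rolle's
theorem applied `j` times, the end points being zeros of all earlier derivatives. -/
lemma exists_finset_roots_rodrigues (n j : ℕ) (hj : j ≤ n) :
    ∃ t : Finset ℝ, (∀ x ∈ t, x ∈ Ioo (-1 : ℝ) 1 ∧
      (derivative^[j] ((X ^ 2 - 1 : ℝ[X]) ^ n)).eval x = 0) ∧ t.card = j := by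
  induction j with
  | zero => exact ⟨∅, by simp⟩
  | succ j ih =>
    obtain ⟨t, ht, hc⟩ := ih (by omega)
    have hb : ∀ c : ℝ, c ^ 2 = 1 →
        (derivative^[j] ((X ^ 2 - 1 : ℝ[X]) ^ n)).eval c = 0 := by
      intro c hc2
      have h1 : (X - C c) ^ n ∣ (X ^ 2 - 1 : ℝ[X]) ^ n := by
        refine pow_dvd_pow_of_dvd (dvd_iff_isRoot.2 ?_) n
        simp [IsRoot, hc2]
      have h2 := pow_sub_dvd_iterate_derivative_of_pow_dvd j h1
      have h3 : (X - C c) ∣ derivative^[j] ((X ^ 2 - 1 : ℝ[X]) ^ n) :=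
        (dvd_pow_self _ (by omega)).trans h2
      exact dvd_iff_isRoot.1 h3
    have h1 : (1 : ℝ) ∉ insert (-1) t := by
      intro h
      rcases Finset.mem_insert.1 h with h | h
      · norm_num at h
      · exact lt_irrefl _ (ht _ h).1.2
    have h2 : (-1 : ℝ) ∉ t := fun h => lt_irrefl _ (ht _ h).1.1
    obtain ⟨t', ht', hc'⟩ := exists_finset_roots_derivative (a := -1) (b := 1)
      (derivative^[j] ((X ^ 2 - 1 : ℝ[X]) ^ n)) (j + 1) (insert 1 (insert (-1) t)) (by
        intro x hx
        rcases Finset.mem_insert.1 hx with rfl | hx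
        · exact ⟨by norm_num, hb _ (by norm_num)⟩
        rcases Finset.mem_insert.1 hx with rfl | hx
        · exact ⟨by norm_num, hb _ (by norm_num)⟩
        · exact ⟨Ioo_subset_Icc_self (ht x hx).1, (ht x hx).2⟩) (by
        rw [Finset.card_insert_of_notMem h1, Finset.card_insert_of_notMem h2, hc])
    refine ⟨t', fun x hx => ⟨(ht' x hx).1, ?_⟩, hc'⟩
    rw [Function.iterate_succ_apply']
    exact (ht' x hx).2

/-- The interior Gauss-Lobatto nodes. -/
noncomputable def interiorNodes (n : ℕ) : Finset ℝ :=
  (derivative (legendrePoly n)).roots.toFinset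

lemma derivative_legendrePoly_ne_zero {n : ℕ} (hn : 1 ≤ n) : derivative (legendrePoly n) ≠ 0 := by
  intro h
  have := legendrePoly_deriv_eval_one_pos hn
  rw [Function.iterate_one, h] at this
  simp at this

/-- There are exactly `n - 1` interior nodes: `P_n` has `n` zeros in `(-1,1)`, Rolle's theorem
gives `n - 1` zeros of `P_n'`, and the degree allows no more. -/
lemma interiorNodes_spec {n : ℕ} (hn : 1 ≤ n) :
    (interiorNodes n).card = n - 1 ∧ ∀ x ∈ interiorNodes n, x ∈ Ioo (-1 : ℝ) 1 := by
  obtain ⟨t, ht, hc⟩ := exists_finset_roots_rodrigues n n le_rfl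
  obtain ⟨t', ht', hc'⟩ := exists_finset_roots_derivative (a := -1) (b := 1) (legendrePoly n)
    (n - 1) t (fun x hx => ⟨Ioo_subset_Icc_self (ht x hx).1, by
      rw [legendrePoly, eval_mul, (ht x hx).2, mul_zero]⟩) (by omega)
  have hsub : t' ⊆ interiorNodes n := by
    intro x hx
    rw [interiorNodes, Multiset.mem_toFinset, mem_roots (derivative_legendrePoly_ne_zero hn)]
    exact (ht' x hx).2
  have hcard : (interiorNodes n).card ≤ n - 1 := by
    refine (Multiset.toFinset_card_le _).trans ((card_roots' _).trans
      ((natDegree_derivative_le _).trans ?_))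
    have := natDegree_legendrePoly_le n
    omega
  have heq : t' = interiorNodes n := Finset.eq_of_subset_of_card_le hsub (by omega)
  exact ⟨heq ▸ hc', fun x hx => (ht' x (heq ▸ hx)).1⟩

lemma mem_interiorNodes {n : ℕ} (hn : 1 ≤ n) {x : ℝ} :
    x ∈ interiorNodes n ↔ (derivative (legendrePoly n)).eval x = 0 := by
  rw [interiorNodes, Multiset.mem_toFinset, mem_roots (derivative_legendrePoly_ne_zero hn)]
  rfl

lemma mem_gaussLobattoNodes {n : ℕ} {x : ℝ} :
    x ∈ gaussLobattoNodes n ↔ x = -1 ∨ x = 1 ∨ x ∈ interiorNodes n := by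
  simp only [gaussLobattoNodes, interiorNodes, Finset.mem_union, Finset.mem_insert,
    Finset.mem_singleton, or_assoc]

lemma gaussLobattoNodes_card {n : ℕ} (hn : 1 ≤ n) : (gaussLobattoNodes n).card = n + 1 := by
  have h := interiorNodes_spec hn
  have : gaussLobattoNodes n = insert (-1) (insert 1 (interiorNodes n)) := by
    ext x
    simp [mem_gaussLobattoNodes]
  rw [this, Finset.card_insert_of_notMem, Finset.card_insert_of_notMem, h.1]
  · omega
  · exact fun hh => lt_irrefl _ (h.2 _ hh).2
  · intro hh
    rcases Finset.mem_insert.1 hh with hh | hh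
    · norm_num at hh
    · exact lt_irrefl _ (h.2 _ hh).1

lemma gaussLobattoNodes_mem_Icc {n : ℕ} (hn : 1 ≤ n) {x : ℝ} (hx : x ∈ gaussLobattoNodes n) :
    x ∈ Icc (-1 : ℝ) 1 := by
  rcases mem_gaussLobattoNodes.1 hx with rfl | rfl | hx
  · norm_num
  · norm_num
  · exact Ioo_subset_Icc_self ((interiorNodes_spec hn).2 x hx)

end Nodes

/-! ### Stability of Gauss-Lobatto interpolation -/

section Fejer
open Polynomial

/-- The polynomial `(1 - X²) P_n'`, whose zeros are the Gauss-Lobatto points of order `n`. -/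
noncomputable def lobattoPoly (n : ℕ) : ℝ[X] := (1 - X ^ 2) * derivative (legendrePoly n)

lemma derivative_lobattoPoly (n : ℕ) :
    derivative (lobattoPoly n) = - (C ((n : ℝ) * (n + 1)) * legendrePoly n) := by
  have h := legendre_ode_selfAdjoint n 0
  simpa [lobattoPoly] using h

lemma natDegree_lobattoPoly_le {n : ℕ} (hn : 1 ≤ n) : (lobattoPoly n).natDegree ≤ n + 1 := by
  rw [lobattoPoly]
  refine natDegree_mul_le.trans ?_
  have h1 : (1 - X ^ 2 : ℝ[X]).natDegree ≤ 2 := by compute_degree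
  have h2 := natDegree_derivative_le (legendrePoly n)
  have h3 := natDegree_legendrePoly_le n
  omega

lemma lobattoPoly_eval_node {n : ℕ} (hn : 1 ≤ n) {x : ℝ} (hx : x ∈ gaussLobattoNodes n) :
    (lobattoPoly n).eval x = 0 := by
  rw [lobattoPoly, eval_mul]
  rcases mem_gaussLobattoNodes.1 hx with rfl | rfl | hx
  · simp
  · simp
  · rw [(mem_interiorNodes hn).1 hx, mul_zero]

/-- The Lagrange basis polynomials of the Gauss-Lobatto points. -/
noncomputable def lobattoBasis (n : ℕ) (i : ℝ) : ℝ[X] :=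
  Lagrange.basis (gaussLobattoNodes n) id i

lemma lobattoBasis_eval_self {n : ℕ} {i : ℝ} (hi : i ∈ gaussLobattoNodes n) :
    (lobattoBasis n i).eval i = 1 :=
  Lagrange.eval_basis_self (injOn_id _) hi

lemma lobattoBasis_eval_of_ne {n : ℕ} {i j : ℝ} (hij : i ≠ j) (hj : j ∈ gaussLobattoNodes n) :
    (lobattoBasis n i).eval j = 0 :=
  Lagrange.eval_basis_of_ne (v := id) hij hj

lemma natDegree_lobattoBasis {n : ℕ} (hn : 1 ≤ n) {i : ℝ} (hi : i ∈ gaussLobattoNodes n) :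
    (lobattoBasis n i).natDegree = n := by
  rw [lobattoBasis, Lagrange.natDegree_basis (injOn_id _) hi, gaussLobattoNodes_card hn]
  rfl

/-- The Lagrange basis polynomial of the node `i` is proportional to `lobattoPoly n / (X - i)`. -/
lemma lobattoPoly_eq_mul_basis {n : ℕ} (hn : 1 ≤ n) {i : ℝ} (hi : i ∈ gaussLobattoNodes n) :
    ∃ v : ℝ, lobattoPoly n = (X - C i) * (C v * lobattoBasis n i) := by
  obtain ⟨V, hV⟩ := dvd_iff_isRoot.2 (lobattoPoly_eval_node hn hi : (lobattoPoly n).IsRoot i)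
  have hdeg : V.degree < (gaussLobattoNodes n).card := by
    rw [gaussLobattoNodes_card hn]
    by_cases hV0 : V = 0
    · rw [hV0, degree_zero]; exact WithBot.bot_lt_coe _
    · rw [degree_eq_natDegree hV0]
      have h1 := natDegree_lobattoPoly_le hn
      rw [hV, natDegree_mul (X_sub_C_ne_zero i) hV0, natDegree_X_sub_C] at h1
      exact_mod_cast (by omega : V.natDegree < n + 1)
  refine ⟨V.eval i, ?_⟩
  rw [hV]
  congr 1
  refine eq_of_degrees_lt_of_eval_finset_eq (gaussLobattoNodes n) hdeg ?_ ?_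
  · rw [← smul_eq_C_mul]
    refine (degree_smul_le _ _).trans_lt ?_
    rw [lobattoBasis, Lagrange.degree_basis (injOn_id _) hi, gaussLobattoNodes_card hn]
    exact_mod_cast (by omega : n + 1 - 1 < n + 1)
  · intro x hx
    rcases eq_or_ne x i with rfl | hxi
    · rw [eval_mul, eval_C, lobattoBasis_eval_self hi, mul_one]
    · have h1 := lobattoPoly_eval_node hn hx
      rw [hV, eval_mul] at h1
      have h2 : (X - C i).eval x ≠ 0 := by simpa using sub_ne_zero.2 hxi
      rw [(mul_eq_zero.1 h1).resolve_left h2, eval_mul, lobattoBasis_eval_of_ne hxi.symm hx,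
        mul_zero]

/-- The derivative of a basis polynomial at its own node, from the second derivative of
`lobattoPoly n = (X - i) v ℓ_i`, where `(lobattoPoly n)'` is a multiple of `P_n`. It vanishes at
the interior nodes. -/
lemma lobattoBasis_derivative {n : ℕ} (hn : 1 ≤ n) {i : ℝ} (hi : i ∈ gaussLobattoNodes n) :
    2 * (legendrePoly n).eval i * (derivative (lobattoBasis n i)).eval i
      = (derivative (legendrePoly n)).eval i := by
  obtain ⟨v, hv⟩ := lobattoPoly_eq_mul_basis hn hi
  have h1 := congrArg derivative hv
  have h2 := congrArg derivative h1
  rw [derivative_lobattoPoly] at h1 h2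
  have h3 := congrArg (eval i) h1
  have h4 := congrArg (eval i) h2
  simp only [derivative_neg, derivative_mul, derivative_C, derivative_sub, derivative_X, zero_mul,
    zero_add, sub_zero, one_mul, derivative_add, eval_add, eval_mul, eval_neg, eval_C, eval_sub,
    eval_X, sub_self, add_zero, lobattoBasis_eval_self hi, mul_one] at h3 h4
  have hn' : (n : ℝ) * (n + 1) ≠ 0 := by positivity
  refine mul_left_cancel₀ hn' ?_
  rw [← h3] at h4
  linarith

lemma nodal_dvd_of_eval_eq_zero (s : Finset ℝ) (p : ℝ[X]) (h : ∀ x ∈ s, p.eval x = 0) :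
    Lagrange.nodal s id ∣ p := by
  rw [← modByMonic_eq_zero_iff_dvd (Lagrange.nodal_monic)]
  refine eq_zero_of_degree_lt_of_eval_finset_eq_zero s ?_ ?_
  · have := degree_modByMonic_lt p (Lagrange.nodal_monic (s := s) (v := (id : ℝ → ℝ)))
    rwa [Lagrange.degree_nodal] at this
  · intro x hx
    have h1 := modByMonic_add_div p (Lagrange.nodal s (id : ℝ → ℝ))
    have h2 := congrArg (eval x) h1
    have h3 : (Lagrange.nodal s (id : ℝ → ℝ)).eval x = 0 :=
      Lagrange.eval_nodal_at_node (v := id) hx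
    rw [eval_add, eval_mul, h3, zero_mul, add_zero, h x hx] at h2
    exact h2

/-- Fejér's inequality: the squares of the Gauss-Lobatto basis polynomials sum to at most one.
Interior nodes are double zeros of `1 - ∑ ℓ_i²`, which therefore has constant sign. -/
lemma sum_lobattoBasis_sq_le {n : ℕ} (hn : 1 ≤ n) {x : ℝ} (hx : x ∈ Icc (-1 : ℝ) 1) :
    ∑ i ∈ gaussLobattoNodes n, ((lobattoBasis n i).eval x) ^ 2 ≤ 1 := by
  set s := gaussLobattoNodes n with hs
  set t := interiorNodes n with ht
  set Q : ℝ[X] := 1 - ∑ i ∈ s, lobattoBasis n i ^ 2 with hQ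
  have ht_spec := interiorNodes_spec hn
  have hts : t ⊆ s := fun y hy => mem_gaussLobattoNodes.2 (Or.inr (Or.inr hy))
  have hQs : ∀ y ∈ s, Q.eval y = 0 := by
    intro y hy
    rw [hQ, eval_sub, eval_finsetSum, Finset.sum_eq_single y]
    · simp [lobattoBasis_eval_self hy]
    · intro i _ hi
      rw [eval_pow, lobattoBasis_eval_of_ne hi hy]
      simp
    · exact fun h => absurd hy h
  have hQ' : ∀ y ∈ s, (derivative Q).eval y = -2 * (derivative (lobattoBasis n y)).eval y := by
    intro y hy
    rw [hQ, derivative_sub, derivative_one, derivative_sum, eval_sub, eval_finsetSum,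
      Finset.sum_eq_single y]
    · rw [derivative_sq]
      simp [lobattoBasis_eval_self hy]
    · intro i _ hi
      rw [derivative_sq, eval_mul, eval_mul, lobattoBasis_eval_of_ne hi hy]
      simp
    · exact fun h => absurd hy h
  obtain ⟨S, hS⟩ := nodal_dvd_of_eval_eq_zero s Q hQs
  -- at an interior node `ℓ_y` has vanishing derivative, so `Q` has a double zero there
  have hSt : ∀ y ∈ t, S.eval y = 0 := by
    intro y hy
    have h1 := hQ' y (hts hy)
    have h2 := lobattoBasis_derivative hn (hts hy)
    rw [(mem_interiorNodes hn).1 hy] at h2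
    obtain ⟨v, hv⟩ := lobattoPoly_eq_mul_basis hn (hts hy)
    have hP : (legendrePoly n).eval y ≠ 0 := by
      intro hP
      have h3 := congrArg derivative hv
      rw [derivative_lobattoPoly] at h3
      have h4 := congrArg (eval y) h3
      simp only [derivative_mul, derivative_C, derivative_sub, derivative_X, zero_mul,
        zero_add, sub_zero, one_mul, eval_add, eval_mul, eval_neg, eval_C, eval_sub,
        eval_X, sub_self, add_zero, lobattoBasis_eval_self (hts hy), mul_one, hP, mul_zero,
        neg_zero] at h4
      rw [← h4] at hv
      simp only [map_zero, zero_mul, mul_zero, lobattoPoly] at hv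
      rcases mul_eq_zero.1 hv with h5 | h5
      · have := congrArg (eval 0) h5
        simp at this
      · exact derivative_legendrePoly_ne_zero hn h5
    have h3 : (derivative (lobattoBasis n y)).eval y = 0 := by
      rcases mul_eq_zero.1 h2 with h | h
      · exact absurd h (by simpa using hP)
      · exact h
    have h5 : (Lagrange.nodal s (id : ℝ → ℝ)).eval y = 0 :=
      Lagrange.eval_nodal_at_node (v := id) (hts hy)
    rw [h3, hS, derivative_mul, eval_add, eval_mul, eval_mul, h5, mul_zero, zero_mul,
      add_zero] at h1
    refine (mul_eq_zero.1 h1).resolve_left ?_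
    have h4 := Lagrange.eval_nodal_derivative_eval_node_eq (v := (id : ℝ → ℝ)) (hts hy)
    simp only [id] at h4
    rw [h4]
    rw [Lagrange.eval_nodal, ← ne_eq, Finset.prod_ne_zero_iff]
    intro z hz
    exact sub_ne_zero.2 (Finset.ne_of_mem_erase hz).symm
  obtain ⟨R, hR⟩ := nodal_dvd_of_eval_eq_zero t S hSt
  have hQdeg : Q.natDegree ≤ 2 * n := by
    rw [hQ]
    refine (natDegree_sub_le _ _).trans (max_le (by simp) ?_)
    refine natDegree_sum_le_of_forall_le _ _ fun i hi => ?_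
    refine natDegree_pow_le.trans ?_
    rw [natDegree_lobattoBasis hn hi]
  -- the `n + 1` nodes and the `n - 1` additional zeros exhaust the degree `2n` of `Q`
  have hRdeg : R.natDegree ≤ 0 := by
    by_cases hR0 : R = 0
    · simp [hR0]
    · have h1 : Q.natDegree = (n + 1) + ((n - 1) + R.natDegree) := by
        rw [hS, hR, natDegree_mul Lagrange.nodal_ne_zero
          (mul_ne_zero Lagrange.nodal_ne_zero hR0), natDegree_mul Lagrange.nodal_ne_zero hR0,
          Lagrange.natDegree_nodal, Lagrange.natDegree_nodal, hs, gaussLobattoNodes_card hn,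
          ht_spec.1]
      omega
  have hnod : Lagrange.nodal s (id : ℝ → ℝ) = (X ^ 2 - 1) * Lagrange.nodal t id := by
    have h1 : (1 : ℝ) ∉ insert (-1) t := by
      intro h
      rcases Finset.mem_insert.1 h with h | h
      · norm_num at h
      · exact lt_irrefl _ (ht_spec.2 _ h).2
    have h2 : (-1 : ℝ) ∉ t := fun h => lt_irrefl _ (ht_spec.2 _ h).1
    have : s = insert 1 (insert (-1) t) := by
      ext y
      simp [hs, mem_gaussLobattoNodes, ht, or_left_comm]
    rw [this, Lagrange.nodal_insert_eq_nodal h1, Lagrange.nodal_insert_eq_nodal h2]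
    simp
    ring
  set c := R.coeff 0
  have hQeq : Q = C c * ((X ^ 2 - 1) * Lagrange.nodal t id ^ 2) := by
    rw [hS, hR, hnod, eq_C_of_natDegree_le_zero hRdeg]
    ring
  -- the sign of `c` is read off from the derivative of `Q` at `1`
  have h1s : (1 : ℝ) ∈ s := mem_gaussLobattoNodes.2 (Or.inr (Or.inl rfl))
  have hc : c ≤ 0 := by
    have h1 := hQ' 1 h1s
    have h2 := lobattoBasis_derivative hn h1s
    rw [legendrePoly_eval_one] at h2
    have h3 : 0 < (derivative (legendrePoly n)).eval 1 := by
      simpa using legendrePoly_deriv_eval_one_pos hn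
    rw [hQeq] at h1
    simp only [derivative_mul, derivative_C, derivative_sub, derivative_one, derivative_X_pow,
      eval_add, eval_mul, eval_C, eval_sub, eval_pow, eval_X, eval_one] at h1
    norm_num at h1
    by_contra hc
    push Not at hc
    have : 0 ≤ c * (2 * (Lagrange.nodal t id).eval 1 ^ 2) := by positivity
    linarith
  have hfin : 0 ≤ Q.eval x := by
    rw [hQeq]
    simp only [eval_mul, eval_C, eval_sub, eval_pow, eval_X, eval_one]
    have : x ^ 2 - 1 ≤ 0 := by nlinarith [hx.1, hx.2]
    have h2 : 0 ≤ (Lagrange.nodal t id).eval x ^ 2 := by positivity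
    exact mul_nonneg_of_nonpos_of_nonpos hc (mul_nonpos_of_nonpos_of_nonneg this h2)
  rw [hQ, eval_sub, eval_finsetSum] at hfin
  simp only [eval_pow, eval_one] at hfin
  linarith

lemma gaussLobattoInterpolant_eq_sum (n : ℕ) (f : ℝ → ℝ) (x : ℝ) :
    gaussLobattoInterpolant n f x
      = ∑ i ∈ gaussLobattoNodes n, f i * (lobattoBasis n i).eval x := by
  rw [gaussLobattoInterpolant, Lagrange.interpolate_apply, eval_finsetSum]
  simp [lobattoBasis]

/-- For data vanishing at the end points, Gauss-Lobatto interpolation is bounded from `ℓ²` of the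
interior nodes to the uniform norm. -/
lemma gaussLobattoInterpolant_sq_le {n : ℕ} (hn : 1 ≤ n) (e : ℝ → ℝ) (h1 : e 1 = 0)
    (h2 : e (-1) = 0) {x : ℝ} (hx : x ∈ Icc (-1 : ℝ) 1) :
    gaussLobattoInterpolant n e x ^ 2 ≤ ∑ i ∈ interiorNodes n, e i ^ 2 := by
  have hsub : interiorNodes n ⊆ gaussLobattoNodes n :=
    fun y hy => mem_gaussLobattoNodes.2 (Or.inr (Or.inr hy))
  have hsum : ∑ i ∈ interiorNodes n, e i ^ 2 = ∑ i ∈ gaussLobattoNodes n, e i ^ 2 := by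
    refine Finset.sum_subset hsub fun y hy hy' => ?_
    rcases mem_gaussLobattoNodes.1 hy with rfl | rfl | h
    · simp [h2]
    · simp [h1]
    · exact absurd h hy'
  rw [gaussLobattoInterpolant_eq_sum, hsum]
  refine (Finset.sum_mul_sq_le_sq_mul_sq _ _ _).trans ?_
  exact mul_le_of_le_one_right (Finset.sum_nonneg fun _ _ => sq_nonneg _)
    (sum_lobattoBasis_sq_le hn hx)

end Fejer

/-! ### Separation of the Gauss-Lobatto points -/

section Gap
open Polynomial

/-- Cauchy-Schwarz inequality for interval integrals of continuous functions. -/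
lemma sq_integral_mul_le {a b : ℝ} (hab : a ≤ b) {f g : ℝ → ℝ} (hf : ContinuousOn f (Icc a b))
    (hg : ContinuousOn g (Icc a b)) :
    (∫ x in a..b, f x * g x) ^ 2 ≤ (∫ x in a..b, f x ^ 2) * ∫ x in a..b, g x ^ 2 := by
  have hf' : ContinuousOn f (uIcc a b) := by rwa [uIcc_of_le hab]
  have hg' : ContinuousOn g (uIcc a b) := by rwa [uIcc_of_le hab]
  have key : ∀ t : ℝ, 0 ≤ (∫ x in a..b, f x ^ 2) * (t * t)
      + (2 * ∫ x in a..b, f x * g x) * t + ∫ x in a..b, g x ^ 2 := by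
    intro t
    have h0 : 0 ≤ ∫ x in a..b, (t * f x + g x) ^ 2 :=
      intervalIntegral.integral_nonneg hab fun _ _ => sq_nonneg _
    have h1 : ∫ x in a..b, (t * f x + g x) ^ 2
        = (∫ x in a..b, (t * t) * f x ^ 2) + (∫ x in a..b, (2 * t) * (f x * g x))
          + ∫ x in a..b, g x ^ 2 := by
      rw [← intervalIntegral.integral_add, ← intervalIntegral.integral_add]
      · refine intervalIntegral.integral_congr fun x _ => ?_
        ring
      · exact ((continuousOn_const.mul (hf'.pow 2)).add
          (continuousOn_const.mul (hf'.mul hg'))).intervalIntegrable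
      · exact (hg'.pow 2).intervalIntegrable
      · exact (continuousOn_const.mul (hf'.pow 2)).intervalIntegrable
      · exact (continuousOn_const.mul (hf'.mul hg')).intervalIntegrable
    rw [h1, intervalIntegral.integral_const_mul, intervalIntegral.integral_const_mul] at h0
    linarith
  have := discrim_le_zero key
  rw [discrim] at this
  nlinarith

lemma hasDerivAt_artanh {x : ℝ} (hx : x ∈ Ioo (-1 : ℝ) 1) :
    HasDerivAt Real.artanh (1 / (1 - x ^ 2)) x := by
  have h1 : 0 < 1 + x := by linarith [hx.1]
  have h2 : 0 < 1 - x := by linarith [hx.2]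
  have hd : HasDerivAt (fun y : ℝ => 1 / 2 * (Real.log (1 + y) - Real.log (1 - y)))
      (1 / 2 * (1 / (1 + x) - (-1) / (1 - x))) x := by
    refine HasDerivAt.const_mul _ (HasDerivAt.sub ?_ ?_)
    · exact ((hasDerivAt_id x).const_add 1).log h1.ne'
    · exact ((hasDerivAt_id x).const_sub 1).log h2.ne'
  have he : (1 / 2 * (1 / (1 + x) - (-1) / (1 - x))) = 1 / (1 - x ^ 2) := by
    have : 1 - x ^ 2 ≠ 0 := by nlinarith
    field_simp
    ring
  rw [he] at hd
  refine hd.congr_of_eventuallyEq ?_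
  filter_upwards [isOpen_Ioo.mem_nhds hx] with y hy
  rw [Real.artanh_eq_half_log (Ioo_subset_Icc_self hy),
    Real.log_div (by linarith [hy.1]) (by linarith [hy.2])]

lemma continuousOn_one_div_one_sub_sq :
    ContinuousOn (fun x : ℝ => 1 / (1 - x ^ 2)) (Ioo (-1) 1) := by
  refine continuousOn_const.div (by fun_prop) fun x hx => ?_
  nlinarith [hx.1, hx.2]

lemma integral_one_div_one_sub_sq {a b : ℝ} (ha : -1 < a) (hab : a ≤ b) (hb : b < 1) :
    ∫ x in a..b, 1 / (1 - x ^ 2) = Real.artanh b - Real.artanh a := by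
  have hsub : uIcc a b ⊆ Ioo (-1) 1 := by
    rw [uIcc_of_le hab]; exact Icc_subset_Ioo ha hb
  exact intervalIntegral.integral_eq_sub_of_hasDerivAt (fun x hx => hasDerivAt_artanh (hsub hx))
    (continuousOn_one_div_one_sub_sq.mono hsub).intervalIntegrable

/-- Separation of the interior Gauss-Lobatto points in the hyperbolic distance: the polynomial
`W = (1 - x²) P_n'` satisfies `∫ W'² = n (n + 1) ∫ W² / (1 - x²)` between two of its zeros. -/
lemma artanh_sub_artanh_ge {n : ℕ} (hn : 1 ≤ n) {a b : ℝ} (ha : a ∈ interiorNodes n)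
    (hb : b ∈ interiorNodes n) (hab : a < b) :
    1 / ((n : ℝ) + 1) ≤ Real.artanh b - Real.artanh a := by
  have haI := (interiorNodes_spec hn).2 a ha
  have hbI := (interiorNodes_spec hn).2 b hb
  set W := lobattoPoly n with hW
  set P' := derivative (legendrePoly n) with hP'
  set L := Real.artanh b - Real.artanh a with hL
  set J := ∫ x in a..b, ((derivative W).eval x) ^ 2 with hJ
  have hWa : W.eval a = 0 :=
    lobattoPoly_eval_node hn (mem_gaussLobattoNodes.2 (Or.inr (Or.inr ha)))
  have hWb : W.eval b = 0 :=
    lobattoPoly_eval_node hn (mem_gaussLobattoNodes.2 (Or.inr (Or.inr hb)))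
  have hW'' : derivative (derivative W) = - (C ((n : ℝ) * (n + 1)) * P') := by
    rw [hW, derivative_lobattoPoly, derivative_neg, derivative_C_mul]
  -- integration by parts, the boundary terms vanishing with `W`; recall `W = (1 - x²) P_n'`
  have hparts : J = (n * (n + 1)) * ∫ x in a..b, (W * P').eval x := by
    have h1 : ∫ x in a..b, (derivative (W * derivative W)).eval x
        = (W * derivative W).eval b - (W * derivative W).eval a :=
      intervalIntegral.integral_eq_sub_of_hasDerivAt (fun x _ => Polynomial.hasDerivAt _ x)
        ((Polynomial.continuous _).intervalIntegrable _ _)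
    rw [eval_mul, eval_mul, hWa, hWb, zero_mul, zero_mul, sub_zero] at h1
    have h2 : ∀ x, (derivative (W * derivative W)).eval x
        = ((derivative W).eval x) ^ 2 - (n * (n + 1)) * (W * P').eval x := by
      intro x
      rw [derivative_mul, hW'']
      simp only [eval_add, eval_mul, eval_neg, eval_C]
      ring
    simp only [h2] at h1
    rw [intervalIntegral.integral_sub, intervalIntegral.integral_const_mul] at h1
    · linarith
    · exact (((derivative W).continuous).pow 2).intervalIntegrable _ _
    · exact (continuous_const.mul (W * P').continuous).intervalIntegrable _ _
  have hWne : derivative W ≠ 0 := by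
    intro h
    have h1 := congrArg (eval 1) (derivative_lobattoPoly n)
    rw [← hW, h] at h1
    simp [legendrePoly_eval_one] at h1
    rcases h1 with h1 | h1
    · omega
    · have : (0 : ℝ) < n + 1 := by positivity
      linarith
  have hJpos : 0 < J := by
    obtain ⟨x, hx, hpx⟩ : ∃ x ∈ Icc a b, (derivative W).eval x ≠ 0 := by
      by_contra! hc
      exact hWne (eq_zero_of_infinite_isRoot _ ((Icc_infinite hab).mono hc))
    refine intervalIntegral.integral_pos hab ((derivative W).continuous.pow 2).continuousOn
      (fun y _ => sq_nonneg _) ⟨x, hx, ?_⟩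
    positivity
  have hsub : Icc a b ⊆ Ioo (-1) 1 := Icc_subset_Ioo haI.1 hbI.2
  have hLint := integral_one_div_one_sub_sq haI.1 hab.le hbI.2
  have hint : IntervalIntegrable (fun x : ℝ => 1 / (1 - x ^ 2)) volume a b := by
    refine (continuousOn_one_div_one_sub_sq.mono ?_).intervalIntegrable
    rwa [uIcc_of_le hab.le]
  have hLab : b - a ≤ L := by
    have h1 : ∫ x in a..b, (1 : ℝ) ≤ ∫ x in a..b, 1 / (1 - x ^ 2) := by
      refine intervalIntegral.integral_mono_on hab.le (by simp) hint fun x hx => ?_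
      have := hsub hx
      rw [le_div_iff₀ (by nlinarith [this.1, this.2])]
      nlinarith
    rw [hLint] at h1
    simpa using h1
  -- Cauchy-Schwarz, starting from the zero `a` of `W`
  have hWsq : ∀ x ∈ Icc a b, W.eval x ^ 2 ≤ L * J := by
    intro x hx
    have h1 : ∫ y in a..x, 1 * (derivative W).eval y = W.eval x := by
      simp only [one_mul]
      rw [intervalIntegral.integral_eq_sub_of_hasDerivAt (fun y _ => W.hasDerivAt y)
        ((derivative W).continuous.intervalIntegrable _ _), hWa, sub_zero]
    have h2 := sq_integral_mul_le (f := fun _ => (1 : ℝ)) hx.1 continuousOn_const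
      (derivative W).continuous.continuousOn
    rw [h1] at h2
    simp only [one_pow, intervalIntegral.integral_const, smul_eq_mul, mul_one] at h2
    have h3 : ∫ y in a..x, ((derivative W).eval y) ^ 2 ≤ J := by
      refine intervalIntegral.integral_mono_interval le_rfl hx.1 hx.2 ?_ ?_
      · exact Filter.Eventually.of_forall fun y => sq_nonneg _
      · exact ((derivative W).continuous.pow 2).intervalIntegrable _ _
    have h4 : 0 ≤ ∫ y in a..x, ((derivative W).eval y) ^ 2 :=
      intervalIntegral.integral_nonneg hx.1 fun _ _ => sq_nonneg _
    have h5 : x - a ≤ L := by linarith [hx.2]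
    calc W.eval x ^ 2 ≤ (x - a) * ∫ y in a..x, ((derivative W).eval y) ^ 2 := h2
      _ ≤ L * J := mul_le_mul h5 h3 h4 (by linarith)
  -- `W P_n' = W² / (1 - x²)`, and `1 / (1 - x²)` integrates to the hyperbolic length `L`
  have hbound : ∫ x in a..b, (W * P').eval x ≤ L * J * L := by
    rw [← hL] at hLint
    rw [← hLint, ← intervalIntegral.integral_const_mul, hLint]
    refine intervalIntegral.integral_mono_on hab.le ((W * P').continuous.intervalIntegrable _ _)
      (hint.const_mul _) fun x hx => ?_
    have hx' := hsub hx
    have hpos : 0 < 1 - x ^ 2 := by nlinarith [hx'.1, hx'.2]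
    rw [mul_one_div, le_div_iff₀ hpos]
    have : (W * P').eval x * (1 - x ^ 2) = W.eval x ^ 2 := by
      simp only [hW, lobattoPoly, eval_mul, eval_sub, eval_one, eval_pow, eval_X]
      ring
    rw [this]
    exact hWsq x hx
  have hfin : 1 ≤ (n * (n + 1)) * L ^ 2 := by
    have h1 : J ≤ (n * (n + 1)) * (L * J * L) := by
      rw [hparts] at *
      exact mul_le_mul_of_nonneg_left hbound (by positivity)
    have h2 : J * 1 ≤ J * ((n * (n + 1)) * L ^ 2) := by linarith
    exact le_of_mul_le_mul_left h2 hJpos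
  have hLpos : 0 < L := by linarith
  rw [div_le_iff₀ (by positivity)]
  have hn0 : (0 : ℝ) ≤ n := by positivity
  by_contra! hc
  nlinarith [mul_pos hLpos hLpos, mul_pos hLpos (show (0 : ℝ) < n + 1 by positivity)]

/-- A discrete `ℓ²` bound over points separated in the hyperbolic distance: the intervals of
hyperbolic length `τ` to the right of the points are disjoint, and the value at each point is
compared with the average of the function over its interval. -/
lemma sum_sq_le_of_separated (t : Finset ℝ) (ht : ∀ a ∈ t, a ∈ Ioo (-1 : ℝ) 1) {τ : ℝ}
    (hτ : 0 < τ) (hsep : ∀ a ∈ t, ∀ b ∈ t, a < b → τ ≤ Real.artanh b - Real.artanh a)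
    (S : ℝ[X]) :
    τ * ∑ a ∈ t, (((1 - X ^ 2) * S).eval a) ^ 2 ≤ polyIntegral ((1 - X ^ 2) * S ^ 2)
      + τ * ∫ x in (-1 : ℝ)..1,
          2 * |((1 - X ^ 2) * S).eval x * (derivative ((1 - X ^ 2) * S)).eval x| := by
  set E : ℝ[X] := (1 - X ^ 2) * S with hE
  set F : ℝ → ℝ := fun x => 2 * |E.eval x * (derivative E).eval x| with hF
  have hFc : Continuous F := by
    have h1 := E.continuous
    have h2 := (derivative E).continuous
    fun_prop
  have hF0 : ∀ x, 0 ≤ F x := fun x => by positivity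
  set G : ℝ → ℝ := fun x => ((1 - X ^ 2) * S ^ 2).eval x + τ * F x with hG
  have hGc : Continuous G := (Polynomial.continuous _).add (continuous_const.mul hFc)
  have hGint : ∀ a b : ℝ, ∫ x in a..b, G x
      = (∫ x in a..b, ((1 - X ^ 2) * S ^ 2).eval x) + τ * ∫ x in a..b, F x := by
    intro a b
    rw [← intervalIntegral.integral_const_mul]
    exact intervalIntegral.integral_add ((Polynomial.continuous _).intervalIntegrable _ _)
      ((continuous_const.mul hFc).intervalIntegrable _ _)
  -- `(a, β a]` is the interval of hyperbolic length `τ` to the right of `a`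
  set β : ℝ → ℝ := fun a => Real.tanh (Real.artanh a + τ) with hβ
  have hβI : ∀ a, β a ∈ Ioo (-1 : ℝ) 1 := fun a => ⟨Real.neg_one_lt_tanh _, Real.tanh_lt_one _⟩
  have hβart : ∀ a, Real.artanh (β a) = Real.artanh a + τ := fun a => Real.artanh_tanh _
  have hβlt : ∀ a ∈ t, a < β a := by
    intro a ha
    rw [← Real.artanh_lt_artanh_iff (ht a ha) (hβI a), hβart]
    linarith
  have hone : ∀ a ∈ t, τ * E.eval a ^ 2 ≤ ∫ x in Ioc a (β a), G x := by
    intro a ha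
    have hab := (hβlt a ha).le
    have hsub : Icc a (β a) ⊆ Ioo (-1) 1 := Icc_subset_Ioo (ht a ha).1 (hβI a).2
    have hint : IntervalIntegrable (fun x : ℝ => 1 / (1 - x ^ 2)) volume a (β a) := by
      refine (continuousOn_one_div_one_sub_sq.mono ?_).intervalIntegrable
      rwa [uIcc_of_le hab]
    have hL := integral_one_div_one_sub_sq (ht a ha).1 hab (hβI a).2
    rw [hβart, add_sub_cancel_left] at hL
    set K := ∫ y in a..β a, F y with hK
    have hE2 : ∀ x ∈ Icc a (β a), E.eval a ^ 2 ≤ E.eval x ^ 2 + K := by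
      intro x hx
      have h1 : ∫ y in a..x, (derivative (E ^ 2)).eval y = E.eval x ^ 2 - E.eval a ^ 2 := by
        rw [intervalIntegral.integral_eq_sub_of_hasDerivAt
          (fun y _ => Polynomial.hasDerivAt (E ^ 2) y)
          ((Polynomial.continuous _).intervalIntegrable _ _)]
        simp
      have h2 : ∫ y in a..x, - F y ≤ ∫ y in a..x, (derivative (E ^ 2)).eval y := by
        refine intervalIntegral.integral_mono_on hx.1 (hFc.neg.intervalIntegrable _ _)
          ((Polynomial.continuous _).intervalIntegrable _ _) fun y _ => ?_
        rw [derivative_sq]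
        simp only [eval_mul, eval_C]
        have := neg_abs_le (E.eval y * (derivative E).eval y)
        simp only [hF]
        linarith
      rw [intervalIntegral.integral_neg] at h2
      have h3 : ∫ y in a..x, F y ≤ K :=
        intervalIntegral.integral_mono_interval le_rfl hx.1 hx.2
          (Filter.Eventually.of_forall hF0) (hFc.intervalIntegrable _ _)
      linarith
    have hpoly : Continuous fun x => ((1 - X ^ 2) * S ^ 2 : ℝ[X]).eval x :=
      Polynomial.continuous _
    have h1 : ∫ x in a..β a, E.eval a ^ 2 * (1 / (1 - x ^ 2))
        ≤ ∫ x in a..β a, (((1 - X ^ 2) * S ^ 2).eval x + K * (1 / (1 - x ^ 2))) := by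
      refine intervalIntegral.integral_mono_on hab (hint.const_mul _)
        ((hpoly.intervalIntegrable _ _).add (hint.const_mul _)) fun x hx => ?_
      have hx' := hsub hx
      have hpos : 0 < 1 - x ^ 2 := by nlinarith [hx'.1, hx'.2]
      have h2 : ((1 - X ^ 2) * S ^ 2).eval x = E.eval x ^ 2 * (1 / (1 - x ^ 2)) := by
        simp only [hE, eval_mul, eval_sub, eval_one, eval_pow, eval_X]
        field_simp
      rw [h2, ← add_mul]
      exact mul_le_mul_of_nonneg_right (hE2 x hx) (by positivity)
    rw [intervalIntegral.integral_const_mul, hL, intervalIntegral.integral_add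
      (hpoly.intervalIntegrable _ _) (hint.const_mul _), intervalIntegral.integral_const_mul,
      hL] at h1
    have h2 : ∫ x in Ioc a (β a), G x
        = (∫ x in a..β a, ((1 - X ^ 2) * S ^ 2).eval x) + τ * K := by
      rw [← intervalIntegral.integral_of_le hab, hGint]
    rw [h2]
    linarith
  have hdisj : Set.Pairwise (t : Set ℝ) (Function.onFun Disjoint fun a => Ioc a (β a)) := by
    have key : ∀ a ∈ t, ∀ b ∈ t, a < b → Disjoint (Ioc a (β a)) (Ioc b (β b)) := by
      intro a ha b hb hab
      have h1 : β a ≤ b := by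
        rw [← Real.artanh_le_artanh_iff (hβI a) (ht b hb), hβart]
        linarith [hsep a ha b hb hab]
      exact Set.disjoint_left.2 fun x hx hx' => absurd (hx.2.trans h1) (not_le.2 hx'.1)
    intro a ha b hb hab
    rcases lt_or_gt_of_ne hab with h | h
    · exact key a ha b hb h
    · exact (key b hb a ha h).symm
  have hGon : IntegrableOn G (Ioc (-1) 1) :=
    (hGc.integrableOn_Icc (a := -1) (b := 1)).mono_set Ioc_subset_Icc_self
  have hsubset : ∀ a ∈ t, Ioc a (β a) ⊆ Ioc (-1) 1 := fun a ha =>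
    Ioc_subset_Ioc (ht a ha).1.le (hβI a).2.le
  calc τ * ∑ a ∈ t, E.eval a ^ 2 = ∑ a ∈ t, τ * E.eval a ^ 2 := Finset.mul_sum _ _ _
    _ ≤ ∑ a ∈ t, ∫ x in Ioc a (β a), G x := Finset.sum_le_sum hone
    _ = ∫ x in ⋃ a ∈ t, Ioc a (β a), G x :=
        (integral_biUnion_finset t (fun _ _ => measurableSet_Ioc) hdisj
          fun a ha => hGon.mono_set (hsubset a ha)).symm
    _ ≤ ∫ x in Ioc (-1) 1, G x := by
        refine setIntegral_mono_set hGon ?_ (LE.le.eventuallyLE (iUnion₂_subset hsubset))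
        filter_upwards [ae_restrict_mem measurableSet_Ioc] with x hx
        have h1 : 0 ≤ 1 - x ^ 2 := by nlinarith [hx.1, hx.2]
        have h2 := hF0 x
        simp only [hG, eval_mul, eval_sub, eval_one, eval_pow, eval_X, Pi.zero_apply]
        positivity
    _ = _ := by
        rw [← intervalIntegral.integral_of_le (by norm_num), hGint, polyIntegral_apply]

/-- If `E = (1 - x²) S` satisfies the Poincaré-type inequality of the orthogonal complement of
polynomials of low degree, then both `E` and its Gauss-Lobatto interpolant are uniformly of size
`‖E'‖_{L²} / √n`. -/
lemma interpolant_and_sup_bound {n : ℕ} (hn : 1 ≤ n) (S : ℝ[X])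
    (hp : (n : ℝ) * (n + 1) * polyIntegral ((1 - X ^ 2) * S ^ 2)
      ≤ polyIntegral (derivative ((1 - X ^ 2) * S) ^ 2)) {x : ℝ} (hx : x ∈ Icc (-1 : ℝ) 1) :
    gaussLobattoInterpolant n (fun y => ((1 - X ^ 2) * S).eval y) x ^ 2
        ≤ 3 * (polyIntegral (derivative ((1 - X ^ 2) * S) ^ 2) / n) ∧
      (((1 - X ^ 2) * S).eval x) ^ 2
        ≤ 2 * (polyIntegral (derivative ((1 - X ^ 2) * S) ^ 2) / n) := by
  set E : ℝ[X] := (1 - X ^ 2) * S with hE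
  set D := polyIntegral (derivative E ^ 2) with hD
  set V := polyIntegral ((1 - X ^ 2) * S ^ 2) with hV
  have hnpos : (0 : ℝ) < n := by exact_mod_cast hn
  have hV0 : 0 ≤ V := polyIntegral_nonneg fun y hy => by
    simp only [eval_mul, eval_sub, eval_one, eval_pow, eval_X]
    have : 0 ≤ 1 - y ^ 2 := by nlinarith [hy.1, hy.2]
    positivity
  have hD0 : 0 ≤ D := polyIntegral_nonneg fun y _ => by
    simp only [eval_pow]; positivity
  set F : ℝ → ℝ := fun x => 2 * |E.eval x * (derivative E).eval x| with hF
  have hFc : Continuous F := by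
    have h1 := E.continuous
    have h2 := (derivative E).continuous
    fun_prop
  have hF0 : ∀ x, 0 ≤ F x := fun x => by positivity
  have hFint : ∫ y in (-1 : ℝ)..1, F y ≤ n * V + D / n := by
    have h1 : ∫ y in (-1 : ℝ)..1, F y ≤
        polyIntegral (C (n : ℝ) * ((1 - X ^ 2) * S ^ 2) + C (1 / (n : ℝ)) * derivative E ^ 2) := by
      refine intervalIntegral.integral_mono_on (by norm_num) (hFc.intervalIntegrable _ _)
        ((Polynomial.continuous _).intervalIntegrable _ _) fun y hy => ?_
      have hw0 : 0 ≤ 1 - y ^ 2 := by nlinarith [hy.1, hy.2]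
      have hw1 : 1 - y ^ 2 ≤ 1 := by nlinarith
      have hEy : E.eval y ^ 2 ≤ (1 - y ^ 2) * S.eval y ^ 2 := by
        simp only [hE, eval_mul, eval_sub, eval_one, eval_pow, eval_X]
        have := mul_nonneg hw0 (sq_nonneg (S.eval y))
        nlinarith
      -- the weights `n` and `1 / n` balance the two integrals bounded in `hp`
      have ham : 2 * |E.eval y * (derivative E).eval y|
          ≤ n * E.eval y ^ 2 + 1 / n * (derivative E).eval y ^ 2 := by
        rw [abs_mul, ← sq_abs (E.eval y), ← sq_abs ((derivative E).eval y)]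
        set u := |E.eval y|
        set v := |(derivative E).eval y|
        have h := sq_nonneg (n * u - v)
        have : n * u ^ 2 + 1 / n * v ^ 2 - 2 * (u * v) = (n * u - v) ^ 2 / n := by
          field_simp
          ring
        have h2 : 0 ≤ (n * u - v) ^ 2 / n := by positivity
        linarith
      simp only [eval_add, eval_mul, eval_C, eval_pow, eval_sub, eval_one, eval_X, hF]
      have := mul_le_mul_of_nonneg_left hEy hnpos.le
      simp only [hE, eval_mul, eval_pow, eval_sub, eval_one, eval_X] at ham this ⊢
      linarith
    rw [map_add, polyIntegral_C_mul, polyIntegral_C_mul] at h1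
    have : 1 / (n : ℝ) * polyIntegral (derivative E ^ 2) = D / n := by rw [hD]; ring
    rwa [this] at h1
  have hnV : n * V ≤ D / n := by
    rw [le_div_iff₀ hnpos]
    nlinarith [mul_nonneg hnpos.le hV0]
  have hE1 : E.eval 1 = 0 := by simp [hE]
  have hE2 : E.eval (-1) = 0 := by simp [hE]
  constructor
  · refine (gaussLobattoInterpolant_sq_le hn _ hE1 hE2 hx).trans ?_
    have h1 := sum_sq_le_of_separated (interiorNodes n) (interiorNodes_spec hn).2
      (τ := 1 / ((n : ℝ) + 1)) (by positivity)
      (fun a ha b hb hab => artanh_sub_artanh_ge hn ha hb hab) S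
    rw [← hE, ← hV] at h1
    have hn1 : (0 : ℝ) < n + 1 := by positivity
    have h2 : ∑ a ∈ interiorNodes n, E.eval a ^ 2
        ≤ (n + 1) * V + ∫ y in (-1 : ℝ)..1, F y := by
      have := mul_le_mul_of_nonneg_left h1 hn1.le
      field_simp at this
      linarith
    have h3 : (n + 1) * V ≤ D / n := by
      rw [le_div_iff₀ hnpos]; linarith
    linarith
  · have h1 : ∫ y in (-1 : ℝ)..x, (derivative (E ^ 2)).eval y = E.eval x ^ 2 := by
      rw [intervalIntegral.integral_eq_sub_of_hasDerivAt
        (fun y _ => Polynomial.hasDerivAt (E ^ 2) y)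
        ((Polynomial.continuous _).intervalIntegrable _ _)]
      simp [hE2]
    have h2 : ∫ y in (-1 : ℝ)..x, (derivative (E ^ 2)).eval y ≤ ∫ y in (-1 : ℝ)..x, F y := by
      refine intervalIntegral.integral_mono_on hx.1
        ((Polynomial.continuous _).intervalIntegrable _ _) (hFc.intervalIntegrable _ _)
        fun y _ => ?_
      rw [derivative_sq]
      simp only [eval_mul, eval_C]
      have := le_abs_self (E.eval y * (derivative E).eval y)
      simp only [hF]
      linarith
    have h3 : ∫ y in (-1 : ℝ)..x, F y ≤ ∫ y in (-1 : ℝ)..1, F y :=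
      intervalIntegral.integral_mono_interval le_rfl hx.1 hx.2
        (Filter.Eventually.of_forall hF0) (hFc.intervalIntegrable _ _)
    linarith

end Gap

/-! ### Quantitative calculus on an interval -/

/-- `u` is absolutely continuous on `[a,b]` with integrable derivative `v`. The values of `u` and
`v` outside `[a,b]` play no role. -/
def IsPrimitiveOn (a b : ℝ) (u v : ℝ → ℝ) : Prop :=
  IntervalIntegrable v volume a b ∧ ∀ x ∈ Icc a b, u x = u a + ∫ t in a..x, v t

/-- `u` is a good representative of a `W^{k,1}(a,b)` function, all of whose derivatives of order
at most `k` have `L¹` norm at most `N`. The definition is recursive in the order, which suits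
inductions through the product and chain rules; the bound is carried along as a number, so that
constants can be chosen before the function. -/
def SobolevBound (a b : ℝ) : ℕ → (ℝ → ℝ) → ℝ → Prop
  | 0, u, N => IntervalIntegrable u volume a b ∧ ∫ x in a..b, |u x| ≤ N
  | k + 1, u, N => ∫ x in a..b, |u x| ≤ N ∧ ∃ v, IsPrimitiveOn a b u v ∧ SobolevBound a b k v N

/-- `g` is of class `C^k` on `[a,b]`, all derivatives of order at most `k` being bounded
by `B`. At the end points the derivatives are one-sided. -/
def SmoothBound (a b : ℝ) : ℕ → (ℝ → ℝ) → ℝ → Prop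
  | 0, g, B => ContinuousOn g (Icc a b) ∧ ∀ x ∈ Icc a b, |g x| ≤ B
  | k + 1, g, B => (∀ x ∈ Icc a b, |g x| ≤ B) ∧
      ∃ g' : ℝ → ℝ, (∀ x ∈ Icc a b, HasDerivWithinAt g (g' x) (Icc a b) x) ∧
        SmoothBound a b k g' B

namespace SmoothBound

variable {a b : ℝ} {k : ℕ} {g h : ℝ → ℝ} {B B' : ℝ}

lemma bound (hg : SmoothBound a b k g B) : ∀ x ∈ Icc a b, |g x| ≤ B := by
  cases k with
  | zero => exact hg.2
  | succ k => exact hg.1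

lemma continuousOn (hg : SmoothBound a b k g B) : ContinuousOn g (Icc a b) := by
  cases k with
  | zero => exact hg.1
  | succ k =>
    obtain ⟨g', hd, -⟩ := hg.2
    exact fun x hx => (hd x hx).continuousWithinAt

lemma nonneg (hab : a ≤ b) (hg : SmoothBound a b k g B) : 0 ≤ B :=
  (abs_nonneg _).trans (hg.bound a (left_mem_Icc.2 hab))

lemma mono (hg : SmoothBound a b k g B) (hB : B ≤ B') : SmoothBound a b k g B' := by
  induction k generalizing g with
  | zero => exact ⟨hg.1, fun x hx => (hg.2 x hx).trans hB⟩
  | succ k ih =>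
    obtain ⟨h1, g', hd, h2⟩ := hg
    exact ⟨fun x hx => (h1 x hx).trans hB, g', hd, ih h2⟩

lemma pred (hg : SmoothBound a b (k + 1) g B) : SmoothBound a b k g B := by
  induction k generalizing g with
  | zero => exact ⟨hg.continuousOn, hg.1⟩
  | succ k ih =>
    obtain ⟨h1, g', hd, h2⟩ := hg
    exact ⟨h1, g', hd, ih h2⟩

lemma add (hg : SmoothBound a b k g B) (hh : SmoothBound a b k h B') :
    SmoothBound a b k (fun x => g x + h x) (B + B') := by
  induction k generalizing g h with
  | zero =>
    exact ⟨hg.1.add hh.1, fun x hx =>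
      (abs_add_le _ _).trans (add_le_add (hg.2 x hx) (hh.2 x hx))⟩
  | succ k ih =>
    obtain ⟨h1, g', hd, h2⟩ := hg
    obtain ⟨h1', h', hd', h2'⟩ := hh
    exact ⟨fun x hx => (abs_add_le _ _).trans (add_le_add (h1 x hx) (h1' x hx)), _,
      fun x hx => (hd x hx).add (hd' x hx), ih h2 h2'⟩

lemma neg (hg : SmoothBound a b k g B) : SmoothBound a b k (fun x => -g x) B := by
  induction k generalizing g with
  | zero => exact ⟨hg.1.neg, fun x hx => by rw [abs_neg]; exact hg.2 x hx⟩
  | succ k ih =>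
    obtain ⟨h1, g', hd, h2⟩ := hg
    exact ⟨fun x hx => by rw [abs_neg]; exact h1 x hx, _, fun x hx => (hd x hx).neg, ih h2⟩

lemma mul (hab : a ≤ b) (hg : SmoothBound a b k g B) (hh : SmoothBound a b k h B') :
    SmoothBound a b k (fun x => g x * h x) (2 ^ k * (B * B')) := by
  have hB := hg.nonneg hab
  have hB' := hh.nonneg hab
  have hbd : ∀ x ∈ Icc a b, |g x * h x| ≤ B * B' := fun x hx => by
    rw [abs_mul]
    exact mul_le_mul (hg.bound x hx) (hh.bound x hx) (abs_nonneg _) hB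
  induction k generalizing g h with
  | zero => simpa using ⟨hg.1.mul hh.1, hbd⟩
  | succ k ih =>
    have hg0 := hg.pred
    have hh0 := hh.pred
    obtain ⟨h1, g', hd, h2⟩ := hg
    obtain ⟨h1', h', hd', h2'⟩ := hh
    have hbd1 : ∀ x ∈ Icc a b, |g' x * h x| ≤ B * B' := fun x hx => by
      rw [abs_mul]
      exact mul_le_mul (h2.bound x hx) (h1' x hx) (abs_nonneg _) hB
    have hbd2 : ∀ x ∈ Icc a b, |g x * h' x| ≤ B * B' := fun x hx => by
      rw [abs_mul]
      exact mul_le_mul (h1 x hx) (h2'.bound x hx) (abs_nonneg _) hB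
    refine ⟨fun x hx => (hbd x hx).trans ?_, _, fun x hx => (hd x hx).mul (hd' x hx), ?_⟩
    · exact le_mul_of_one_le_left (by positivity) (one_le_pow₀ (by norm_num))
    · have := (ih h2 hh0 hbd1).add (ih hg0 h2' hbd2)
      rw [← two_mul, ← mul_assoc, ← pow_succ'] at this
      exact this

end SmoothBound

/-- Reciprocals of `C^k` functions bounded below; the bound depends only on `k`, the lower bound
and the bound of the function. -/
lemma exists_smoothBound_inv (k : ℕ) (κ B : ℝ) (hκ : 0 < κ) :
    ∃ C : ℝ, ∀ (a b : ℝ) (g : ℝ → ℝ), a ≤ b → SmoothBound a b k g B →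
      (∀ x ∈ Icc a b, κ ≤ g x) → SmoothBound a b k (fun x => (g x)⁻¹) C := by
  induction k with
  | zero =>
    refine ⟨κ⁻¹, fun a b g _ hg hκg => ⟨hg.1.inv₀ fun x hx => ?_, fun x hx => ?_⟩⟩
    · exact (hκ.trans_le (hκg x hx)).ne'
    · rw [abs_of_nonneg (inv_nonneg.2 (hκ.le.trans (hκg x hx)))]
      exact inv_anti₀ hκ (hκg x hx)
  | succ k ih =>
    obtain ⟨C, hC⟩ := ih
    refine ⟨max κ⁻¹ (2 ^ k * (B * (2 ^ k * (C * C)))), fun a b g hab hg hκg => ?_⟩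
    have hi := hC a b g hab hg.pred hκg
    obtain ⟨h1, g', hd, h2⟩ := hg
    refine ⟨fun x hx => ?_, fun x => -(g' x * ((g x)⁻¹ * (g x)⁻¹)), fun x hx => ?_, ?_⟩
    · rw [abs_of_nonneg (inv_nonneg.2 (hκ.le.trans (hκg x hx)))]
      exact (inv_anti₀ hκ (hκg x hx)).trans (le_max_left _ _)
    · have hne : g x ≠ 0 := (hκ.trans_le (hκg x hx)).ne'
      have h3 := (hd x hx).inv hne
      have h4 : -g' x / g x ^ 2 = -(g' x * ((g x)⁻¹ * (g x)⁻¹)) := by field_simp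
      rw [h4] at h3
      exact h3
    · exact ((h2.mul hab (hi.mul hab hi)).neg).mono (le_max_right _ _)

lemma SmoothBound.comp_zero {a b c d : ℝ} {h φ : ℝ → ℝ} {B : ℝ} (hh : SmoothBound c d 0 h B)
    (hφ : ContinuousOn φ (Icc a b)) (hm : MapsTo φ (Icc a b) (Icc c d)) :
    SmoothBound a b 0 (fun x => h (φ x)) B :=
  ⟨hh.1.comp hφ hm, fun _ hx => hh.2 _ (hm hx)⟩

/-- Compositions of `C^{k+1}` functions; no bound on the values of the inner function is needed. -/
lemma exists_smoothBound_comp (k : ℕ) (B B' : ℝ) :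
    ∃ C : ℝ, ∀ (a b c d : ℝ) (h φ φ' : ℝ → ℝ), a ≤ b → SmoothBound c d (k + 1) h B →
      MapsTo φ (Icc a b) (Icc c d) →
      (∀ x ∈ Icc a b, HasDerivWithinAt φ (φ' x) (Icc a b) x) → SmoothBound a b k φ' B' →
      SmoothBound a b (k + 1) (fun x => h (φ x)) C := by
  induction k with
  | zero =>
    refine ⟨max B (B * B'), fun a b c d h φ φ' hab hh hm hd hφ' => ?_⟩
    have hφc : ContinuousOn φ (Icc a b) := fun x hx => (hd x hx).continuousWithinAt
    obtain ⟨h1, h', hdh, h2⟩ := hh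
    refine ⟨fun x hx => (h1 _ (hm hx)).trans (le_max_left _ _), fun x => h' (φ x) * φ' x,
      fun x hx => (hdh _ (hm hx)).comp x (hd x hx) hm, ?_⟩
    have := (h2.comp_zero hφc hm).mul hab hφ'
    rw [pow_zero, one_mul] at this
    exact this.mono (le_max_right _ _)
  | succ k ih =>
    obtain ⟨C, hC⟩ := ih
    refine ⟨max B (2 ^ (k + 1) * (C * B')), fun a b c d h φ φ' hab hh hm hd hφ' => ?_⟩
    obtain ⟨h1, h', hdh, h2⟩ := hh
    refine ⟨fun x hx => (h1 _ (hm hx)).trans (le_max_left _ _), fun x => h' (φ x) * φ' x,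
      fun x hx => (hdh _ (hm hx)).comp x (hd x hx) hm, ?_⟩
    exact ((hC a b c d h' φ φ' hab h2 hm hd hφ'.pred).mul hab hφ').mono (le_max_right _ _)

/-- Derivatives of an inverse function are controlled by those of the function. -/
lemma exists_smoothBound_inverse (k : ℕ) (κ B : ℝ) (hκ : 0 < κ) :
    ∃ C : ℝ, ∀ (a b c d : ℝ) (g' ψ : ℝ → ℝ), a ≤ b → c ≤ d → SmoothBound a b k g' B →
      (∀ x ∈ Icc a b, κ ≤ g' x) → MapsTo ψ (Icc c d) (Icc a b) →
      (∀ y ∈ Icc c d, HasDerivWithinAt ψ (g' (ψ y))⁻¹ (Icc c d) y) →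
      SmoothBound c d k (fun y => (g' (ψ y))⁻¹) C := by
  induction k with
  | zero =>
    obtain ⟨C, hC⟩ := exists_smoothBound_inv 0 κ B hκ
    refine ⟨C, fun a b c d g' ψ hab hcd hg hκg hm hd => ?_⟩
    exact (hC a b g' hab hg hκg).comp_zero (fun y hy => (hd y hy).continuousWithinAt) hm
  | succ k ih =>
    obtain ⟨C1, hC1⟩ := ih
    obtain ⟨C2, hC2⟩ := exists_smoothBound_inv (k + 1) κ B hκ
    obtain ⟨C3, hC3⟩ := exists_smoothBound_comp k C2 C1
    refine ⟨C3, fun a b c d g' ψ hab hcd hg hκg hm hd => ?_⟩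
    exact hC3 c d a b _ ψ _ hcd (hC2 a b g' hab hg hκg) hm hd
      (hC1 a b c d g' ψ hab hcd hg.pred hκg hm hd)

namespace IsPrimitiveOn

variable {a b : ℝ} {u v u' v' : ℝ → ℝ}

lemma absolutelyContinuous (h : IsPrimitiveOn a b u v) :
    AbsolutelyContinuousOnInterval (fun x => u a + ∫ t in a..x, v t) a b := by
  have h1 := h.1.absolutelyContinuousOnInterval_intervalIntegral (c := a) left_mem_uIcc
  have h2 : AbsolutelyContinuousOnInterval (fun _ : ℝ => u a) a b :=
    (LipschitzWith.const (u a)).lipschitzOnWith.absolutelyContinuousOnInterval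
  exact h2.add h1

lemma continuousOn (hab : a ≤ b) (h : IsPrimitiveOn a b u v) : ContinuousOn u (Icc a b) := by
  have := h.absolutelyContinuous.continuousOn
  rw [uIcc_of_le hab] at this
  exact this.congr h.2

lemma intervalIntegrable (hab : a ≤ b) (h : IsPrimitiveOn a b u v) :
    IntervalIntegrable u volume a b := by
  have := h.continuousOn hab
  rw [← uIcc_of_le hab] at this
  exact this.intervalIntegrable

lemma sub_eq (h : IsPrimitiveOn a b u v) {x y : ℝ} (hx : x ∈ Icc a b) (hy : y ∈ Icc a b) :
    u y - u x = ∫ t in x..y, v t := by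
  have hsub : ∀ z ∈ Icc a b, IntervalIntegrable v volume a z := fun z hz =>
    h.1.mono_set (by
      rw [uIcc_of_le hz.1, uIcc_of_le (hz.1.trans hz.2)]
      exact Icc_subset_Icc le_rfl hz.2)
  rw [h.2 x hx, h.2 y hy, ← intervalIntegral.integral_interval_sub_left (hsub y hy) (hsub x hx)]
  ring

lemma add (h : IsPrimitiveOn a b u v) (h' : IsPrimitiveOn a b u' v') :
    IsPrimitiveOn a b (fun x => u x + u' x) (fun x => v x + v' x) := by
  refine ⟨h.1.add h'.1, fun x hx => ?_⟩
  have hsub : ∀ {w : ℝ → ℝ}, IntervalIntegrable w volume a b → IntervalIntegrable w volume a x :=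
    fun hw => hw.mono_set (by
      rw [uIcc_of_le hx.1, uIcc_of_le (hx.1.trans hx.2)]
      exact Icc_subset_Icc le_rfl hx.2)
  rw [intervalIntegral.integral_add (hsub h.1) (hsub h'.1)]
  simp only
  rw [h.2 x hx, h'.2 x hx]
  ring

/-- The product rule for absolutely continuous functions. -/
lemma mul (hab : a ≤ b) (h : IsPrimitiveOn a b u v) (h' : IsPrimitiveOn a b u' v') :
    IsPrimitiveOn a b (fun x => u x * u' x) (fun x => v x * u' x + u x * v' x) := by
  have hc := h.continuousOn hab
  have hc' := h'.continuousOn hab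
  rw [← uIcc_of_le hab] at hc hc'
  refine ⟨(h.1.mul_continuousOn hc').add (h'.1.continuousOn_mul hc), fun x hx => ?_⟩
  have hux : uIcc a x ⊆ uIcc a b := by
    rw [uIcc_of_le hx.1, uIcc_of_le hab]
    exact Icc_subset_Icc le_rfl hx.2
  have h1 := h.absolutelyContinuous.mono hux
  have h1' := h'.absolutelyContinuous.mono hux
  have key := h1.integral_deriv_mul_eq_sub h1'
  have hae : ∀ᵐ t, t ∈ uIoc a x →
      v t * u' t + u t * v' t = deriv (fun x => u a + ∫ t in a..x, v t) t *
        (u' a + ∫ s in a..t, v' s) + (u a + ∫ s in a..t, v s) *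
          deriv (fun x => u' a + ∫ t in a..x, v' t) t := by
    filter_upwards [h.1.ae_hasDerivAt_integral, h'.1.ae_hasDerivAt_integral] with t ht ht' htx
    have hm : t ∈ uIcc a b := hux (uIoc_subset_uIcc htx)
    have hm' : t ∈ Icc a b := by rwa [uIcc_of_le hab] at hm
    rw [((ht hm a left_mem_uIcc).const_add (u a)).deriv,
      ((ht' hm a left_mem_uIcc).const_add (u' a)).deriv, ← h.2 t hm', ← h'.2 t hm']
  rw [intervalIntegral.integral_congr_ae hae, key]
  simp only [intervalIntegral.integral_same, add_zero]
  rw [← h.2 x hx, ← h'.2 x hx]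
  ring

lemma of_hasDerivWithinAt (hab : a ≤ b)
    (hd : ∀ x ∈ Icc a b, HasDerivWithinAt u (v x) (Icc a b) x) (hv : ContinuousOn v (Icc a b)) :
    IsPrimitiveOn a b u v := by
  have hv' : IntervalIntegrable v volume a b := by
    rw [← uIcc_of_le hab] at hv
    exact hv.intervalIntegrable
  refine ⟨hv', fun x hx => ?_⟩
  rw [intervalIntegral.integral_eq_sub_of_hasDeriv_right_of_le hx.1]
  · ring
  · exact fun y hy => ((hd y ⟨hy.1, hy.2.trans hx.2⟩).continuousWithinAt).mono
      (Icc_subset_Icc le_rfl hx.2)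
  · intro y hy
    have hy' : y ∈ Icc a b := ⟨hy.1.le, hy.2.le.trans hx.2⟩
    refine ((hd y hy').mono_of_mem_nhdsWithin ?_)
    exact mem_nhdsWithin_of_mem_nhds (Icc_mem_nhds hy.1 (hy.2.trans_le hx.2))
  · exact hv'.mono_set (by
      rw [uIcc_of_le hx.1, uIcc_of_le hab]
      exact Icc_subset_Icc le_rfl hx.2)

lemma congr_right (hab : a ≤ b) (h : IsPrimitiveOn a b u v)
    (hv : ∀ᵐ x, x ∈ Ioc a b → v x = v' x) : IsPrimitiveOn a b u v' := by
  refine ⟨h.1.congr_ae ?_, fun x hx => ?_⟩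
  · rw [uIoc_of_le hab]
    exact (ae_restrict_iff' measurableSet_Ioc).2 hv
  · rw [h.2 x hx]
    congr 1
    refine intervalIntegral.integral_congr_ae ?_
    rw [uIoc_of_le hx.1]
    filter_upwards [hv] with t ht htx
    exact ht ⟨htx.1, htx.2.trans hx.2⟩

lemma hasDerivWithinAt (hab : a < b) (h : IsPrimitiveOn a b u v) (hv : ContinuousOn v (Icc a b))
    {x : ℝ} (hx : x ∈ Icc a b) : HasDerivWithinAt u (v x) (Icc a b) x := by
  have : Fact (x ∈ Icc a b) := ⟨hx⟩
  have h1 : HasDerivWithinAt (fun y => ∫ t in a..y, v t) (v x) (Icc a b) x :=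
    intervalIntegral.integral_hasDerivWithinAt_right
      (h.1.mono_set (by
        rw [uIcc_of_le hx.1, uIcc_of_le hab.le]
        exact Icc_subset_Icc le_rfl hx.2))
      (hv.stronglyMeasurableAtFilter_nhdsWithin measurableSet_Icc x) (hv x hx)
  exact (h1.const_add (u a)).congr h.2 (h.2 x hx)

/-- Substitution of an increasing `C¹` change of variables. -/
lemma comp (hab : a ≤ b) {c d : ℝ} {φ φ' : ℝ → ℝ}
    (h : IsPrimitiveOn c d u v) (hm : MapsTo φ (Icc a b) (Icc c d)) (ha : φ a = c) (hb : φ b = d)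
    (hd : ∀ x ∈ Icc a b, HasDerivWithinAt φ (φ' x) (Icc a b) x)
    (hφ' : ∀ x ∈ Icc a b, 0 ≤ φ' x) :
    IsPrimitiveOn a b (fun x => u (φ x)) (fun x => v (φ x) * φ' x) := by
  have hc : ContinuousOn φ (Icc a b) := fun x hx => (hd x hx).continuousWithinAt
  have hdI : ∀ x ∈ Icc a b, ∀ y ∈ Ioo a x, HasDerivAt φ (φ' y) y := fun x hx y hy =>
    (hd y ⟨hy.1.le, hy.2.le.trans hx.2⟩).hasDerivAt
      (Icc_mem_nhds hy.1 (hy.2.trans_le hx.2))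
  refine ⟨?_, fun x hx => ?_⟩
  · have := intervalIntegral.integrable_comp_mul_deriv_iff_of_deriv_nonneg (a := a) (b := b)
      (f := φ) (f' := φ') (g := v) (by rwa [uIcc_of_le hab])
      (by rw [min_eq_left hab, max_eq_right hab]; exact hdI b (right_mem_Icc.2 hab))
      (by
        rw [min_eq_left hab, max_eq_right hab]
        exact fun x hx => hφ' x (Ioo_subset_Icc_self hx))
    rw [ha, hb] at this
    exact this.2 h.1
  · have := intervalIntegral.integral_comp_mul_deriv_of_deriv_nonneg (a := a) (b := x)
      (f := φ) (f' := φ') (g := v)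
      (by rw [uIcc_of_le hx.1]; exact hc.mono (Icc_subset_Icc le_rfl hx.2))
      (by rw [min_eq_left hx.1, max_eq_right hx.1]; exact hdI x hx)
      (by
        rw [min_eq_left hx.1, max_eq_right hx.1]
        exact fun y hy => hφ' y ⟨hy.1.le, hy.2.le.trans hx.2⟩)
    simp only [Function.comp] at this
    simp only
    rw [this, ha]
    exact h.2 _ (hm hx)

end IsPrimitiveOn

namespace SobolevBound

variable {a b : ℝ} {k : ℕ} {u u' g : ℝ → ℝ} {N N' B : ℝ}

lemma integral_le (h : SobolevBound a b k u N) : ∫ x in a..b, |u x| ≤ N := by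
  cases k with
  | zero => exact h.2
  | succ k => exact h.1

lemma intervalIntegrable (hab : a ≤ b) (h : SobolevBound a b k u N) :
    IntervalIntegrable u volume a b := by
  cases k with
  | zero => exact h.1
  | succ k =>
    obtain ⟨-, v, hv, -⟩ := h
    exact hv.intervalIntegrable hab

lemma nonneg (hab : a ≤ b) (h : SobolevBound a b k u N) : 0 ≤ N :=
  (intervalIntegral.integral_nonneg hab fun _ _ => abs_nonneg _).trans h.integral_le

lemma mono (h : SobolevBound a b k u N) (hN : N ≤ N') : SobolevBound a b k u N' := by
  induction k generalizing u with
  | zero => exact ⟨h.1, h.2.trans hN⟩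
  | succ k ih =>
    obtain ⟨h1, v, hv, h2⟩ := h
    exact ⟨h1.trans hN, v, hv, ih h2⟩

lemma pred (hab : a ≤ b) (h : SobolevBound a b (k + 1) u N) : SobolevBound a b k u N := by
  induction k generalizing u with
  | zero => exact ⟨h.intervalIntegrable hab, h.1⟩
  | succ k ih =>
    obtain ⟨h1, v, hv, h2⟩ := h
    exact ⟨h1, v, hv, ih h2⟩

lemma congr (hab : a ≤ b) (h : SobolevBound a b k u N) (hu : EqOn u' u (Icc a b)) :
    SobolevBound a b k u' N := by
  have hI : ∫ x in a..b, |u' x| = ∫ x in a..b, |u x| :=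
    intervalIntegral.integral_congr fun x hx => by
      rw [uIcc_of_le hab] at hx
      simp only [hu hx]
  cases k with
  | zero =>
    refine ⟨h.1.congr fun x hx => ?_, hI ▸ h.2⟩
    rw [uIoc_of_le hab] at hx
    exact (hu (Ioc_subset_Icc_self hx)).symm
  | succ k =>
    obtain ⟨h1, v, hv, h2⟩ := h
    refine ⟨hI ▸ h1, v, ⟨hv.1, fun x hx => ?_⟩, h2⟩
    rw [hu hx, hu (left_mem_Icc.2 hab)]
    exact hv.2 x hx

lemma add (hab : a ≤ b) (h : SobolevBound a b k u N) (h' : SobolevBound a b k u' N') :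
    SobolevBound a b k (fun x => u x + u' x) (N + N') := by
  have hI : ∀ {w w' : ℝ → ℝ}, IntervalIntegrable w volume a b → IntervalIntegrable w' volume a b →
      ∫ x in a..b, |w x| ≤ N → ∫ x in a..b, |w' x| ≤ N' →
      ∫ x in a..b, |w x + w' x| ≤ N + N' := by
    intro w w' hw hw' h1 h2
    refine le_trans ?_ (add_le_add h1 h2)
    rw [← intervalIntegral.integral_add hw.abs hw'.abs]
    exact intervalIntegral.integral_mono_on hab (hw.add hw').abs (hw.abs.add hw'.abs)
      fun x _ => abs_add_le _ _
  induction k generalizing u u' with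
  | zero => exact ⟨h.1.add h'.1, hI h.1 h'.1 h.2 h'.2⟩
  | succ k ih =>
    have hu := h.intervalIntegrable hab
    have hu' := h'.intervalIntegrable hab
    obtain ⟨h1, v, hv, h2⟩ := h
    obtain ⟨h1', v', hv', h2'⟩ := h'
    exact ⟨hI hu hu' h1 h1', _, hv.add hv', ih h2 h2'⟩

lemma mul (hab : a ≤ b) (h : SobolevBound a b k u N) (hg : SmoothBound a b k g B) :
    SobolevBound a b k (fun x => u x * g x) (2 ^ k * (N * B)) := by
  have hB := hg.nonneg hab
  have hN := h.nonneg hab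
  have hI : ∀ {w g : ℝ → ℝ}, IntervalIntegrable w volume a b → ∫ x in a..b, |w x| ≤ N →
      ContinuousOn g (Icc a b) → (∀ x ∈ Icc a b, |g x| ≤ B) →
      ∫ x in a..b, |w x * g x| ≤ N * B := by
    intro w g hw h1 hgc hgb
    rw [← uIcc_of_le hab] at hgc
    calc ∫ x in a..b, |w x * g x| ≤ ∫ x in a..b, |w x| * B := by
          refine intervalIntegral.integral_mono_on hab (hw.mul_continuousOn hgc).abs
            (hw.abs.mul_const B) fun x hx => ?_
          rw [abs_mul]
          exact mul_le_mul_of_nonneg_left (hgb x hx) (abs_nonneg _)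
      _ = (∫ x in a..b, |w x|) * B := intervalIntegral.integral_mul_const _ _
      _ ≤ N * B := mul_le_mul_of_nonneg_right h1 hB
  induction k generalizing u g with
  | zero =>
    have hgc := hg.1
    rw [← uIcc_of_le hab] at hgc
    refine ⟨h.1.mul_continuousOn hgc, ?_⟩
    simpa using hI h.1 h.2 hg.1 hg.2
  | succ k ih =>
    have hu := h.intervalIntegrable hab
    have hup := h.pred hab
    have hgp := hg.pred
    have hgc := hg.continuousOn
    obtain ⟨h1, v, hv, h2⟩ := h
    obtain ⟨h1', g', hd, h2'⟩ := hg
    refine ⟨(hI hu h1 hgc h1').trans ?_, _, hv.mul hab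
      (IsPrimitiveOn.of_hasDerivWithinAt hab hd h2'.continuousOn), ?_⟩
    · exact le_mul_of_one_le_left (by positivity) (one_le_pow₀ (by norm_num))
    · have := (ih h2 hgp).add hab (ih hup h2')
      rw [← two_mul, ← mul_assoc, ← pow_succ'] at this
      exact this

end SobolevBound

/-- An increasing `C^{k+1}` change of variables with derivative bounded below preserves
`W^{k,1}`. -/
lemma exists_sobolevBound_comp (k : ℕ) (κ B : ℝ) (hκ : 0 < κ) :
    ∃ C : ℝ, 0 ≤ C ∧ ∀ (a b c d : ℝ) (u φ φ' : ℝ → ℝ) (N : ℝ), a ≤ b →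
      SobolevBound c d k u N → MapsTo φ (Icc a b) (Icc c d) → φ a = c → φ b = d →
      (∀ x ∈ Icc a b, HasDerivWithinAt φ (φ' x) (Icc a b) x) → (∀ x ∈ Icc a b, κ ≤ φ' x) →
      SmoothBound a b k φ' B → SobolevBound a b k (fun x => u (φ x)) (C * N) := by
  have hI : ∀ (a b c d : ℝ) (u φ φ' : ℝ → ℝ) (N : ℝ), a ≤ b →
      IntervalIntegrable u volume c d → ∫ x in c..d, |u x| ≤ N →
      MapsTo φ (Icc a b) (Icc c d) → φ a = c → φ b = d →
      (∀ x ∈ Icc a b, HasDerivWithinAt φ (φ' x) (Icc a b) x) → (∀ x ∈ Icc a b, κ ≤ φ' x) →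
      ContinuousOn φ' (Icc a b) →
      IntervalIntegrable (fun x => u (φ x)) volume a b ∧ ∫ x in a..b, |u (φ x)| ≤ κ⁻¹ * N := by
    intro a b c d u φ φ' N hab hu hN hm ha hb hd hκφ hφc
    have hpos : ∀ x ∈ Icc a b, 0 < φ' x := fun x hx => hκ.trans_le (hκφ x hx)
    have hp : ∀ w : ℝ → ℝ, IntervalIntegrable w volume c d →
        IsPrimitiveOn a b (fun x => w c + ∫ t in c..φ x, w t) (fun x => w (φ x) * φ' x) := by
      intro w hw
      have h1 : IsPrimitiveOn c d (fun y => w c + ∫ t in c..y, w t) w := ⟨hw, fun x _ => by simp⟩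
      exact h1.comp hab hm ha hb hd fun x hx => (hpos x hx).le
    have hint : IntervalIntegrable (fun x => u (φ x)) volume a b := by
      have h1 := (hp u hu).1.mul_continuousOn (g := fun x => (φ' x)⁻¹) (by
        rw [uIcc_of_le hab]
        exact hφc.inv₀ fun x hx => (hpos x hx).ne')
      refine h1.congr fun x hx => ?_
      rw [uIoc_of_le hab] at hx
      have := (hpos x (Ioc_subset_Icc_self hx)).ne'
      field_simp
    refine ⟨hint, ?_⟩
    have h2 := hp (fun x => |u x|) hu.abs
    have h3 := h2.2 b (right_mem_Icc.2 hab)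
    simp only [ha, hb, intervalIntegral.integral_same, add_zero, add_right_inj] at h3
    have h4 : ∫ x in a..b, |u (φ x)| ≤ ∫ x in a..b, κ⁻¹ * (|u (φ x)| * φ' x) := by
      refine intervalIntegral.integral_mono_on hab hint.abs (h2.1.const_mul _) fun x hx => ?_
      have h5 := hκφ x hx
      have h6 : 1 ≤ κ⁻¹ * φ' x := by
        rw [inv_mul_eq_div, le_div_iff₀ hκ]; linarith
      have h7 := mul_le_mul_of_nonneg_left h6 (abs_nonneg (u (φ x)))
      linarith
    rw [intervalIntegral.integral_const_mul, ← h3] at h4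
    exact h4.trans (mul_le_mul_of_nonneg_left hN (by positivity))
  induction k with
  | zero =>
    refine ⟨κ⁻¹, by positivity, fun a b c d u φ φ' N hab hu hm ha hb hd hκφ hB => ?_⟩
    exact hI a b c d u φ φ' N hab hu.1 hu.2 hm ha hb hd hκφ hB.1
  | succ k ih =>
    obtain ⟨C, hC0, hC⟩ := ih
    refine ⟨max κ⁻¹ (2 ^ k * (C * B)), le_max_of_le_left (by positivity),
      fun a b c d u φ φ' N hab hu hm ha hb hd hκφ hB => ?_⟩
    have hcd : c ≤ d := by
      have := hm (left_mem_Icc.2 hab); exact this.1.trans this.2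
    have hN := hu.nonneg hcd
    have hui := hu.intervalIntegrable hcd
    obtain ⟨h1, v, hv, h2⟩ := hu
    refine ⟨(hI a b c d u φ φ' N hab hui h1 hm ha hb hd hκφ hB.continuousOn).2.trans
      (mul_le_mul_of_nonneg_right (le_max_left _ _) hN), _,
      hv.comp hab hm ha hb hd fun x hx => hκ.le.trans (hκφ x hx), ?_⟩
    refine ((hC a b c d v φ φ' N hab h2 hm ha hb hd hκφ hB.pred).mul hab hB.pred).mono ?_
    calc 2 ^ k * (C * N * B) = (2 ^ k * (C * B)) * N := by ring
      _ ≤ _ := mul_le_mul_of_nonneg_right (le_max_right _ _) hN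

/-! ### Weak derivatives on an interval -/

lemma integrableOn_mul_of_tsupport_subset {U : Set ℝ} {u φ : ℝ → ℝ}
    (hu : LocallyIntegrableOn u U volume) (hφ : Continuous φ) (hc : HasCompactSupport φ)
    (hs : tsupport φ ⊆ U) : Integrable (fun x => u x * φ x) volume := by
  have h1 : IntegrableOn u (tsupport φ) := hu.integrableOn_compact_subset hs hc
  have h2 : IntegrableOn (fun x => u x * φ x) (tsupport φ) :=
    h1.mul_continuousOn hφ.continuousOn hc
  refine (integrableOn_iff_integrable_of_support_subset ?_).1 h2
  intro x hx
  refine subset_tsupport φ ?_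
  intro h0
  exact hx (by simp [h0])

lemma setIntegral_mul_eq_integral {U : Set ℝ} {u φ : ℝ → ℝ} (hs : tsupport φ ⊆ U) :
    ∫ x in U, u x * φ x = ∫ x, u x * φ x := by
  refine setIntegral_eq_integral_of_forall_compl_eq_zero fun x hx => ?_
  rw [image_eq_zero_of_notMem_tsupport fun h => hx (hs h), mul_zero]

/-- Weak derivatives of order zero agree almost everywhere with the function. -/
lemma HasWeakDerivOn.ae_eq_of_zero {U : Set ℝ} (hU : IsOpen U) {u v : ℝ → ℝ}
    (h : HasWeakDerivOn U 0 u v) : ∀ᵐ x, x ∈ U → u x = v x := by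
  obtain ⟨h1, h2, h3⟩ := h
  have := hU.ae_eq_zero_of_integral_contDiff_smul_eq_zero (f := fun x => u x - v x)
    (μ := volume) (h1.sub h2) (fun φ hφ hc hs => by
      have h4 := h3 φ hφ hc hs
      simp only [iteratedDeriv_zero, pow_zero, one_mul] at h4
      rw [setIntegral_mul_eq_integral hs, setIntegral_mul_eq_integral hs] at h4
      have h5 := integral_sub (integrableOn_mul_of_tsupport_subset h1 hφ.continuous hc hs)
        (integrableOn_mul_of_tsupport_subset h2 hφ.continuous hc hs)
      rw [h4, sub_self] at h5
      rw [← h5]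
      refine integral_congr_ae (Filter.Eventually.of_forall fun x => ?_)
      simp only [smul_eq_mul]
      ring)
  filter_upwards [this] with x hx hxU
  exact sub_eq_zero.1 (hx hxU)

/-- The lemma of du Bois-Reymond: a function with vanishing weak derivative is constant. -/
lemma ae_eq_const_of_integral_mul_deriv_eq_zero {a b : ℝ} (hab : a < b) {G : ℝ → ℝ}
    (hG : IntegrableOn G (Ioo a b))
    (h : ∀ φ : ℝ → ℝ, ContDiff ℝ ∞ φ → HasCompactSupport φ → tsupport φ ⊆ Ioo a b →
      ∫ x in Ioo a b, G x * deriv φ x = 0) :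
    ∃ c : ℝ, ∀ᵐ x, x ∈ Ioo a b → G x = c := by
  have hGl : LocallyIntegrableOn G (Ioo a b) := hG.locallyIntegrableOn
  let β : ContDiffBump ((a + b) / 2) :=
    ⟨(b - a) / 8, (b - a) / 4, by linarith, by linarith⟩
  set φ₀ : ℝ → ℝ := β.normed volume with hφ₀
  have hφ₀d : ContDiff ℝ ∞ φ₀ := β.contDiff_normed
  have hφ₀c : HasCompactSupport φ₀ := β.hasCompactSupport_normed
  have hφ₀s : tsupport φ₀ ⊆ Ioo a b := by
    rw [hφ₀, ContDiffBump.tsupport_normed_eq]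
    intro x hx
    rw [Metric.mem_closedBall, Real.dist_eq, abs_le] at hx
    change -((b - a) / 4) ≤ _ ∧ _ ≤ (b - a) / 4 at hx
    constructor <;> linarith [hx.1, hx.2]
  have hφ₀i : ∫ x, φ₀ x = 1 := β.integral_normed
  refine ⟨∫ x, G x * φ₀ x, ?_⟩
  set c := ∫ x, G x * φ₀ x with hc
  have key : ∀ ψ : ℝ → ℝ, ContDiff ℝ ∞ ψ → HasCompactSupport ψ → tsupport ψ ⊆ Ioo a b →
      ∫ x, G x * ψ x = c * ∫ x, ψ x := by
    intro ψ hψ hψc hψs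
    set I := ∫ x, ψ x with hI
    -- `θ` has integral zero, so its primitive is again a test function
    set θ : ℝ → ℝ := fun x => ψ x - I * φ₀ x with hθ
    have hθd : ContDiff ℝ ∞ θ := hψ.sub (contDiff_const.mul hφ₀d)
    have hK : IsCompact (tsupport ψ ∪ tsupport φ₀) := hψc.isCompact.union hφ₀c.isCompact
    have hKs : tsupport ψ ∪ tsupport φ₀ ⊆ Ioo a b := union_subset hψs hφ₀s
    obtain ⟨α, hα, hαK⟩ : ∃ α, a < α ∧ ∀ x ∈ tsupport ψ ∪ tsupport φ₀, α ≤ x := by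
      rcases (tsupport ψ ∪ tsupport φ₀).eq_empty_or_nonempty with he | hne
      · exact ⟨a + 1, by linarith, fun x hx => by rw [he] at hx; exact hx.elim⟩
      · obtain ⟨α, h1, h2⟩ := hK.exists_isLeast hne
        exact ⟨α, (hKs h1).1, fun x hx => h2 hx⟩
    obtain ⟨γ, hγ, hγK⟩ : ∃ γ, γ < b ∧ ∀ x ∈ tsupport ψ ∪ tsupport φ₀, x ≤ γ := by
      rcases (tsupport ψ ∪ tsupport φ₀).eq_empty_or_nonempty with he | hne
      · exact ⟨b - 1, by linarith, fun x hx => by rw [he] at hx; exact hx.elim⟩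
      · obtain ⟨γ, h1, h2⟩ := hK.exists_isGreatest hne
        exact ⟨γ, (hKs h1).2, fun x hx => h2 hx⟩
    have hθ0 : ∀ x, x ∉ Icc α γ → θ x = 0 := by
      intro x hx
      have h1 : x ∉ tsupport ψ ∪ tsupport φ₀ := fun hm => hx ⟨hαK x hm, hγK x hm⟩
      rw [mem_union, not_or] at h1
      simp [hθ, image_eq_zero_of_notMem_tsupport h1.1, image_eq_zero_of_notMem_tsupport h1.2]
    have hψint : Integrable ψ := hψ.continuous.integrable_of_hasCompactSupport hψc
    have hφint : Integrable φ₀ := hφ₀d.continuous.integrable_of_hasCompactSupport hφ₀c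
    have hθI : ∫ x, θ x = 0 := by
      rw [hθ, integral_sub hψint (hφint.const_mul I), integral_const_mul, hφ₀i, mul_one, sub_self]
    set Φ : ℝ → ℝ := fun x => ∫ t in a..x, θ t with hΦ
    have hΦd : ∀ x, HasDerivAt Φ (θ x) x := fun x =>
      intervalIntegral.integral_hasDerivAt_right (hθd.continuous.intervalIntegrable _ _)
        (hθd.continuous.stronglyMeasurableAtFilter _ _) hθd.continuous.continuousAt
    have hderiv : deriv Φ = θ := funext fun x => (hΦd x).deriv
    have hΦc : ContDiff ℝ ∞ Φ := by
      rw [contDiff_infty_iff_deriv, hderiv]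
      exact ⟨fun x => (hΦd x).differentiableAt, hθd⟩
    have hΦ0 : ∀ x, x ∉ Icc α γ → Φ x = 0 := by
      intro x hx
      rw [mem_Icc, not_and_or, not_le, not_le] at hx
      rcases hx with hx | hx
      · rw [hΦ]
        simp only
        rw [intervalIntegral.integral_congr (g := fun _ => 0), intervalIntegral.integral_zero]
        intro t ht
        refine hθ0 t fun hm => ?_
        rcases le_total a x with h | h
        · rw [uIcc_of_le h] at ht; linarith [ht.2, hm.1]
        · rw [uIcc_of_ge h] at ht; linarith [ht.2, hm.1]
      · rcases le_or_gt a x with h | h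
        · rw [hΦ]
          simp only
          rw [intervalIntegral.integral_eq_integral_of_support_subset, hθI]
          intro t ht
          by_contra hm
          refine ht (hθ0 t fun hm' => hm ⟨by linarith [hm'.1], by linarith [hm'.2]⟩)
        · rw [hΦ]
          simp only
          rw [intervalIntegral.integral_congr (g := fun _ => 0), intervalIntegral.integral_zero]
          intro t ht
          refine hθ0 t fun hm => ?_
          rw [uIcc_of_ge h.le] at ht; linarith [ht.1, hm.2, ht.2, hm.1]
    have hΦs : tsupport Φ ⊆ Icc α γ := by
      refine closure_minimal (fun x hx => ?_) isClosed_Icc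
      by_contra hm
      exact hx (hΦ0 x hm)
    have hIcc : Icc α γ ⊆ Ioo a b := Icc_subset_Ioo hα hγ
    have h0 := h Φ hΦc (HasCompactSupport.of_support_subset_isCompact isCompact_Icc
      ((subset_tsupport _).trans hΦs)) (hΦs.trans hIcc)
    rw [hderiv, setIntegral_eq_integral_of_forall_compl_eq_zero (fun x hx => by
      rw [hθ0 x fun hm => hx (hIcc hm), mul_zero])] at h0
    have hi1 := integrableOn_mul_of_tsupport_subset hGl hψ.continuous hψc hψs
    have hi2 := integrableOn_mul_of_tsupport_subset hGl hφ₀d.continuous hφ₀c hφ₀s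
    have h1 : ∫ x, G x * θ x = (∫ x, G x * ψ x) - I * ∫ x, G x * φ₀ x := by
      rw [← integral_const_mul, ← integral_sub hi1 (hi2.const_mul I)]
      refine integral_congr_ae (Filter.Eventually.of_forall fun x => ?_)
      simp only [hθ]
      ring
    rw [h1] at h0
    linarith
  have := isOpen_Ioo.ae_eq_zero_of_integral_contDiff_smul_eq_zero (f := fun x => G x - c)
    (μ := volume) (U := Ioo a b)
    (hGl.sub (locallyIntegrableOn_const c)) (fun ψ hψ hψc hψs => by
      have h1 := key ψ hψ hψc hψs
      have hψint : Integrable ψ := hψ.continuous.integrable_of_hasCompactSupport hψc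
      have hi1 := integrableOn_mul_of_tsupport_subset hGl hψ.continuous hψc hψs
      have h2 := integral_sub hi1 (hψint.const_mul c)
      rw [integral_const_mul, h1, sub_self] at h2
      rw [← h2]
      refine integral_congr_ae (Filter.Eventually.of_forall fun x => ?_)
      simp only [smul_eq_mul]
      ring)
  filter_upwards [this] with x hx hxU
  exact sub_eq_zero.1 (hx hxU)

/-- Integration by parts against a test function. -/
lemma IsPrimitiveOn.integral_mul_deriv_eq {a b : ℝ} (hab : a < b) {u v φ : ℝ → ℝ}
    (h : IsPrimitiveOn a b u v) (hφ : ContDiff ℝ ∞ φ) (hs : tsupport φ ⊆ Ioo a b) :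
    ∫ x in Ioo a b, u x * deriv φ x = - ∫ x in Ioo a b, v x * φ x := by
  have hφ1 : Continuous (deriv φ) := hφ.continuous_deriv (by simp)
  have hp : IsPrimitiveOn a b φ (deriv φ) :=
    IsPrimitiveOn.of_hasDerivWithinAt hab.le
      (fun x _ => ((hφ.differentiable (by simp)) x).hasDerivAt.hasDerivWithinAt) hφ1.continuousOn
  have hm := h.mul hab.le hp
  have ha : φ a = 0 := image_eq_zero_of_notMem_tsupport fun hx => lt_irrefl _ (hs hx).1
  have hb : φ b = 0 := image_eq_zero_of_notMem_tsupport fun hx => lt_irrefl _ (hs hx).2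
  have h1 := hm.2 b (right_mem_Icc.2 hab.le)
  simp only [ha, hb, mul_zero, zero_add] at h1
  have hc := h.continuousOn hab.le
  rw [← uIcc_of_le hab.le] at hc
  rw [intervalIntegral.integral_add (h.1.mul_continuousOn hφ.continuous.continuousOn)
    ((hφ1.intervalIntegrable _ _).continuousOn_mul hc), intervalIntegral.integral_of_le hab.le,
    intervalIntegral.integral_of_le hab.le, integral_Ioc_eq_integral_Ioo,
    integral_Ioc_eq_integral_Ioo] at h1
  linarith

lemma tsupport_deriv_subset' {φ : ℝ → ℝ} : tsupport (deriv φ) ⊆ tsupport φ :=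
  closure_minimal support_deriv_subset isClosed_closure

/-- Iterated primitives are weak derivatives. -/
lemma hasWeakDerivOn_of_isPrimitiveOn {a b : ℝ} (hab : a < b) {k : ℕ} {w : ℕ → ℝ → ℝ}
    (hw : ∀ j < k, IsPrimitiveOn a b (w j) (w (j + 1)))
    (hi : ∀ j ≤ k, IntervalIntegrable (w j) volume a b) :
    ∀ j ≤ k, HasWeakDerivOn (Ioo a b) j (w 0) (w j) := by
  have hloc : ∀ j ≤ k, LocallyIntegrableOn (w j) (Ioo a b) volume := fun j hj =>
    (((intervalIntegrable_iff_integrableOn_Ioo_of_le hab.le).1 (hi j hj))).locallyIntegrableOn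
  intro j hj
  refine ⟨hloc 0 (Nat.zero_le _), hloc j hj, ?_⟩
  induction j with
  | zero => intro φ _ _ _; simp
  | succ j ih =>
    intro φ hφ hc hs
    have hd : ContDiff ℝ ∞ (deriv φ) := (contDiff_infty_iff_deriv.1 hφ).2
    rw [iteratedDeriv_succ', ih (by omega) (deriv φ) hd hc.deriv (tsupport_deriv_subset'.trans hs),
      (hw j (by omega)).integral_mul_deriv_eq hab hφ hs, pow_succ]
    ring

/-- Functions with integrable weak derivatives are, up to null sets, iterated primitives. -/
lemma exists_isPrimitiveOn_of_hasWeakDerivOn {a b : ℝ} (hab : a < b) {k : ℕ} {u : ℝ → ℝ}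
    {v : ℕ → ℝ → ℝ} (hv : ∀ j ≤ k, HasWeakDerivOn (Ioo a b) j u (v j))
    (hi : ∀ j ≤ k, IntegrableOn (v j) (Ioo a b)) :
    ∃ w : ℕ → ℝ → ℝ, (∀ j < k, IsPrimitiveOn a b (w j) (w (j + 1))) ∧
      (∀ j ≤ k, ∀ᵐ x, x ∈ Ioo a b → w j x = v j x) := by
  have hi' : ∀ j ≤ k, IntervalIntegrable (v j) volume a b := fun j hj =>
    (intervalIntegrable_iff_integrableOn_Ioo_of_le hab.le).2 (hi j hj)
  have hstep : ∀ j, ∃ c : ℝ, j < k →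
      ∀ᵐ x, x ∈ Ioo a b → v j x = c + ∫ t in a..x, v (j + 1) t := by
    intro j
    by_cases hj : j < k
    · have hprim : IsPrimitiveOn a b (fun x => ∫ t in a..x, v (j + 1) t) (v (j + 1)) :=
        ⟨hi' (j + 1) hj, fun x _ => by simp⟩
      obtain ⟨c, hc⟩ := ae_eq_const_of_integral_mul_deriv_eq_zero hab
        (G := fun x => v j x - ∫ t in a..x, v (j + 1) t)
        ((hi j hj.le).sub ((intervalIntegrable_iff_integrableOn_Ioo_of_le hab.le).1
          (hprim.intervalIntegrable hab.le))) (fun φ hφ hc hs => by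
          have hd : ContDiff ℝ ∞ (deriv φ) := (contDiff_infty_iff_deriv.1 hφ).2
          have hs' := tsupport_deriv_subset'.trans hs
          have h1 := (hv j hj.le).2.2 (deriv φ) hd hc.deriv hs'
          have h2 := (hv (j + 1) hj).2.2 φ hφ hc hs
          rw [iteratedDeriv_succ', h1, pow_succ] at h2
          have h3 : ((-1 : ℝ)) ^ j ≠ 0 := by simp
          have h4 : ∫ x in Ioo a b, v j x * deriv φ x = - ∫ x in Ioo a b, v (j + 1) x * φ x := by
            refine mul_left_cancel₀ h3 ?_
            rw [h2]; ring
          have h5 := hprim.integral_mul_deriv_eq hab hφ hs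
          have hint1 := (integrableOn_mul_of_tsupport_subset (hi j hj.le).locallyIntegrableOn
            hd.continuous hc.deriv hs').integrableOn (s := Ioo a b)
          have hint2 := (integrableOn_mul_of_tsupport_subset
            ((intervalIntegrable_iff_integrableOn_Ioo_of_le hab.le).1
              (hprim.intervalIntegrable hab.le)).locallyIntegrableOn
            hd.continuous hc.deriv hs').integrableOn (s := Ioo a b)
          simp only [sub_mul]
          rw [integral_sub hint1 hint2, h4, h5, sub_self])
      refine ⟨c, fun _ => ?_⟩
      filter_upwards [hc] with x hx hxm
      linarith [hx hxm]
    · exact ⟨0, fun h => absurd h hj⟩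
  choose c hc using hstep
  refine ⟨fun j => if j < k then fun x => c j + ∫ t in a..x, v (j + 1) t else v j, ?_, ?_⟩
  · intro j hj
    have h1 : IsPrimitiveOn a b (fun x => c j + ∫ t in a..x, v (j + 1) t) (v (j + 1)) :=
      ⟨hi' (j + 1) hj, fun x _ => by simp⟩
    simp only [hj, if_true]
    split_ifs with hj'
    · refine h1.congr_right hab.le ?_
      have hb : ∀ᵐ x : ℝ, x ≠ b := by simp [ae_iff]
      filter_upwards [hc (j + 1) hj', hb] with x hx hxb hm
      exact hx ⟨hm.1, lt_of_le_of_ne hm.2 hxb⟩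
    · exact h1
  · intro j hj
    by_cases hjk : j < k
    · simp only [hjk, if_true]
      filter_upwards [hc j hjk] with x hx hm
      exact (hx hm).symm
    · simp only [hjk, if_false]
      exact Filter.Eventually.of_forall fun _ => by simp

lemma SobolevBound.exists_chain {a b : ℝ} (hab : a ≤ b) {k : ℕ} {u : ℝ → ℝ} {N : ℝ}
    (h : SobolevBound a b k u N) :
    ∃ w : ℕ → ℝ → ℝ, w 0 = u ∧ (∀ j < k, IsPrimitiveOn a b (w j) (w (j + 1))) ∧
      ∀ j ≤ k, IntervalIntegrable (w j) volume a b ∧ ∫ x in a..b, |w j x| ≤ N := by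
  induction k generalizing u with
  | zero =>
    refine ⟨fun _ => u, rfl, fun j hj => absurd hj (Nat.not_lt_zero _), fun j _ => h⟩
  | succ k ih =>
    have hu := h.intervalIntegrable hab
    obtain ⟨h1, v, hv, h2⟩ := h
    obtain ⟨w, hw0, hw1, hw2⟩ := ih h2
    refine ⟨fun j => Nat.casesOn j u w, rfl, ?_, ?_⟩
    · intro j hj
      cases j with
      | zero => simpa [hw0] using hv
      | succ j => exact hw1 j (by omega)
    · intro j hj
      cases j with
      | zero => exact ⟨hu, h1⟩
      | succ j => exact hw2 j (by omega)

lemma sobolevBound_of_chain {a b : ℝ} {k : ℕ} {w : ℕ → ℝ → ℝ} {N : ℝ}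
    (h : ∀ j < k, IsPrimitiveOn a b (w j) (w (j + 1)))
    (hi : ∀ j ≤ k, IntervalIntegrable (w j) volume a b ∧ ∫ x in a..b, |w j x| ≤ N) :
    SobolevBound a b k (w 0) N := by
  induction k generalizing w with
  | zero => exact hi 0 le_rfl
  | succ k ih =>
    exact ⟨(hi 0 (Nat.zero_le _)).2, w 1, h 0 (Nat.succ_pos _),
      ih (w := fun j => w (j + 1)) (fun j hj => h (j + 1) (by omega))
        fun j hj => hi (j + 1) (by omega)⟩

lemma smoothBound_of_chain {a b : ℝ} (hab : a < b) {k : ℕ} {w : ℕ → ℝ → ℝ} {B : ℝ}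
    (h : ∀ j < k, IsPrimitiveOn a b (w j) (w (j + 1)))
    (hc : ∀ j ≤ k, ContinuousOn (w j) (Icc a b) ∧ ∀ x ∈ Icc a b, |w j x| ≤ B) :
    SmoothBound a b k (w 0) B := by
  induction k generalizing w with
  | zero => exact hc 0 le_rfl
  | succ k ih =>
    exact ⟨(hc 0 (Nat.zero_le _)).2, w 1,
      fun x hx => (h 0 (Nat.succ_pos _)).hasDerivWithinAt hab (hc 1 (by omega)).1 hx,
      ih (w := fun j => w (j + 1)) (fun j hj => h (j + 1) (by omega))
        fun j hj => hc (j + 1) (by omega)⟩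

lemma HasWeakDerivOn.congr_left {U : Set ℝ} (hU : IsOpen U) {j : ℕ} {u u' v : ℝ → ℝ}
    (h : HasWeakDerivOn U j u v) (hu : ∀ᵐ x, x ∈ U → u' x = u x) : HasWeakDerivOn U j u' v := by
  have hu' : u' =ᵐ[volume.restrict U] u := (ae_restrict_iff' hU.measurableSet).2 hu
  refine ⟨?_, h.2.1, fun φ hφ hc hs => ?_⟩
  · rw [locallyIntegrableOn_iff hU.isLocallyClosed]
    intro K hK hKc
    have h1 := h.1.integrableOn_compact_subset hK hKc
    refine h1.congr ?_
    refine (ae_restrict_iff' hKc.measurableSet).2 ?_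
    filter_upwards [hu] with x hx hxK
    exact (hx (hK hxK)).symm
  · rw [← h.2.2 φ hφ hc hs]
    refine integral_congr_ae ?_
    filter_upwards [hu'] with x hx
    rw [hx]

/-- A good representative with bounded derivatives yields a bound of the Sobolev norm. -/
lemma SobolevBound.sobolevENorm_le {a b : ℝ} (hab : a < b) {k : ℕ} {u u' : ℝ → ℝ} {N : ℝ}
    (h : SobolevBound a b k u N) (hu : ∀ᵐ x, x ∈ Ioo a b → u' x = u x) :
    sobolevENorm (Ioo a b) k 1 u' ≤ ENNReal.ofReal N := by
  obtain ⟨w, rfl, hw1, hw2⟩ := h.exists_chain hab.le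
  have hwd := hasWeakDerivOn_of_isPrimitiveOn hab hw1 fun j hj => (hw2 j hj).1
  refine iInf₂_le_of_le w (fun j hj => (hwd j hj).congr_left isOpen_Ioo hu) ?_
  refine Finset.sup_le fun j hj => ?_
  have hj' : j ≤ k := by simpa [Nat.lt_succ_iff] using hj
  have hint : Integrable (w j) (volume.restrict (Ioo a b)) :=
    (intervalIntegrable_iff_integrableOn_Ioo_of_le hab.le).1 (hw2 j hj').1
  rw [eLpNorm_one_eq_lintegral_enorm, ← ofReal_integral_norm_eq_lintegral_enorm hint]
  refine ENNReal.ofReal_le_ofReal ?_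
  have := (hw2 j hj').2
  rwa [intervalIntegral.integral_of_le hab.le, integral_Ioc_eq_integral_Ioo] at this

lemma exists_family_of_sobolevENorm_lt {U : Set ℝ} {k : ℕ} {p : ENNReal} {u : ℝ → ℝ}
    {N : ENNReal} (h : sobolevENorm U k p u < N) :
    ∃ v : ℕ → ℝ → ℝ, (∀ j ≤ k, HasWeakDerivOn U j u (v j)) ∧
      ∀ j ≤ k, eLpNorm (v j) p (volume.restrict U) < N := by
  simp only [sobolevENorm, iInf_lt_iff] at h
  obtain ⟨v, hv, h⟩ := h
  refine ⟨v, hv, fun j hj => lt_of_le_of_lt ?_ h⟩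
  exact Finset.le_sup (f := fun j => eLpNorm (v j) p (volume.restrict U))
    (Finset.mem_range.2 (Nat.lt_succ_of_le hj))

lemma ae_mem_Ioc_of_Ioo {a b : ℝ} {p : ℝ → Prop} (h : ∀ᵐ x, x ∈ Ioo a b → p x) :
    ∀ᵐ x, x ∈ Ioc a b → p x := by
  have hb : ∀ᵐ x : ℝ, x ≠ b := by simp [ae_iff]
  filter_upwards [h, hb] with x hx hxb hm
  exact hx ⟨hm.1, lt_of_le_of_ne hm.2 hxb⟩

/-- A function of finite `W^{k,1}` norm has a good representative. -/
lemma exists_sobolevBound_of_sobolevENorm_lt {a b : ℝ} (hab : a < b) {k : ℕ} {u : ℝ → ℝ} {N : ℝ}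
    (hN : 0 ≤ N) (h : sobolevENorm (Ioo a b) k 1 u < ENNReal.ofReal N) :
    ∃ u' : ℝ → ℝ, (∀ᵐ x, x ∈ Ioo a b → u x = u' x) ∧ SobolevBound a b k u' N := by
  obtain ⟨v, hv, hvN⟩ := exists_family_of_sobolevENorm_lt h
  have hint : ∀ j ≤ k, IntegrableOn (v j) (Ioo a b) := fun j hj =>
    memLp_one_iff_integrable.1 ⟨(hv j hj).2.1.aestronglyMeasurable, (hvN j hj).trans
      ENNReal.ofReal_lt_top⟩
  obtain ⟨w, hw1, hw2⟩ := exists_isPrimitiveOn_of_hasWeakDerivOn hab hv hint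
  refine ⟨w 0, ?_, sobolevBound_of_chain hw1 fun j hj => ?_⟩
  · filter_upwards [(hv 0 (Nat.zero_le _)).ae_eq_of_zero isOpen_Ioo, hw2 0 (Nat.zero_le _)]
      with x h1 h2 hx
    rw [h1 hx, h2 hx]
  · have h1 : IntervalIntegrable (v j) volume a b :=
      (intervalIntegrable_iff_integrableOn_Ioo_of_le hab.le).2 (hint j hj)
    have h2 : ∀ᵐ x, x ∈ uIoc a b → w j x = v j x := by
      rw [uIoc_of_le hab.le]
      exact ae_mem_Ioc_of_Ioo (hw2 j hj)
    refine ⟨h1.congr_ae ?_, ?_⟩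
    · refine (ae_restrict_iff' measurableSet_uIoc).2 ?_
      filter_upwards [h2] with x hx hm
      exact (hx hm).symm
    · have h3 : ∫ x in a..b, |w j x| = ∫ x in a..b, |v j x| := by
        refine intervalIntegral.integral_congr_ae ?_
        filter_upwards [h2] with x hx hm
        rw [hx hm]
      rw [h3, intervalIntegral.integral_of_le hab.le, integral_Ioc_eq_integral_Ioo]
      have h4 := (hvN j hj).le
      rw [eLpNorm_one_eq_lintegral_enorm,
        ← ofReal_integral_norm_eq_lintegral_enorm (hint j hj)] at h4
      exact (ENNReal.ofReal_le_ofReal_iff hN).1 h4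

/-! ### Legendre coefficients of Sobolev functions -/

section LegendreCoefficients
open Polynomial

/-- Parseval's identity for the `j`-th derivatives of Legendre polynomials, which are orthogonal
in the weight `(1 - x²) ^ j`. The coefficients are normalized by `‖P_k‖² = 1 / (k + 1/2)`. -/
lemma polyIntegral_weight_sum_sq (s : Finset ℕ) (j : ℕ) (γ : ℕ → ℝ) :
    polyIntegral ((1 - X ^ 2) ^ j *
      (∑ k ∈ s, C (((k : ℝ) + 1 / 2) * γ k) * derivative^[j] (legendrePoly k)) ^ 2)
      = ∑ k ∈ s, ((k : ℝ) + 1 / 2) * γ k ^ 2 * legendreWeight k j := by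
  rw [sq (∑ k ∈ s, _), Finset.sum_mul_sum, Finset.mul_sum, map_sum]
  refine Finset.sum_congr rfl fun k hk => ?_
  rw [Finset.mul_sum, map_sum, Finset.sum_eq_single k]
  · have h := polyIntegral_weight_eq k k j
    have h2 := polyIntegral_legendre_mul_self k
    rw [show (1 - X ^ 2) ^ j * (C (((k : ℝ) + 1 / 2) * γ k) * derivative^[j] (legendrePoly k) *
        (C (((k : ℝ) + 1 / 2) * γ k) * derivative^[j] (legendrePoly k)))
        = C ((((k : ℝ) + 1 / 2) * γ k) * (((k : ℝ) + 1 / 2) * γ k)) *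
          ((1 - X ^ 2) ^ j * derivative^[j] (legendrePoly k) * derivative^[j] (legendrePoly k)) by
      rw [C_mul (a := ((k : ℝ) + 1 / 2) * γ k)]; ring, polyIntegral_C_mul, h]
    linear_combination (((k : ℝ) + 1 / 2) * γ k ^ 2 * legendreWeight k j) * h2
  · intro l _ hl
    have h := polyIntegral_weight_eq k l j
    rw [polyIntegral_legendre_mul_of_ne hl.symm, mul_zero] at h
    rw [show (1 - X ^ 2) ^ j * (C (((k : ℝ) + 1 / 2) * γ k) * derivative^[j] (legendrePoly k) *
        (C (((l : ℝ) + 1 / 2) * γ l) * derivative^[j] (legendrePoly l)))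
        = C ((((k : ℝ) + 1 / 2) * γ k) * (((l : ℝ) + 1 / 2) * γ l)) *
          ((1 - X ^ 2) ^ j * derivative^[j] (legendrePoly k) * derivative^[j] (legendrePoly l)) by
      rw [C_mul (a := ((k : ℝ) + 1 / 2) * γ k)]; ring, polyIntegral_C_mul, h, mul_zero]
  · exact fun h => absurd hk h

/-- The factors of `legendreWeight k j` are at least `k² / 2`, which needs `j ≤ k / 2`. -/
lemma pow_le_legendreWeight {k j : ℕ} (h : 2 * j ≤ k) :
    (k : ℝ) ^ (2 * j) ≤ 2 ^ j * legendreWeight k j := by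
  have h1 : (k : ℝ) ^ (2 * j) = ∏ _i ∈ Finset.range j, (k : ℝ) ^ 2 := by
    rw [Finset.prod_const, Finset.card_range, pow_mul]
  have h2 : (2 : ℝ) ^ j = ∏ _i ∈ Finset.range j, (2 : ℝ) := by
    rw [Finset.prod_const, Finset.card_range]
  rw [h1, h2, legendreWeight, ← Finset.prod_mul_distrib]
  refine Finset.prod_le_prod (fun i _ => by positivity) fun i hi => ?_
  have h3 : 2 * ((i : ℝ) + 1) ≤ k := by
    have := Finset.mem_range.1 hi
    exact_mod_cast (by omega : 2 * (i + 1) ≤ k)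
  have h4 : (0 : ℝ) ≤ i := by positivity
  nlinarith

/-- Bessel's inequality for derivatives of Legendre polynomials in the ultraspherical weight. -/
lemma sum_legendreWeight_le {v : ℝ → ℝ} (hv : IntervalIntegrable v volume (-1) 1)
    (hv2 : IntervalIntegrable (fun x => v x ^ 2) volume (-1) 1) (j : ℕ) (b : ℕ → ℝ)
    (hb : ∀ k, ∫ x in (-1 : ℝ)..1, ((1 - X ^ 2) ^ j * derivative^[j] (legendrePoly k)).eval x * v x
      = legendreWeight k j * b k) (s : Finset ℕ) :
    ∑ k ∈ s, ((k : ℝ) + 1 / 2) * b k ^ 2 * legendreWeight k j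
      ≤ ∫ x in (-1 : ℝ)..1, v x ^ 2 := by
  set p : ℝ[X] := ∑ k ∈ s, C (((k : ℝ) + 1 / 2) * b k) * derivative^[j] (legendrePoly k) with hp
  set wt : ℝ[X] := (1 - X ^ 2) ^ j with hw_t
  set tot := ∑ k ∈ s, ((k : ℝ) + 1 / 2) * b k ^ 2 * legendreWeight k j with htot
  have hpoly : ∀ q : ℝ[X], IntervalIntegrable (fun x => q.eval x) volume (-1) 1 := fun q =>
    q.continuous.intervalIntegrable _ _
  have hqv : ∀ q : ℝ[X], IntervalIntegrable (fun x => q.eval x * v x) volume (-1) 1 := fun q =>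
    hv.continuousOn_mul q.continuous.continuousOn
  have hqv2 : ∀ q : ℝ[X], IntervalIntegrable (fun x => q.eval x * v x ^ 2) volume (-1) 1 :=
    fun q => hv2.continuousOn_mul q.continuous.continuousOn
  have h1 : ∫ x in (-1 : ℝ)..1, (wt * p).eval x * v x = tot := by
    have : ∀ x, (wt * p).eval x * v x = ∑ k ∈ s, (((k : ℝ) + 1 / 2) * b k) *
        ((wt * derivative^[j] (legendrePoly k)).eval x * v x) := by
      intro x
      rw [hp, eval_mul, eval_finsetSum, Finset.mul_sum, Finset.sum_mul]
      refine Finset.sum_congr rfl fun k _ => ?_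
      simp only [eval_mul, eval_C]
      ring
    simp only [this]
    rw [intervalIntegral.integral_finsetSum fun k _ => (hqv _).const_mul _]
    refine Finset.sum_congr rfl fun k _ => ?_
    rw [intervalIntegral.integral_const_mul, hb]
    ring
  have h2 : ∫ x in (-1 : ℝ)..1, (wt * p ^ 2).eval x = tot := polyIntegral_weight_sum_sq s j b
  have hw_t01 : ∀ x ∈ Icc (-1 : ℝ) 1, 0 ≤ wt.eval x ∧ wt.eval x ≤ 1 := by
    intro x hx
    have h3 : 0 ≤ 1 - x ^ 2 := by nlinarith [hx.1, hx.2]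
    simp only [hw_t, eval_pow, eval_sub, eval_one, eval_X]
    exact ⟨by positivity, pow_le_one₀ h3 (by nlinarith)⟩
  have h3 : 0 ≤ ∫ x in (-1 : ℝ)..1, (wt.eval x * v x ^ 2 - 2 * ((wt * p).eval x * v x)
      + (wt * p ^ 2).eval x) := by
    refine intervalIntegral.integral_nonneg (by norm_num) fun x hx => ?_
    have : wt.eval x * v x ^ 2 - 2 * ((wt * p).eval x * v x) + (wt * p ^ 2).eval x
        = wt.eval x * (v x - p.eval x) ^ 2 := by
      simp only [eval_mul, eval_pow]
      ring
    rw [this]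
    exact mul_nonneg (hw_t01 x hx).1 (sq_nonneg _)
  rw [intervalIntegral.integral_add ((hqv2 _).sub ((hqv _).const_mul _)) (hpoly _),
    intervalIntegral.integral_sub (hqv2 _) ((hqv _).const_mul _),
    intervalIntegral.integral_const_mul, h1, h2] at h3
  have h4 : ∫ x in (-1 : ℝ)..1, wt.eval x * v x ^ 2 ≤ ∫ x in (-1 : ℝ)..1, v x ^ 2 := by
    refine intervalIntegral.integral_mono_on (by norm_num) (hqv2 _) hv2 fun x hx => ?_
    exact mul_le_of_le_one_left (sq_nonneg _) (hw_t01 x hx).2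
  linarith

/-- Integration by parts against a polynomial vanishing at the end points. -/
lemma IsPrimitiveOn.integral_poly_mul {u v : ℝ → ℝ} (h : IsPrimitiveOn (-1) 1 u v) (p : ℝ[X])
    (h1 : p.eval 1 = 0) (h2 : p.eval (-1) = 0) :
    ∫ x in (-1 : ℝ)..1, p.eval x * v x = - ∫ x in (-1 : ℝ)..1, (derivative p).eval x * u x := by
  have hp : IsPrimitiveOn (-1) 1 (fun x => p.eval x) (fun x => (derivative p).eval x) :=
    IsPrimitiveOn.of_hasDerivWithinAt (by norm_num)
      (fun x _ => (p.hasDerivAt x).hasDerivWithinAt) (derivative p).continuous.continuousOn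
  have hc := h.continuousOn (by norm_num)
  rw [← uIcc_of_le (by norm_num : (-1 : ℝ) ≤ 1)] at hc
  have h3 := (hp.mul (by norm_num) h).2 1 (right_mem_Icc.2 (by norm_num))
  simp only [h1, h2, zero_mul, zero_add] at h3
  rw [intervalIntegral.integral_add
    (((derivative p).continuous.intervalIntegrable _ _).mul_continuousOn hc)
    (h.1.continuousOn_mul p.continuous.continuousOn)] at h3
  linarith

/-- The functions `w 0, …, w σ` are the successive derivatives of an `H^σ(-1,1)` function, all of
`L²` norm at most `M`. -/
structure IsSobolevChain (σ : ℕ) (M : ℝ) (w : ℕ → ℝ → ℝ) : Prop where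
  prim : ∀ j < σ, IsPrimitiveOn (-1) 1 (w j) (w (j + 1))
  sq_integrable : ∀ j ≤ σ, IntervalIntegrable (fun x => w j x ^ 2) volume (-1) 1
  sq_le : ∀ j ≤ σ, ∫ x in (-1 : ℝ)..1, w j x ^ 2 ≤ M ^ 2

/-- The (unnormalized) Legendre coefficients of a function. -/
noncomputable def legendreCoeff (h : ℝ → ℝ) (k : ℕ) : ℝ :=
  ∫ x in (-1 : ℝ)..1, (legendrePoly k).eval x * h x

namespace IsSobolevChain

variable {σ : ℕ} {M : ℝ} {w : ℕ → ℝ → ℝ}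

lemma intervalIntegrable (hw : IsSobolevChain σ M w) (hσ : 1 ≤ σ) {j : ℕ} (hj : j ≤ σ) :
    IntervalIntegrable (w j) volume (-1) 1 := by
  rcases j with _ | j
  · exact (hw.prim 0 hσ).intervalIntegrable (by norm_num)
  · exact (hw.prim j hj).1

/-- The coefficients of a higher derivative against the derivatives of Legendre polynomials are
multiples of those of the first derivative: each integration by parts uses the self-adjoint
differential equation, and the weight removes the boundary terms. -/
lemma integral_weight_eq (hw : IsSobolevChain σ M w) (k j : ℕ) (hj : j + 1 ≤ σ) :
    ∫ x in (-1 : ℝ)..1, ((1 - X ^ 2) ^ j * derivative^[j] (legendrePoly k)).eval x * w (j + 1) x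
      = legendreWeight k j * legendreCoeff (w 1) k := by
  induction j with
  | zero => simp [legendreWeight, legendreCoeff]
  | succ j ih =>
    rw [(hw.prim (j + 1) (by omega)).integral_poly_mul _ (by simp) (by simp),
      legendre_ode_selfAdjoint]
    have := ih (by omega)
    simp only [eval_neg, eval_mul (p := C _), eval_C, neg_mul, mul_assoc
      ((k : ℝ) * (k + 1) - j * (j + 1))]
    rw [intervalIntegral.integral_neg, intervalIntegral.integral_const_mul, this, neg_neg,
      legendreWeight, legendreWeight, Finset.prod_range_succ]
    ring

/-- The regularity of a function as a weighted summability of its Legendre coefficients. -/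
lemma sum_le (hw : IsSobolevChain σ M w) {j : ℕ} (hj : j + 1 ≤ σ) (s : Finset ℕ) :
    ∑ k ∈ s, ((k : ℝ) + 1 / 2) * legendreCoeff (w 1) k ^ 2 * legendreWeight k j ≤ M ^ 2 :=
  (sum_legendreWeight_le (hw.prim j hj).1 (hw.sq_integrable _ hj) j _
    (fun k => hw.integral_weight_eq k j hj) s).trans (hw.sq_le _ hj)

/-- Decay of the tail of the Legendre series. -/
lemma tail_le (hw : IsSobolevChain σ M w) {s : ℕ} (hs : s + 1 ≤ σ) {n : ℕ} (hn : 2 * s ≤ n)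
    (N : ℕ) : (n : ℝ) ^ (2 * s) *
      ∑ k ∈ Finset.Ico n N, ((k : ℝ) + 1 / 2) * legendreCoeff (w 1) k ^ 2 ≤ 2 ^ s * M ^ 2 := by
  refine le_trans ?_ (mul_le_mul_of_nonneg_left (hw.sum_le hs (Finset.Ico n N)) (by positivity))
  rw [Finset.mul_sum, Finset.mul_sum]
  refine Finset.sum_le_sum fun k hk => ?_
  have hnk : n ≤ k := (Finset.mem_Ico.1 hk).1
  have h1 : (n : ℝ) ^ (2 * s) ≤ 2 ^ s * legendreWeight k s := by
    refine le_trans ?_ (pow_le_legendreWeight (hn.trans hnk))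
    gcongr
  have h2 : 0 ≤ ((k : ℝ) + 1 / 2) * legendreCoeff (w 1) k ^ 2 := by positivity
  nlinarith [mul_le_mul_of_nonneg_right h1 h2]

/-- Decay of a single Legendre coefficient. -/
lemma coeff_le (hw : IsSobolevChain σ M w) {s : ℕ} (hs : s + 1 ≤ σ) (k : ℕ) :
    ((k : ℝ) + 1 / 2) * legendreCoeff (w 1) k ^ 2 * (k : ℝ) ^ (2 * s)
      ≤ (((2 * s : ℕ) : ℝ) ^ (2 * s) + 2 ^ s) * M ^ 2 := by
  have h0 : 0 ≤ ((k : ℝ) + 1 / 2) * legendreCoeff (w 1) k ^ 2 := by positivity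
  -- the weight is comparable to `k ^ (2 s)` only for `2 s ≤ k`; small `k` use the `L²` bound
  rcases le_total (2 * s) k with h | h
  · have h1 := hw.sum_le hs {k}
    rw [Finset.sum_singleton] at h1
    calc ((k : ℝ) + 1 / 2) * legendreCoeff (w 1) k ^ 2 * (k : ℝ) ^ (2 * s)
        ≤ ((k : ℝ) + 1 / 2) * legendreCoeff (w 1) k ^ 2 * (2 ^ s * legendreWeight k s) :=
          mul_le_mul_of_nonneg_left (pow_le_legendreWeight h) h0
      _ = 2 ^ s * (((k : ℝ) + 1 / 2) * legendreCoeff (w 1) k ^ 2 * legendreWeight k s) := by ring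
      _ ≤ 2 ^ s * M ^ 2 := mul_le_mul_of_nonneg_left h1 (by positivity)
      _ ≤ _ := mul_le_mul_of_nonneg_right (le_add_of_nonneg_left (by positivity)) (sq_nonneg _)
  · have h1 := hw.sum_le (j := 0) (by omega) {k}
    rw [Finset.sum_singleton] at h1
    simp only [legendreWeight, Finset.range_zero, Finset.prod_empty, mul_one] at h1
    calc ((k : ℝ) + 1 / 2) * legendreCoeff (w 1) k ^ 2 * (k : ℝ) ^ (2 * s)
        ≤ M ^ 2 * ((2 * s : ℕ) : ℝ) ^ (2 * s) := by gcongr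
      _ = ((2 * s : ℕ) : ℝ) ^ (2 * s) * M ^ 2 := mul_comm _ _
      _ ≤ _ := mul_le_mul_of_nonneg_right (le_add_of_nonneg_right (by positivity)) (sq_nonneg _)

end IsSobolevChain

/-! ### Integrated Legendre series -/

/-- The primitive of a Legendre polynomial that vanishes at `-1`. -/
noncomputable def legendrePrimitive (k : ℕ) : ℝ[X] :=
  if k = 0 then X + 1
  else (1 - X ^ 2) * (C (-1 / ((k : ℝ) * (k + 1))) * derivative (legendrePoly k))

lemma derivative_legendrePrimitive (k : ℕ) :
    derivative (legendrePrimitive k) = legendrePoly k := by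
  rw [legendrePrimitive]
  split_ifs with hk
  · subst hk
    simp [legendrePoly]
  · have h := derivative_lobattoPoly k
    have hk' : (k : ℝ) * (k + 1) ≠ 0 := by
      have : (k : ℝ) ≠ 0 := by exact_mod_cast hk
      positivity
    rw [mul_left_comm, derivative_C_mul, ← lobattoPoly, h, mul_neg, ← mul_assoc, ← C_mul,
      ← neg_mul, ← C_neg]
    rw [show -(-1 / ((k : ℝ) * (k + 1)) * (k * (k + 1))) = 1 by field_simp]
    simp

lemma legendrePrimitive_eval_neg_one (k : ℕ) : (legendrePrimitive k).eval (-1) = 0 := by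
  rw [legendrePrimitive]
  split_ifs <;> simp

lemma natDegree_legendrePrimitive_le (k : ℕ) : (legendrePrimitive k).natDegree ≤ k + 1 := by
  rw [legendrePrimitive]
  split_ifs with hk
  · refine (natDegree_add_le _ _).trans ?_
    simp
  · rw [mul_left_comm]
    exact (natDegree_C_mul_le _ _).trans (natDegree_lobattoPoly_le (by omega))

/-- The part of the integrated Legendre series with indices in `s`. -/
noncomputable def legendreSeries (b : ℕ → ℝ) (s : Finset ℕ) : ℝ[X] :=
  ∑ k ∈ s, C (((k : ℝ) + 1 / 2) * b k) * legendrePrimitive k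

lemma derivative_legendreSeries (b : ℕ → ℝ) (s : Finset ℕ) :
    derivative (legendreSeries b s)
      = ∑ k ∈ s, C (((k : ℝ) + 1 / 2) * b k) * legendrePoly k := by
  rw [legendreSeries, derivative_sum]
  refine Finset.sum_congr rfl fun k _ => ?_
  rw [derivative_C_mul, derivative_legendrePrimitive]

lemma legendreSeries_eval_neg_one (b : ℕ → ℝ) (s : Finset ℕ) :
    (legendreSeries b s).eval (-1) = 0 := by
  rw [legendreSeries, eval_finsetSum]
  refine Finset.sum_eq_zero fun k _ => ?_
  rw [eval_mul, legendrePrimitive_eval_neg_one, mul_zero]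

lemma natDegree_legendreSeries_le (b : ℕ → ℝ) (n : ℕ) :
    (legendreSeries b (Finset.range n)).natDegree ≤ n := by
  refine natDegree_sum_le_of_forall_le _ _ fun k hk => ?_
  exact (natDegree_C_mul_le _ _).trans ((natDegree_legendrePrimitive_le k).trans
    (Finset.mem_range.1 hk))

/-- High-frequency integrated Legendre sums are small in the uniform norm, and so are their
Gauss-Lobatto interpolants. -/
lemma legendreSeries_interpolant_bound {n : ℕ} (hn : 1 ≤ n) (b : ℕ → ℝ) (N : ℕ) {x : ℝ}
    (hx : x ∈ Icc (-1 : ℝ) 1) :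
    gaussLobattoInterpolant n (fun y => (legendreSeries b (Finset.Ico n N)).eval y) x ^ 2
        ≤ 3 * ((∑ k ∈ Finset.Ico n N, ((k : ℝ) + 1 / 2) * b k ^ 2) / n) ∧
      ((legendreSeries b (Finset.Ico n N)).eval x) ^ 2
        ≤ 2 * ((∑ k ∈ Finset.Ico n N, ((k : ℝ) + 1 / 2) * b k ^ 2) / n) := by
  set γ : ℕ → ℝ := fun k => b k * (-1 / ((k : ℝ) * (k + 1))) with hγ
  set S : ℝ[X] := ∑ k ∈ Finset.Ico n N, C (((k : ℝ) + 1 / 2) * γ k) *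
    derivative^[1] (legendrePoly k) with hS
  have hE : legendreSeries b (Finset.Ico n N) = (1 - X ^ 2) * S := by
    rw [legendreSeries, hS, Finset.mul_sum]
    refine Finset.sum_congr rfl fun k hk => ?_
    have hk0 : k ≠ 0 := by have := (Finset.mem_Ico.1 hk).1; omega
    rw [legendrePrimitive, if_neg hk0, hγ]
    simp only [C_mul, Function.iterate_one]
    ring
  have hD : polyIntegral (derivative ((1 - X ^ 2) * S) ^ 2)
      = ∑ k ∈ Finset.Ico n N, ((k : ℝ) + 1 / 2) * b k ^ 2 := by
    rw [← hE, derivative_legendreSeries]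
    have := polyIntegral_weight_sum_sq (Finset.Ico n N) 0 b
    simpa [legendreWeight] using this
  have hV : polyIntegral ((1 - X ^ 2) * S ^ 2)
      = ∑ k ∈ Finset.Ico n N, ((k : ℝ) + 1 / 2) * γ k ^ 2 * legendreWeight k 1 := by
    have := polyIntegral_weight_sum_sq (Finset.Ico n N) 1 γ
    rwa [pow_one] at this
  have hnpos : (0 : ℝ) < n := by exact_mod_cast hn
  -- termwise, since only the frequencies `k ≥ n` occur
  have hp : (n : ℝ) * (n + 1) * polyIntegral ((1 - X ^ 2) * S ^ 2)
      ≤ polyIntegral (derivative ((1 - X ^ 2) * S) ^ 2) := by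
    rw [hD, hV, Finset.mul_sum]
    refine Finset.sum_le_sum fun k hk => ?_
    have hnk : (n : ℝ) ≤ k := by exact_mod_cast (Finset.mem_Ico.1 hk).1
    have hk0 : (0 : ℝ) < k := hnpos.trans_le hnk
    simp only [hγ, legendreWeight, Finset.prod_range_one]
    have : n * (n + 1) * (((k : ℝ) + 1 / 2) * (b k * (-1 / (k * (k + 1)))) ^ 2 *
        (k * (k + 1) - (0 : ℕ) * ((0 : ℕ) + 1)))
        = (((k : ℝ) + 1 / 2) * b k ^ 2) * ((n * (n + 1)) / (k * (k + 1))) := by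
      push_cast
      field_simp
      ring
    rw [this]
    refine mul_le_of_le_one_right (by positivity) ?_
    rw [div_le_one (by positivity)]
    gcongr
  have := interpolant_and_sup_bound hn S hp hx
  rwa [hD, ← hE] at this

/-- A Markov-type inequality: derivatives of a polynomial of degree `n` in terms of its maximum
on `[-1,1]`. -/
lemma abs_iterate_derivative_le {n : ℕ} {p : ℝ[X]} (hp : p.natDegree ≤ n) {ε : ℝ}
    (hε : ∀ x ∈ Icc (-1 : ℝ) 1, p.eval x ^ 2 ≤ ε) (j : ℕ) {x : ℝ} (hx : x ∈ Icc (-1 : ℝ) 1) :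
    ((derivative^[j] p).eval x) ^ 2 ≤ ε * (((n : ℝ) + 1) * (n : ℝ) ^ (2 * j)) ^ 2 := by
  set c : ℕ → ℝ := fun k => polyIntegral (p * legendrePoly k) with hc
  have hdeg : p.degree < (n + 1 : ℕ) :=
    degree_le_natDegree.trans_lt (by exact_mod_cast Nat.lt_succ_of_le hp)
  have hexp := eq_sum_legendre (n + 1) p hdeg
  have hsq : ∑ k ∈ Finset.range (n + 1), ((k : ℝ) + 1 / 2) * c k ^ 2 ≤ 2 * ε := by
    have h1 := polyIntegral_weight_sum_sq (Finset.range (n + 1)) 0 c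
    simp only [pow_zero, one_mul, Function.iterate_zero, id, legendreWeight, Finset.range_zero,
      Finset.prod_empty, mul_one] at h1
    rw [← hexp] at h1
    rw [← h1]
    have h2 : polyIntegral (p ^ 2) ≤ polyIntegral (C ε) :=
      polyIntegral_mono fun y hy => by simpa using hε y hy
    refine h2.trans (le_of_eq ?_)
    rw [polyIntegral_apply]
    simp
    norm_num
  have hε0 : 0 ≤ ε := (sq_nonneg _).trans (hε x hx)
  have heval : (derivative^[j] p).eval x = ∑ k ∈ Finset.range (n + 1),
      (((k : ℝ) + 1 / 2) * c k) * (derivative^[j] (legendrePoly k)).eval x := by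
    conv_lhs => rw [hexp]
    rw [iterate_derivative_sum, eval_finsetSum]
    refine Finset.sum_congr rfl fun k _ => ?_
    rw [iterate_derivative_C_mul, eval_mul, eval_C]
  have hbound : |(derivative^[j] p).eval x| ≤ (n : ℝ) ^ (2 * j) *
      ∑ k ∈ Finset.range (n + 1), ((k : ℝ) + 1 / 2) * |c k| := by
    rw [heval, Finset.mul_sum]
    refine (Finset.abs_sum_le_sum_abs _ _).trans (Finset.sum_le_sum fun k hk => ?_)
    have hkn : (k : ℝ) ≤ n := by
      exact_mod_cast Nat.lt_succ_iff.1 (Finset.mem_range.1 hk)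
    have h1 := legendrePoly_deriv_abs_le k j hx
    have h2 : (k : ℝ) ^ (2 * j) ≤ (n : ℝ) ^ (2 * j) := by gcongr
    rw [abs_mul, abs_mul, abs_of_nonneg (by positivity : (0 : ℝ) ≤ (k : ℝ) + 1 / 2), mul_comm]
    exact mul_le_mul_of_nonneg_right (h1.trans h2) (by positivity)
  have hsum : ∑ k ∈ Finset.range (n + 1), ((k : ℝ) + 1 / 2) = ((n : ℝ) + 1) ^ 2 / 2 := by
    clear * -
    induction n with
    | zero => norm_num
    | succ n ih =>
      rw [Finset.sum_range_succ, ih]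
      push_cast
      ring
  have hCS : (∑ k ∈ Finset.range (n + 1), ((k : ℝ) + 1 / 2) * |c k|) ^ 2
      ≤ ((n : ℝ) + 1) ^ 2 / 2 * (2 * ε) := by
    have h1 := Finset.sum_mul_sq_le_sq_mul_sq (Finset.range (n + 1))
      (fun k => √((k : ℝ) + 1 / 2)) (fun k => √((k : ℝ) + 1 / 2) * |c k|)
    have h2 : ∀ k : ℕ, √((k : ℝ) + 1 / 2) * √((k : ℝ) + 1 / 2) = (k : ℝ) + 1 / 2 := fun k =>
      Real.mul_self_sqrt (by positivity)
    simp only [← mul_assoc, h2, mul_pow, sq_abs] at h1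
    simp only [sq (√_), h2] at h1
    rw [hsum] at h1
    exact h1.trans (mul_le_mul_of_nonneg_left hsq (by positivity))
  have h0 : 0 ≤ ∑ k ∈ Finset.range (n + 1), ((k : ℝ) + 1 / 2) * |c k| :=
    Finset.sum_nonneg fun k _ => by positivity
  calc ((derivative^[j] p).eval x) ^ 2 = |(derivative^[j] p).eval x| ^ 2 := (sq_abs _).symm
    _ ≤ ((n : ℝ) ^ (2 * j) * ∑ k ∈ Finset.range (n + 1), ((k : ℝ) + 1 / 2) * |c k|) ^ 2 := by
        gcongr
    _ = ((n : ℝ) ^ (2 * j)) ^ 2 *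
        (∑ k ∈ Finset.range (n + 1), ((k : ℝ) + 1 / 2) * |c k|) ^ 2 := by ring
    _ ≤ ((n : ℝ) ^ (2 * j)) ^ 2 * (((n : ℝ) + 1) ^ 2 / 2 * (2 * ε)) := by gcongr
    _ = _ := by ring

end LegendreCoefficients

/-! ### Approximation of Sobolev functions by Gauss-Lobatto interpolants -/

section Approximation
open Polynomial Filter Topology

/-- The derivative of a function with Lipschitz constant `L` is bounded by `L`. -/
lemma HasDerivWithinAt.abs_le_of_lipschitz {a b : ℝ} (hab : a < b) {e : ℝ → ℝ} {e' L x : ℝ}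
    (hx : x ∈ Icc a b) (hd : HasDerivWithinAt e e' (Icc a b) x)
    (hL : ∀ y ∈ Icc a b, |e y - e x| ≤ L * |y - x|) : |e'| ≤ L := by
  have hne : (𝓝[Icc a b \ {x}] x).NeBot :=
    accPt_principal_iff_nhdsWithin.1 (uniqueDiffWithinAt_iff_accPt.1 (uniqueDiffOn_Icc hab x hx))
  have h1 := (hasDerivWithinAt_iff_tendsto_slope.1 hd).abs
  refine le_of_tendsto h1 ?_
  filter_upwards [self_mem_nhdsWithin] with y hy
  have hyx : y - x ≠ 0 := sub_ne_zero.2 hy.2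
  rw [slope_def_field, abs_div, div_le_iff₀ (abs_pos.2 hyx)]
  exact hL y hy.1

lemma legendreSeries_range_eq_add (b : ℕ → ℝ) {n N : ℕ} (h : n ≤ N) :
    legendreSeries b (Finset.range N)
      = legendreSeries b (Finset.range n) + legendreSeries b (Finset.Ico n N) := by
  rw [legendreSeries, legendreSeries, legendreSeries, Finset.sum_range_add_sum_Ico _ h]

/-- Partial Legendre sums are best approximations in `L²`. -/
lemma integral_sub_legendre_sq_le {h : ℝ → ℝ} (hh : ContinuousOn h (Icc (-1) 1)) {N : ℕ}
    {q : ℝ[X]} (hq : q.degree < N) :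
    ∫ x in (-1 : ℝ)..1,
        (h x - (derivative (legendreSeries (legendreCoeff h) (Finset.range N))).eval x) ^ 2
      ≤ ∫ x in (-1 : ℝ)..1, (h x - q.eval x) ^ 2 := by
  set Q := derivative (legendreSeries (legendreCoeff h) (Finset.range N)) with hQ
  rw [← uIcc_of_le (by norm_num : (-1 : ℝ) ≤ 1)] at hh
  have hQdeg : Q.degree < N := by
    rw [hQ, derivative_legendreSeries]
    refine (degree_sum_le _ _).trans_lt ((Finset.sup_lt_iff (WithBot.bot_lt_coe N)).2 ?_)
    intro k hk
    have hkN : (legendrePoly k).degree < (N : WithBot ℕ) := degree_le_natDegree.trans_lt (by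
      exact_mod_cast (natDegree_legendrePoly_le k).trans_lt (Finset.mem_range.1 hk))
    rw [← smul_eq_C_mul]
    exact (degree_smul_le _ _).trans_lt hkN
  have horth : ∀ k < N, ∫ x in (-1 : ℝ)..1, (h x - Q.eval x) * (legendrePoly k).eval x = 0 := by
    intro k hk
    have h1 : polyIntegral (Q * legendrePoly k) = legendreCoeff h k := by
      rw [hQ, derivative_legendreSeries, Finset.sum_mul, map_sum, Finset.sum_eq_single k]
      · rw [mul_assoc, polyIntegral_C_mul, mul_right_comm, polyIntegral_legendre_mul_self, one_mul]
      · intro l _ hl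
        rw [mul_assoc, polyIntegral_C_mul, polyIntegral_legendre_mul_of_ne hl, mul_zero]
      · exact fun h => absurd (Finset.mem_range.2 hk) h
    have h2 : ∫ x in (-1 : ℝ)..1, (h x - Q.eval x) * (legendrePoly k).eval x
        = legendreCoeff h k - polyIntegral (Q * legendrePoly k) := by
      rw [legendreCoeff, polyIntegral_apply, ← intervalIntegral.integral_sub
        (hh.intervalIntegrable.continuousOn_mul (legendrePoly k).continuous.continuousOn)
        ((Polynomial.continuous _).intervalIntegrable _ _)]
      refine intervalIntegral.integral_congr fun x _ => ?_
      simp only [eval_mul]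
      ring
    rw [h2, h1, sub_self]
  obtain ⟨c, hc⟩ := exists_eq_sum_legendre N (Q - q) ((degree_sub_le _ _).trans_lt (max_lt hQdeg hq))
  have hcross : ∫ x in (-1 : ℝ)..1, (h x - Q.eval x) * (Q - q).eval x = 0 := by
    have : ∀ x, (h x - Q.eval x) * (Q - q).eval x
        = ∑ k ∈ Finset.range N, c k * ((h x - Q.eval x) * (legendrePoly k).eval x) := by
      intro x
      rw [hc, eval_finsetSum, Finset.mul_sum]
      refine Finset.sum_congr rfl fun k _ => ?_
      rw [eval_mul, eval_C]
      ring
    simp only [this]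
    have hint : ∀ k, IntervalIntegrable
        (fun x => c k * ((h x - Q.eval x) * (legendrePoly k).eval x)) volume (-1) 1 := fun k =>
      (continuousOn_const.mul ((hh.sub Q.continuous.continuousOn).mul
        (legendrePoly k).continuous.continuousOn)).intervalIntegrable
    rw [intervalIntegral.integral_finsetSum fun k _ => hint k]
    refine Finset.sum_eq_zero fun k hk => ?_
    rw [intervalIntegral.integral_const_mul, horth k (Finset.mem_range.1 hk), mul_zero]
  have hcQ : ContinuousOn (fun x => h x - Q.eval x) (uIcc (-1) 1) :=
    hh.sub Q.continuous.continuousOn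
  have hcq : ContinuousOn (fun x => (Q - q).eval x) (uIcc (-1) 1) :=
    (Q - q).continuous.continuousOn
  have hsplit : ∫ x in (-1 : ℝ)..1, (h x - q.eval x) ^ 2
      = (∫ x in (-1 : ℝ)..1, (h x - Q.eval x) ^ 2)
        + (2 * ∫ x in (-1 : ℝ)..1, (h x - Q.eval x) * (Q - q).eval x)
        + ∫ x in (-1 : ℝ)..1, (Q - q).eval x ^ 2 := by
    rw [← intervalIntegral.integral_const_mul, ← intervalIntegral.integral_add,
      ← intervalIntegral.integral_add]
    · refine intervalIntegral.integral_congr fun x _ => ?_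
      simp only [eval_sub]
      ring
    · exact ((hcQ.pow 2).add (continuousOn_const.mul (hcQ.mul hcq))).intervalIntegrable
    · exact (hcq.pow 2).intervalIntegrable
    · exact (hcQ.pow 2).intervalIntegrable
    · exact (continuousOn_const.mul (hcQ.mul hcq)).intervalIntegrable
  have hnn : 0 ≤ ∫ x in (-1 : ℝ)..1, (Q - q).eval x ^ 2 :=
    intervalIntegral.integral_nonneg (by norm_num) fun _ _ => sq_nonneg _
  rw [hsplit, hcross]
  linarith

/-- Integrated Legendre series converge; completeness comes from the Weierstrass theorem. -/
lemma tendsto_legendreSeries {u h : ℝ → ℝ} (hu : IsPrimitiveOn (-1) 1 u h)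
    (hh : ContinuousOn h (Icc (-1) 1)) {x : ℝ} (hx : x ∈ Icc (-1 : ℝ) 1) :
    Tendsto (fun N => u (-1) + (legendreSeries (legendreCoeff h) (Finset.range N)).eval x) atTop
      (𝓝 (u x)) := by
  set P : ℕ → ℝ[X] := fun N => legendreSeries (legendreCoeff h) (Finset.range N) with hP
  have hsq : ∀ N, (u x - (u (-1) + (P N).eval x)) ^ 2
      ≤ 2 * ∫ t in (-1 : ℝ)..1, (h t - (derivative (P N)).eval t) ^ 2 := by
    intro N
    have hc : ContinuousOn (fun t => h t - (derivative (P N)).eval t) (Icc (-1) 1) :=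
      hh.sub (Polynomial.continuous _).continuousOn
    have h0 : IntervalIntegrable h volume (-1) x := hu.1.mono_set (by
      rw [uIcc_of_le hx.1, uIcc_of_le (by norm_num)]
      exact Icc_subset_Icc le_rfl hx.2)
    have h1 : ∫ t in (-1 : ℝ)..x, 1 * (h t - (derivative (P N)).eval t)
        = u x - (u (-1) + (P N).eval x) := by
      simp only [one_mul]
      rw [intervalIntegral.integral_sub h0 ((Polynomial.continuous _).intervalIntegrable _ _),
        intervalIntegral.integral_eq_sub_of_hasDerivAt (fun t _ => (P N).hasDerivAt t)
          ((Polynomial.continuous _).intervalIntegrable _ _), hP, legendreSeries_eval_neg_one,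
        hu.2 x hx]
      ring
    have h2 := sq_integral_mul_le (f := fun _ => (1 : ℝ)) hx.1 continuousOn_const
      (hc.mono (Icc_subset_Icc le_rfl hx.2))
    rw [h1] at h2
    simp only [one_pow, intervalIntegral.integral_const, smul_eq_mul, mul_one] at h2
    rw [← uIcc_of_le (by norm_num : (-1 : ℝ) ≤ 1)] at hc
    have h3 : ∫ t in (-1 : ℝ)..x, (h t - (derivative (P N)).eval t) ^ 2
        ≤ ∫ t in (-1 : ℝ)..1, (h t - (derivative (P N)).eval t) ^ 2 :=
      intervalIntegral.integral_mono_interval le_rfl hx.1 hx.2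
        (Eventually.of_forall fun t => sq_nonneg _) (hc.pow 2).intervalIntegrable
    have h4 : 0 ≤ ∫ t in (-1 : ℝ)..x, (h t - (derivative (P N)).eval t) ^ 2 :=
      intervalIntegral.integral_nonneg hx.1 fun _ _ => sq_nonneg _
    exact h2.trans (mul_le_mul (by linarith [hx.2]) h3 h4 (by norm_num))
  rw [Metric.tendsto_atTop]
  intro ε hε
  obtain ⟨q, hq⟩ := exists_polynomial_near_of_continuousOn (-1) 1 h hh (ε / 4) (by positivity)
  refine ⟨q.natDegree + 1, fun N hN => ?_⟩
  have hqN : q.degree < N :=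
    degree_le_natDegree.trans_lt (by exact_mod_cast (by omega : q.natDegree < N))
  have h1 := integral_sub_legendre_sq_le hh hqN
  have hc : ContinuousOn (fun t => h t - q.eval t) (uIcc (-1) 1) := by
    rw [uIcc_of_le (by norm_num)]
    exact hh.sub q.continuous.continuousOn
  have h2 : ∫ t in (-1 : ℝ)..1, (h t - q.eval t) ^ 2 ≤ ∫ _t in (-1 : ℝ)..1, (ε / 4) ^ 2 := by
    refine intervalIntegral.integral_mono_on (by norm_num) (hc.pow 2).intervalIntegrable
      (by simp) fun t ht => ?_
    have := hq t ht
    rw [abs_sub_comm] at this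
    rw [← sq_abs]
    gcongr
  rw [intervalIntegral.integral_const, smul_eq_mul] at h2
  have h3 := hsq N
  rw [Real.dist_eq, abs_sub_comm]
  refine abs_lt_of_sq_lt_sq ?_ hε.le
  nlinarith

lemma gaussLobattoInterpolant_poly {n : ℕ} (hn : 1 ≤ n) {p : ℝ[X]} (hp : p.natDegree ≤ n) :
    Lagrange.interpolate (gaussLobattoNodes n) id (fun y => p.eval y) = p := by
  refine (Lagrange.eq_interpolate (injOn_id _) ?_).symm
  rw [gaussLobattoNodes_card hn]
  exact degree_le_natDegree.trans_lt (by exact_mod_cast Nat.lt_succ_of_le hp)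

lemma sum_inv_sq_Ico_le {n : ℕ} (hn : 1 ≤ n) (N : ℕ) :
    ∑ k ∈ Finset.Ico n N, ((k : ℝ) ^ 2)⁻¹ ≤ 2 / n := by
  have h := sum_Ioo_inv_sq_le (α := ℝ) (n - 1) N
  have h1 : Finset.Ioo (n - 1) N = Finset.Ico n N := by
    ext k; simp only [Finset.mem_Ioo, Finset.mem_Ico]; omega
  rw [h1] at h
  have h2 : ((n - 1 : ℕ) : ℝ) + 1 = n := by
    rw [Nat.cast_sub hn]; simp
  rwa [h2] at h

/-- All derivatives below the top order are uniformly bounded. -/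
lemma IsSobolevChain.abs_le {σ : ℕ} {M : ℝ} {w : ℕ → ℝ → ℝ} (hw : IsSobolevChain σ M w) {j : ℕ}
    (hj : j < σ) {x : ℝ} (hx : x ∈ Icc (-1 : ℝ) 1) : |w j x| ≤ 2 * (1 + M ^ 2) := by
  have hL1 : ∀ i ≤ σ, ∫ t in (-1 : ℝ)..1, |w i t| ≤ 1 + M ^ 2 := by
    intro i hi
    have hint := hw.intervalIntegrable (by omega) hi
    have h1 : ∫ t in (-1 : ℝ)..1, |w i t| ≤ ∫ t in (-1 : ℝ)..1, ((1 : ℝ) / 2 + w i t ^ 2) := by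
      refine intervalIntegral.integral_mono_on (by norm_num) hint.abs
        ((by simp : IntervalIntegrable (fun _ => (1 : ℝ) / 2) volume (-1) 1).add
          (hw.sq_integrable i hi)) fun t _ => ?_
      rw [← sq_abs (w i t)]
      nlinarith [sq_nonneg (|w i t| - 1 / 2)]
    rw [intervalIntegral.integral_add (by simp) (hw.sq_integrable i hi)] at h1
    have h2 := hw.sq_le i hi
    norm_num at h1
    linarith
  have hprim := hw.prim j hj
  have hd : ∀ y ∈ Icc (-1 : ℝ) 1, |w j x| ≤ |w j y| + (1 + M ^ 2) := by
    intro y hy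
    have h1 := hprim.sub_eq hy hx
    have h2 : |w j x - w j y| ≤ ∫ t in (-1 : ℝ)..1, |w (j + 1) t| := by
      rw [h1]
      have h5 := intervalIntegral.norm_integral_le_integral_norm_uIoc
        (f := w (j + 1)) (a := y) (b := x) (μ := volume)
      rw [Real.norm_eq_abs] at h5
      refine h5.trans ?_
      rw [intervalIntegral.integral_of_le (by norm_num)]
      refine setIntegral_mono_set ?_ (Eventually.of_forall fun t => norm_nonneg _)
        (LE.le.eventuallyLE ?_)
      · have := hprim.1.norm
        rwa [intervalIntegrable_iff_integrableOn_Ioc_of_le (by norm_num)] at this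
      · exact Ioc_subset_Ioc (le_min hy.1 hx.1) (max_le hy.2 hx.2)
    have h3 := abs_sub_abs_le_abs_sub (w j x) (w j y)
    linarith [hL1 (j + 1) hj]
  have hc := hprim.intervalIntegrable (by norm_num)
  have h1 : ∫ _y in (-1 : ℝ)..1, |w j x| ≤ ∫ y in (-1 : ℝ)..1, (|w j y| + (1 + M ^ 2)) :=
    intervalIntegral.integral_mono_on (by norm_num) (by simp) (hc.abs.add (by simp)) hd
  rw [intervalIntegral.integral_add hc.abs (by simp)] at h1
  simp only [intervalIntegral.integral_const, smul_eq_mul] at h1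
  nlinarith [hL1 j hj.le, sq_nonneg M]

end Approximation

/-! ### Error bounds for Gauss-Lobatto interpolation -/

section InterpolationError
open Polynomial Filter Topology

namespace IsSobolevChain

variable {m s : ℕ} {M : ℝ} {w : ℕ → ℝ → ℝ}

/-- The size of the constant in the decay of the Legendre coefficients. -/
noncomputable def decayConst (s : ℕ) (M : ℝ) : ℝ :=
  √(2 * ((((2 * s : ℕ) : ℝ) ^ (2 * s) + 2 ^ s) * M ^ 2))

/-- Derivatives of Legendre polynomials grow like `k ^ (2 i)` by `legendrePoly_deriv_abs_le`. For
`4 m + 5 ≤ 2 s` the decay of the coefficients leaves a summable factor `k ^ (-2)`. -/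
lemma term_le (hw : IsSobolevChain (s + 1) M w) (hs : 2 * m + 3 ≤ s) {i : ℕ} (hi : i ≤ m) {k : ℕ}
    (hk : 1 ≤ k) :
    ((k : ℝ) + 1 / 2) * |legendreCoeff (w 1) k| * (k : ℝ) ^ (2 * i)
      ≤ decayConst s M * ((k : ℝ) ^ 2)⁻¹ := by
  set A := ((((2 * s : ℕ) : ℝ) ^ (2 * s) + 2 ^ s) * M ^ 2) with hA
  have hA0 : 0 ≤ A := by positivity
  have hk1 : (1 : ℝ) ≤ k := by exact_mod_cast hk
  have hk0 : (0 : ℝ) < k := by linarith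
  have h1 := hw.coeff_le le_rfl k
  rw [← hA] at h1
  rw [← div_eq_mul_inv, le_div_iff₀ (by positivity)]
  refine Real.le_sqrt_of_sq_le ?_
  have h2 : (k : ℝ) * (k : ℝ) ^ (4 * i + 4) ≤ (k : ℝ) ^ (2 * s) := by
    rw [← pow_succ']
    exact pow_le_pow_right₀ hk1 (by omega)
  set β := legendreCoeff (w 1) k
  have hβ : 0 ≤ ((k : ℝ) + 1 / 2) * β ^ 2 := by positivity
  calc (((k : ℝ) + 1 / 2) * |β| * (k : ℝ) ^ (2 * i) * (k : ℝ) ^ 2) ^ 2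
      = ((k : ℝ) + 1 / 2) * (k : ℝ) ^ (4 * i + 4) * (((k : ℝ) + 1 / 2) * β ^ 2) := by
        rw [← sq_abs β]; ring
    _ ≤ (2 * k) * (k : ℝ) ^ (4 * i + 4) * (((k : ℝ) + 1 / 2) * β ^ 2) := by
        gcongr; linarith
    _ = 2 * (k * (k : ℝ) ^ (4 * i + 4)) * (((k : ℝ) + 1 / 2) * β ^ 2) := by ring
    _ ≤ 2 * (k : ℝ) ^ (2 * s) * (((k : ℝ) + 1 / 2) * β ^ 2) := by gcongr
    _ = 2 * (((k : ℝ) + 1 / 2) * β ^ 2 * (k : ℝ) ^ (2 * s)) := by ring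
    _ ≤ 2 * A := by linarith

lemma sum_term_le (hw : IsSobolevChain (s + 1) M w) (hs : 2 * m + 3 ≤ s) {i : ℕ} (hi : i ≤ m)
    {n : ℕ} (hn : 1 ≤ n) (N : ℕ) :
    ∑ k ∈ Finset.Ico n N, ((k : ℝ) + 1 / 2) * |legendreCoeff (w 1) k| * (k : ℝ) ^ (2 * i)
      ≤ 2 * decayConst s M / n := by
  have h0 : 0 ≤ decayConst s M := Real.sqrt_nonneg _
  calc _ ≤ ∑ k ∈ Finset.Ico n N, decayConst s M * ((k : ℝ) ^ 2)⁻¹ :=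
        Finset.sum_le_sum fun k hk => hw.term_le hs hi (hn.trans (Finset.mem_Ico.1 hk).1)
    _ = decayConst s M * ∑ k ∈ Finset.Ico n N, ((k : ℝ) ^ 2)⁻¹ := (Finset.mul_sum _ _ _).symm
    _ ≤ decayConst s M * (2 / n) := mul_le_mul_of_nonneg_left (sum_inv_sq_Ico_le hn N) h0
    _ = _ := by ring

lemma abs_series_deriv_le (b : ℕ → ℝ) (S : Finset ℕ) (i : ℕ) {x : ℝ}
    (hx : x ∈ Icc (-1 : ℝ) 1) :
    |(derivative^[i + 1] (legendreSeries b S)).eval x|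
      ≤ ∑ k ∈ S, ((k : ℝ) + 1 / 2) * |b k| * (k : ℝ) ^ (2 * i) := by
  rw [Function.iterate_succ_apply, derivative_legendreSeries, iterate_derivative_sum,
    eval_finsetSum]
  refine (Finset.abs_sum_le_sum_abs _ _).trans (Finset.sum_le_sum fun k _ => ?_)
  rw [iterate_derivative_C_mul, eval_mul, eval_C, abs_mul, abs_mul,
    abs_of_nonneg (by positivity : (0 : ℝ) ≤ (k : ℝ) + 1 / 2)]
  exact mul_le_mul_of_nonneg_left (legendrePoly_deriv_abs_le k i hx) (by positivity)

/-- The derivatives of all partial sums are bounded uniformly. The index `0`, to which the decay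
estimate does not apply, is split off. -/
lemma partial_sum_deriv_le (hw : IsSobolevChain (s + 1) M w) (hs : 2 * m + 3 ≤ s) {i : ℕ}
    (hi : i ≤ m) (n : ℕ) {x : ℝ} (hx : x ∈ Icc (-1 : ℝ) 1) :
    |(derivative^[i + 1] (legendreSeries (legendreCoeff (w 1)) (Finset.range n))).eval x|
      ≤ |M| + 2 * decayConst s M := by
  refine (abs_series_deriv_le _ _ i hx).trans ?_
  have h0 : 0 ≤ decayConst s M := Real.sqrt_nonneg _
  rcases n with _ | n
  · simp only [Finset.range_zero, Finset.sum_empty]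
    positivity
  · rw [← Finset.sum_range_add_sum_Ico _ (by omega : 1 ≤ n + 1), Finset.sum_range_one]
    have h1 := hw.sum_term_le hs hi le_rfl (n + 1)
    have h2 := hw.sum_le (j := 0) (by omega) {0}
    rw [Finset.sum_singleton] at h2
    simp only [legendreWeight, Finset.range_zero, Finset.prod_empty, mul_one, Nat.cast_zero,
      zero_add] at h2
    set β := legendreCoeff (w 1) 0
    have h3 : 1 / 2 * |β| ≤ |M| := by
      refine abs_le_of_sq_le_sq' ?_ (abs_nonneg _) |>.2
      rw [mul_pow, sq_abs, sq_abs]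
      nlinarith [sq_nonneg β]
    have h4 : ((0 : ℕ) : ℝ) ^ (2 * i) ≤ 1 := by
      rcases Nat.eq_zero_or_pos i with rfl | hi0
      · simp
      · rw [Nat.cast_zero, zero_pow (by omega)]; norm_num
    have h5 : (((0 : ℕ) : ℝ) + 1 / 2) * |β| * ((0 : ℕ) : ℝ) ^ (2 * i) ≤ |M| := by
      refine le_trans (mul_le_of_le_one_right (by positivity) h4) ?_
      simpa using h3
    simp only [Nat.cast_one, div_one] at h1
    linarith

end IsSobolevChain

lemma gaussLobattoInterpolant_add (n : ℕ) (f g : ℝ → ℝ) (x : ℝ) :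
    gaussLobattoInterpolant n (fun y => f y + g y) x
      = gaussLobattoInterpolant n f x + gaussLobattoInterpolant n g x := by
  simp only [gaussLobattoInterpolant_eq_sum, add_mul, Finset.sum_add_distrib]

lemma tendsto_gaussLobattoInterpolant {n : ℕ} (hn : 1 ≤ n) {F : ℕ → ℝ → ℝ} {f : ℝ → ℝ}
    (h : ∀ x ∈ Icc (-1 : ℝ) 1, Tendsto (fun N => F N x) atTop (𝓝 (f x))) (x : ℝ) :
    Tendsto (fun N => gaussLobattoInterpolant n (F N) x) atTop
      (𝓝 (gaussLobattoInterpolant n f x)) := by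
  simp only [gaussLobattoInterpolant_eq_sum]
  exact tendsto_finsetSum _ fun i hi =>
    (h i (gaussLobattoNodes_mem_Icc hn hi)).mul tendsto_const_nhds

/-- Gauss-Lobatto interpolation of an `H^{s+1}` function with `s ≥ 2m + 3`: error bounds for the
function and its derivative, and uniform bounds for the derivatives of order at most `m + 1` of
the interpolants. -/
theorem exists_interpolation_bounds (m s : ℕ) (hs : 2 * m + 3 ≤ s) (M : ℝ) :
    ∃ C : ℝ, 0 ≤ C ∧ ∀ w : ℕ → ℝ → ℝ, IsSobolevChain (s + 1) M w → ∀ n : ℕ, 1 ≤ n → 2 * s ≤ n →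
      ∀ x ∈ Icc (-1 : ℝ) 1,
        (w 0 x - (Lagrange.interpolate (gaussLobattoNodes n) id (w 0)).eval x) ^ 2
            ≤ C / ((n : ℝ) ^ (2 * s) * n) ∧
        (w 1 x - (derivative (Lagrange.interpolate (gaussLobattoNodes n) id (w 0))).eval x) ^ 2
            ≤ C / n ∧
        ∀ j ≤ m,
          |(derivative^[j + 1] (Lagrange.interpolate (gaussLobattoNodes n) id (w 0))).eval x|
            ≤ C := by
  set K := 2 ^ s * M ^ 2 with hK
  have hK0 : 0 ≤ K := by positivity
  set B := IsSobolevChain.decayConst s M with hB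
  have hB0 : 0 ≤ B := Real.sqrt_nonneg _
  -- one constant serving the three bounds
  set C := |M| + 2 * B + 12 * K + 1 + (8 * B ^ 2 + 24 * K) with hC
  refine ⟨C, by positivity, fun w hw n hn hsn x hx => ?_⟩
  have hn1 : (1 : ℝ) ≤ n := by exact_mod_cast hn
  have hn0 : (0 : ℝ) < n := by linarith
  set b := legendreCoeff (w 1) with hb
  set p : ℝ[X] := Polynomial.C (w 0 (-1)) + legendreSeries b (Finset.range n) with hp
  have hpdeg : p.natDegree ≤ n :=
    (natDegree_add_le _ _).trans (max_le (by simp) (natDegree_legendreSeries_le b n))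
  set e : ℝ → ℝ := fun y => w 0 y - p.eval y with he
  have hprim := hw.prim 0 (by omega)
  have hc1 := (hw.prim 1 (by omega)).continuousOn (by norm_num)
  -- the error is the limit of the high-frequency parts of the Legendre series
  have hlim : ∀ y ∈ Icc (-1 : ℝ) 1,
      Tendsto (fun N => (legendreSeries b (Finset.Ico n N)).eval y) atTop (𝓝 (e y)) := by
    intro y hy
    have h1 := (tendsto_legendreSeries hprim hc1 hy).sub_const (p.eval y)
    refine h1.congr' ?_
    filter_upwards [eventually_ge_atTop n] with N hN
    rw [legendreSeries_range_eq_add _ hN]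
    simp only [hp, eval_add, eval_C, hb]
    ring
  have hT : ∀ N, (∑ k ∈ Finset.Ico n N, ((k : ℝ) + 1 / 2) * b k ^ 2) / n
      ≤ K / ((n : ℝ) ^ (2 * s) * n) := by
    intro N
    rw [← div_div]
    refine div_le_div_of_nonneg_right ?_ hn0.le
    rw [le_div_iff₀ (by positivity), mul_comm]
    exact hw.tail_le le_rfl hsn N
  set T := K / ((n : ℝ) ^ (2 * s) * n) with hTdef
  have hT0 : 0 ≤ T := by positivity
  have hI : ∀ y ∈ Icc (-1 : ℝ) 1, gaussLobattoInterpolant n e y ^ 2 ≤ 3 * T := by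
    intro y hy
    refine le_of_tendsto' ((tendsto_gaussLobattoInterpolant hn hlim y).pow 2) fun N => ?_
    exact (legendreSeries_interpolant_bound hn b N hy).1.trans
      (mul_le_mul_of_nonneg_left (hT N) (by norm_num))
  have hE : ∀ y ∈ Icc (-1 : ℝ) 1, e y ^ 2 ≤ 2 * T := by
    intro y hy
    refine le_of_tendsto' ((hlim y hy).pow 2) fun N => ?_
    exact (legendreSeries_interpolant_bound hn b N hy).2.trans
      (mul_le_mul_of_nonneg_left (hT N) (by norm_num))
  set G := Lagrange.interpolate (gaussLobattoNodes n) id (w 0) with hG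
  -- `p` is reproduced by interpolation, so `G - p` interpolates the high-frequency error `e`
  have hGe : ∀ y, (G - p).eval y = gaussLobattoInterpolant n e y := by
    intro y
    have h1 : gaussLobattoInterpolant n (w 0) y
        = gaussLobattoInterpolant n e y + gaussLobattoInterpolant n (fun y => p.eval y) y := by
      rw [← gaussLobattoInterpolant_add]
      congr 1
      ext z
      simp only [he]
      ring
    have h2 : gaussLobattoInterpolant n (fun y => p.eval y) y = p.eval y := by
      rw [gaussLobattoInterpolant, gaussLobattoInterpolant_poly hn hpdeg]
    rw [eval_sub, hG, ← gaussLobattoInterpolant, h1, h2]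
    ring
  have hGdeg : (G - p).natDegree ≤ n := by
    refine (natDegree_sub_le _ _).trans (max_le ?_ hpdeg)
    have h1 := Lagrange.degree_interpolate_lt (w 0) (v := (id : ℝ → ℝ))
      (s := gaussLobattoNodes n) (injOn_id _)
    rw [gaussLobattoNodes_card hn] at h1
    exact natDegree_le_iff_coeff_eq_zero.2 fun N hN => (degree_lt_iff_coeff_zero _ _).1 h1 N hN
  -- the Markov inequality costs a factor `n ^ (2 j + 1)`, which `T` outweighs for `j ≤ m + 1`
  have hGp : ∀ j ≤ m + 1, ((derivative^[j] (G - p)).eval x) ^ 2 ≤ 12 * K / n := by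
    intro j hj
    have h1 := abs_iterate_derivative_le hGdeg (ε := 3 * T)
      (fun y hy => by rw [hGe]; exact hI y hy) j hx
    refine h1.trans ?_
    have h2 : (n : ℝ) ^ 2 * (n : ℝ) ^ (4 * j) ≤ (n : ℝ) ^ (2 * s) := by
      rw [← pow_add]
      exact pow_le_pow_right₀ hn1 (by omega)
    have h3 : (((n : ℝ) + 1) * (n : ℝ) ^ (2 * j)) ^ 2 ≤ 4 * (n : ℝ) ^ (2 * s) := by
      calc (((n : ℝ) + 1) * (n : ℝ) ^ (2 * j)) ^ 2 ≤ ((2 * n) * (n : ℝ) ^ (2 * j)) ^ 2 := by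
            gcongr; linarith
        _ = 4 * ((n : ℝ) ^ 2 * (n : ℝ) ^ (4 * j)) := by ring
        _ ≤ _ := by gcongr
    calc 3 * T * (((n : ℝ) + 1) * (n : ℝ) ^ (2 * j)) ^ 2
        ≤ 3 * T * (4 * (n : ℝ) ^ (2 * s)) := by gcongr
      _ = 12 * K / n := by rw [hTdef]; field_simp; ring
  refine ⟨?_, ?_, ?_⟩
  · have h1 : w 0 x - G.eval x = e x - gaussLobattoInterpolant n e x := by
      rw [← hGe, eval_sub]; simp only [he]; ring
    rw [h1]
    have h2 : (e x - gaussLobattoInterpolant n e x) ^ 2 ≤ 10 * T := by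
      nlinarith [hE x hx, hI x hx, sq_nonneg (e x + gaussLobattoInterpolant n e x)]
    refine h2.trans ?_
    rw [hTdef, ← mul_div_assoc]
    refine div_le_div_of_nonneg_right ?_ (by positivity)
    rw [hC]
    nlinarith [abs_nonneg M, sq_nonneg B]
  -- the derivative of `e` is bounded through the Lipschitz constants of the partial sums, which
  -- pass to the limit without any convergence of derivatives
  · have hL : |w 1 x - (derivative p).eval x| ≤ 2 * B / n := by
      have hd : HasDerivWithinAt e (w 1 x - (derivative p).eval x) (Icc (-1) 1) x :=
        (hprim.hasDerivWithinAt (by norm_num) hc1 hx).sub (p.hasDerivAt x).hasDerivWithinAt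
      refine hd.abs_le_of_lipschitz (by norm_num) hx fun y hy => ?_
      refine le_of_tendsto' (((hlim y hy).sub (hlim x hx)).abs) fun N => ?_
      set q := legendreSeries b (Finset.Ico n N)
      have hq : ∀ z ∈ Icc (-1 : ℝ) 1, ‖(derivative q).eval z‖ ≤ 2 * B / n := by
        intro z hz
        have h1 := IsSobolevChain.abs_series_deriv_le b (Finset.Ico n N) 0 hz
        exact h1.trans (hw.sum_term_le hs (Nat.zero_le m) hn N)
      have := (convex_Icc (-1 : ℝ) 1).norm_image_sub_le_of_norm_hasDerivWithin_le
        (f := fun z => q.eval z) (fun z _ => (q.hasDerivAt z).hasDerivWithinAt) hq hx hy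
      simpa [Real.norm_eq_abs] using this
    have h1 := hGp 1 (by omega)
    rw [Function.iterate_one, derivative_sub, eval_sub] at h1
    have h2 : (w 1 x - (derivative p).eval x) ^ 2 ≤ 4 * B ^ 2 / n := by
      rw [← sq_abs]
      calc |w 1 x - (derivative p).eval x| ^ 2 ≤ (2 * B / n) ^ 2 := by gcongr
        _ = 4 * B ^ 2 / n / n := by field_simp; ring
        _ ≤ 4 * B ^ 2 / n := div_le_self (by positivity) hn1
    have h3 : (w 1 x - (derivative G).eval x) ^ 2 ≤ 2 * (4 * B ^ 2 / n) + 2 * (12 * K / n) := by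
      nlinarith [sq_nonneg (w 1 x - (derivative p).eval x
        + ((derivative G).eval x - (derivative p).eval x))]
    refine h3.trans ?_
    rw [le_div_iff₀ hn0]
    have h4 : (2 * (4 * B ^ 2 / n) + 2 * (12 * K / n)) * n = 8 * B ^ 2 + 24 * K := by
      field_simp; ring
    rw [h4, hC]
    linarith [abs_nonneg M]
  · intro j hj
    have h1 := hGp (j + 1) (by omega)
    have h2 := hw.partial_sum_deriv_le hs hj n hx
    have h3 : derivative^[j + 1] p = derivative^[j + 1] (legendreSeries b (Finset.range n)) := by
      rw [hp, Function.iterate_succ_apply, Function.iterate_succ_apply, derivative_add,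
        derivative_C, zero_add]
    rw [← hb, ← h3] at h2
    rw [iterate_derivative_sub, eval_sub] at h1
    set u := (derivative^[j + 1] G).eval x
    set v := (derivative^[j + 1] p).eval x
    have h4 : (u - v) ^ 2 ≤ 12 * K := h1.trans (div_le_self (by positivity) hn1)
    have h5 : |u - v| ≤ 12 * K + 1 := by
      refine abs_le_of_sq_le_sq' ?_ (by positivity) |> abs_le.2
      nlinarith
    have h6 : |u| ≤ |v| + |u - v| := by
      have := abs_add_le v (u - v)
      rwa [add_sub_cancel] at this
    rw [hC]
    nlinarith [sq_nonneg B]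

end InterpolationError

/-! ### An interpolation inequality of Landau–Kolmogorov type in `L¹` -/

lemma IsPrimitiveOn.reflect {a b : ℝ} {u v : ℝ → ℝ} (h : IsPrimitiveOn a b u v) :
    IsPrimitiveOn a b (fun x => u (a + b - x)) (fun x => -v (a + b - x)) := by
  refine ⟨?_, fun x hx => ?_⟩
  · have := (h.1.comp_sub_left (a + b)).symm
    simp only [add_sub_cancel_left, add_sub_cancel_right] at this
    exact this.neg
  · have h1 := h.sub_eq (x := a + b - x) (y := b) ⟨by linarith [hx.2], by linarith [hx.1]⟩
      ⟨hx.1.trans hx.2, le_rfl⟩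
    rw [intervalIntegral.integral_neg, intervalIntegral.integral_comp_sub_left]
    simp only [add_sub_cancel_left]
    linarith

lemma intervalIntegrable_of_subset {a b p q : ℝ} {u : ℝ → ℝ} (hu : IntervalIntegrable u volume a b)
    (h1 : a ≤ p) (h2 : p ≤ q) (h3 : q ≤ b) : IntervalIntegrable u volume p q :=
  hu.mono_set (by
    rw [uIcc_of_le h2, uIcc_of_le (h1.trans (h2.trans h3))]
    exact Icc_subset_Icc h1 h3)

lemma integral_abs_le_of_subset {a b p q : ℝ} {u : ℝ → ℝ} (hu : IntervalIntegrable u volume a b)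
    (h1 : a ≤ p) (h2 : p ≤ q) (h3 : q ≤ b) : ∫ x in p..q, |u x| ≤ ∫ x in a..b, |u x| :=
  intervalIntegral.integral_mono_interval h1 h2 h3 (Filter.Eventually.of_forall fun _ => abs_nonneg _)
    hu.abs

/-- Moving averages do not increase the `L¹` norm. -/
lemma integral_integral_abs_le {a b c h : ℝ} {v : ℝ → ℝ} (hv : IntervalIntegrable v volume a b)
    (hh : 0 ≤ h) (hac : a ≤ c) (hcb : c + h ≤ b) :
    ∫ x in a..c, ∫ t in x..(x + h), |v t| ≤ h * ∫ t in a..b, |v t| := by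
  set V : ℝ → ℝ := fun x => ∫ t in a..x, |v t| with hV
  have hab : a ≤ b := by linarith
  have hprim : IsPrimitiveOn a b V (fun t => |v t|) := ⟨hv.abs, fun x _ => by simp [hV]⟩
  have hVi := hprim.intervalIntegrable hab
  have e1 : ∫ x in a..c, ∫ t in x..(x + h), |v t| = ∫ x in a..c, (V (x + h) - V x) := by
    refine intervalIntegral.integral_congr fun x hx => ?_
    rw [uIcc_of_le hac] at hx
    exact (hprim.sub_eq ⟨hx.1, by linarith [hx.2]⟩ ⟨by linarith [hx.1], by linarith [hx.2]⟩).symm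
  have i1 : IntervalIntegrable (fun x => V (x + h)) volume a c := by
    have := (intervalIntegrable_of_subset hVi (p := a + h) (q := c + h) (by linarith)
      (by linarith) hcb).comp_add_right h
    simpa using this
  have i2 := intervalIntegrable_of_subset hVi le_rfl hac (by linarith : c ≤ b)
  rw [e1, intervalIntegral.integral_sub i1 i2, intervalIntegral.integral_comp_add_right]
  have i3 := intervalIntegrable_of_subset hVi (p := a) (q := a + h) le_rfl (by linarith)
    (by linarith)
  have i4 := intervalIntegrable_of_subset hVi (p := c) (q := c + h) hac (by linarith) hcb
  have i5 := intervalIntegrable_of_subset hVi (p := a) (q := c + h) le_rfl (by linarith) hcb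
  have e2 := intervalIntegral.integral_add_adjacent_intervals i3
    (intervalIntegrable_of_subset hVi (p := a + h) (q := c + h) (by linarith) (by linarith) hcb)
  have e3 := intervalIntegral.integral_add_adjacent_intervals i2 i4
  have hV0 : ∀ x ∈ Icc a b, 0 ≤ V x := fun x hx =>
    intervalIntegral.integral_nonneg hx.1 fun _ _ => abs_nonneg _
  have hVb : ∀ x ∈ Icc a b, V x ≤ V b := fun x hx =>
    integral_abs_le_of_subset hv le_rfl hx.1 hx.2
  have h1 : 0 ≤ ∫ x in a..(a + h), V x :=
    intervalIntegral.integral_nonneg (by linarith) fun x hx =>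
      hV0 x ⟨hx.1, by linarith [hx.2]⟩
  have h2 : ∫ x in c..(c + h), V x ≤ ∫ _ in c..(c + h), V b :=
    intervalIntegral.integral_mono_on (by linarith) i4 intervalIntegrable_const
      fun x hx => hVb x ⟨by linarith [hx.1], by linarith [hx.2]⟩
  rw [intervalIntegral.integral_const, smul_eq_mul, add_sub_cancel_left] at h2
  linarith

/-- Bound for `u'` on the part of the interval where the forward difference `u (x + h) - u x` is
defined: the difference quotient differs from `u' x` by at most a moving integral of `|v|`. -/
lemma IsPrimitiveOn.integral_abs_left_le {a b c h : ℝ} {u u' v : ℝ → ℝ}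
    (hu : IsPrimitiveOn a b u u') (hu' : IsPrimitiveOn a b u' v) (hh : 0 < h) (hac : a ≤ c)
    (hcb : c + h ≤ b) :
    ∫ x in a..c, |u' x| ≤ 2 / h * (∫ x in a..b, |u x|) + h * ∫ x in a..b, |v x| := by
  have hab : a ≤ b := by linarith
  have hui := hu.intervalIntegrable hab
  have hpt : ∀ x ∈ Icc a c, h * |u' x| ≤ |u (x + h)| + |u x| + h * ∫ t in x..(x + h), |v t| := by
    intro x hx
    have hx0 : x ∈ Icc a b := ⟨hx.1, by linarith [hx.2]⟩
    have hx1 : x + h ∈ Icc a b := ⟨by linarith [hx.1], by linarith [hx.2]⟩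
    have e1 := hu.sub_eq hx0 hx1
    have iu' := intervalIntegrable_of_subset hu.1 hx.1 (by linarith : x ≤ x + h) hx1.2
    have e2 : ∫ t in x..(x + h), (u' t - u' x) = u (x + h) - u x - h * u' x := by
      rw [intervalIntegral.integral_sub iu' intervalIntegrable_const, ← e1,
        intervalIntegral.integral_const, smul_eq_mul, add_sub_cancel_left]
    have e3 : |∫ t in x..(x + h), (u' t - u' x)| ≤ (∫ t in x..(x + h), |v t|) * |x + h - x| := by
      rw [← Real.norm_eq_abs]
      refine intervalIntegral.norm_integral_le_of_norm_le_const fun t ht => ?_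
      rw [uIoc_of_le (by linarith)] at ht
      have ht' : t ∈ Icc a b := ⟨by linarith [hx.1, ht.1], by linarith [hx1.2, ht.2]⟩
      rw [hu'.sub_eq hx0 ht', Real.norm_eq_abs]
      refine (intervalIntegral.abs_integral_le_integral_abs ht.1.le).trans ?_
      exact integral_abs_le_of_subset
        (intervalIntegrable_of_subset hu'.1 hx.1 (by linarith) hx1.2) le_rfl ht.1.le ht.2
    rw [e2, add_sub_cancel_left, abs_of_pos hh] at e3
    have e4 : h * |u' x| = |h * u' x| := by rw [abs_mul, abs_of_pos hh]
    have e5 : h * u' x = u (x + h) - u x - (u (x + h) - u x - h * u' x) := by ring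
    rw [e4, e5]
    have e6 := abs_sub (u (x + h) - u x) (u (x + h) - u x - h * u' x)
    have e7 := abs_sub (u (x + h)) (u x)
    linarith
  have i0 := intervalIntegrable_of_subset hu.1 le_rfl hac (by linarith : c ≤ b)
  have i1 : IntervalIntegrable (fun x => u (x + h)) volume a c := by
    have := (intervalIntegrable_of_subset hui (p := a + h) (q := c + h) (by linarith)
      (by linarith) hcb).comp_add_right h
    simpa using this
  have i2 := intervalIntegrable_of_subset hui le_rfl hac (by linarith : c ≤ b)
  have i3 : IntervalIntegrable (fun x => ∫ t in x..(x + h), |v t|) volume a c := by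
    have hprim : IsPrimitiveOn a b (fun x => ∫ t in a..x, |v t|) (fun t => |v t|) :=
      ⟨hu'.1.abs, fun x _ => by simp⟩
    have hVi := hprim.intervalIntegrable hab
    have j1 := (intervalIntegrable_of_subset hVi (p := a + h) (q := c + h) (by linarith)
      (by linarith) hcb).comp_add_right h
    simp only [add_sub_cancel_right] at j1
    refine (j1.sub (intervalIntegrable_of_subset hVi le_rfl hac (by linarith : c ≤ b))).congr
      fun x hx => ?_
    rw [uIoc_of_le hac] at hx
    exact hprim.sub_eq ⟨hx.1.le, by linarith [hx.2]⟩ ⟨by linarith [hx.1], by linarith [hx.2]⟩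
  have key := intervalIntegral.integral_mono_on hac (i0.abs.const_mul h)
    ((i1.abs.add i2.abs).add (i3.const_mul h)) hpt
  rw [intervalIntegral.integral_add (i1.abs.add i2.abs) (i3.const_mul h),
    intervalIntegral.integral_add i1.abs i2.abs, intervalIntegral.integral_const_mul,
    intervalIntegral.integral_const_mul,
    intervalIntegral.integral_comp_add_right (fun x => |u x|)] at key
  have k1 := integral_abs_le_of_subset hui (p := a + h) (q := c + h) (by linarith)
      (by linarith) hcb
  have k2 := integral_abs_le_of_subset hui le_rfl hac (by linarith : c ≤ b)
  have k3 := integral_integral_abs_le hu'.1 hh.le hac hcb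
  have k4 := mul_le_mul_of_nonneg_left k3 hh.le
  have k5 : h * (2 / h * (∫ x in a..b, |u x|)) = 2 * ∫ x in a..b, |u x| := by field_simp
  refine le_of_mul_le_mul_left ?_ hh
  rw [mul_add, k5]
  linarith

/-- Bound for `u'` in `L¹` by `u` and `v = u''` at the scale `h`. The left half of the interval uses
forward differences, the right half is its mirror image. -/
lemma IsPrimitiveOn.integral_abs_le {a b h : ℝ} {u u' v : ℝ → ℝ}
    (hu : IsPrimitiveOn a b u u') (hu' : IsPrimitiveOn a b u' v) (hh : 0 < h)
    (hhab : h ≤ (b - a) / 2) :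
    ∫ x in a..b, |u' x| ≤ 4 / h * (∫ x in a..b, |u x|) + 2 * h * ∫ x in a..b, |v x| := by
  have h1 := hu.integral_abs_left_le hu' hh (c := (a + b) / 2) (by linarith) (by linarith)
  have hu2 := hu'.reflect
  have hu1 : IsPrimitiveOn a b (fun x => -u (a + b - x)) (fun x => u' (a + b - x)) := by
    have := hu.reflect
    refine ⟨this.1.neg.congr fun x _ => by simp, fun x hx => ?_⟩
    have h2 := this.2 x hx
    simp only [intervalIntegral.integral_neg] at h2
    simp only
    linarith
  have h2 := hu1.integral_abs_left_le hu2 hh (c := (a + b) / 2) (by linarith) (by linarith)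
  have hr : ∀ (w : ℝ → ℝ) (c : ℝ), ∫ x in a..c, |w (a + b - x)| = ∫ x in (a + b - c)..b, |w x| := by
    intro w c
    rw [intervalIntegral.integral_comp_sub_left (fun x => |w x|)]
    simp
  simp only [abs_neg] at h2
  rw [hr u', hr u, hr v, add_sub_cancel_right] at h2
  rw [show a + b - (a + b) / 2 = (a + b) / 2 by ring] at h2
  have h3 := intervalIntegral.integral_add_adjacent_intervals
    (intervalIntegrable_of_subset hu.1.abs (p := a) (q := (a + b) / 2) le_rfl (by linarith)
      (by linarith))
    (intervalIntegrable_of_subset hu.1.abs (p := (a + b) / 2) (q := b) (by linarith) (by linarith)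
      le_rfl)
  rw [← h3]
  have e4 : 4 / h * (∫ x in a..b, |u x|) = 2 * (2 / h * (∫ x in a..b, |u x|)) := by ring
  rw [e4]
  linarith

/-- A first derivative is controlled in `L¹` by the function and by a higher derivative, with
the optimal powers of the scale `h`; the induction on the order absorbs the intermediate
derivative by a choice of two different scales. -/
lemma exists_integral_abs_deriv_le (k : ℕ) :
    ∃ C : ℝ, 1 ≤ C ∧ ∀ (a b h : ℝ) (w : ℕ → ℝ → ℝ), 0 < h → h ≤ (b - a) / 2 →
      (∀ j ≤ k, IsPrimitiveOn a b (w j) (w (j + 1))) →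
      ∫ x in a..b, |w 1 x| ≤
        C * (h⁻¹ * (∫ x in a..b, |w 0 x|) + h ^ k * ∫ x in a..b, |w (k + 1) x|) := by
  induction k with
  | zero =>
    refine ⟨1, le_rfl, fun a b h w hh hhab _ => ?_⟩
    have : 0 ≤ ∫ x in a..b, |w 0 x| :=
      intervalIntegral.integral_nonneg (by linarith) fun _ _ => abs_nonneg _
    have : 0 ≤ h⁻¹ * ∫ x in a..b, |w 0 x| := by positivity
    simp only [pow_zero, one_mul, zero_add]
    linarith
  | succ k ih =>
    obtain ⟨C, hC1, hC⟩ := ih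
    refine ⟨32 * C, by linarith, fun a b η w hη hηab hw => ?_⟩
    have h1 := hC a b η (fun j => w (j + 1)) hη hηab fun j hj => hw (j + 1) (by omega)
    simp only [zero_add] at h1
    have hC0 : 0 < C := by linarith
    -- at the scale `η / (4 C)` half of the first derivative is absorbed in the left side
    have hle : η / (4 * C) ≤ η := div_le_self hη.le (by linarith)
    have h2 := (hw 0 (by omega)).integral_abs_le (hw 1 (by omega)) (h := η / (4 * C))
      (by positivity) (by linarith)
    set I0 := ∫ x in a..b, |w 0 x|
    set I1 := ∫ x in a..b, |w (0 + 1) x|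
    set I2 := ∫ x in a..b, |w (1 + 1) x|
    set I3 := ∫ x in a..b, |w (k + 1 + 1) x|
    have hI3 : 0 ≤ I3 := intervalIntegral.integral_nonneg (by linarith) fun _ _ => abs_nonneg _
    have h3 : 2 * (η / (4 * C)) * I2 ≤ I1 / 2 + η ^ (k + 1) * I3 / 2 := by
      calc 2 * (η / (4 * C)) * I2 ≤ 2 * (η / (4 * C)) * (C * (η⁻¹ * I1 + η ^ k * I3)) := by gcongr
        _ = I1 / 2 + η ^ (k + 1) * I3 / 2 := by field_simp; ring
    have h4 : 4 / (η / (4 * C)) * I0 = 16 * C * (η⁻¹ * I0) := by field_simp; ring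
    have h5 : η ^ (k + 1) * I3 ≤ 32 * C * (η ^ (k + 1) * I3) :=
      le_mul_of_one_le_left (by positivity) (by linarith)
    rw [mul_add]
    change I1 ≤ _
    linarith

/-! ### Transport of densities by increasing diffeomorphisms -/

/-- `φ` is a `C¹` diffeomorphism from `[a,b]` onto `[c,d]` with derivative `φ' ≥ κ > 0` and
inverse `ψ`. -/
structure IsIncreasingDiffeo (κ a b c d : ℝ) (φ φ' ψ : ℝ → ℝ) : Prop where
  lt : a < b
  pos : 0 < κ
  deriv : ∀ x ∈ Icc a b, HasDerivWithinAt φ (φ' x) (Icc a b) x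
  cont : ContinuousOn φ' (Icc a b)
  lower : ∀ x ∈ Icc a b, κ ≤ φ' x
  map_left : φ a = c
  map_right : φ b = d
  mapsTo_inv : MapsTo ψ (Icc c d) (Icc a b)
  right_inv : ∀ y ∈ Icc c d, φ (ψ y) = y

/-- The density at `y = φ x` of the image under `φ` of the measure with density `r`. Here `φ'` is
the derivative and `ψ` the inverse of `φ`; the values are meaningful only on the image of `φ`. -/
noncomputable def pushDensity (φ' ψ r : ℝ → ℝ) : ℝ → ℝ := fun y => r (ψ y) * (φ' (ψ y))⁻¹

lemma mul_sub_le_of_le_hasDerivWithinAt {κ a b : ℝ} {φ φ' : ℝ → ℝ}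
    (hd : ∀ x ∈ Icc a b, HasDerivWithinAt φ (φ' x) (Icc a b) x)
    (hl : ∀ x ∈ Icc a b, κ ≤ φ' x) {x y : ℝ} (hx : x ∈ Icc a b) (hy : y ∈ Icc a b)
    (hxy : x ≤ y) : κ * (y - x) ≤ φ y - φ x := by
  have hda : ∀ z ∈ interior (Icc a b), HasDerivAt φ (φ' z) z := fun z hz =>
    (hd z (interior_subset hz)).hasDerivAt (mem_interior_iff_mem_nhds.1 hz)
  refine (convex_Icc a b).mul_sub_le_image_sub_of_le_deriv
    (fun z hz => (hd z hz).continuousWithinAt)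
    (fun z hz => (hda z hz).differentiableAt.differentiableWithinAt) (fun z hz => ?_) x hx y hy hxy
  rw [(hda z hz).deriv]
  exact hl z (interior_subset hz)

namespace IsIncreasingDiffeo

variable {κ a b c d : ℝ} {φ φ' ψ r : ℝ → ℝ}

/-- A map with derivative bounded below by `κ > 0` is an increasing diffeomorphism between the
intervals. -/
lemma mk' (hab : a < b) (hκ : 0 < κ)
    (hd : ∀ x ∈ Icc a b, HasDerivWithinAt φ (φ' x) (Icc a b) x) (hc : ContinuousOn φ' (Icc a b))
    (hl : ∀ x ∈ Icc a b, κ ≤ φ' x) (ha : φ a = c) (hb : φ b = d) :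
    ∃ ψ, IsIncreasingDiffeo κ a b c d φ φ' ψ := by
  have hs : SurjOn φ (Icc a b) (Icc c d) := by
    rw [← ha, ← hb]
    exact ContinuousOn.surjOn_Icc (fun z hz => (hd z hz).continuousWithinAt)
      (left_mem_Icc.2 hab.le) (right_mem_Icc.2 hab.le)
  exact ⟨Function.invFunOn φ (Icc a b), hab, hκ, hd, hc, hl, ha, hb,
    fun y hy => Function.invFunOn_mem (hs hy), fun y hy => Function.invFunOn_eq (hs hy)⟩

variable (h : IsIncreasingDiffeo κ a b c d φ φ' ψ)
include h

lemma continuousOn : ContinuousOn φ (Icc a b) := fun z hz => (h.deriv z hz).continuousWithinAt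

lemma mul_sub_le {x y : ℝ} (hx : x ∈ Icc a b) (hy : y ∈ Icc a b) (hxy : x ≤ y) :
    κ * (y - x) ≤ φ y - φ x :=
  mul_sub_le_of_le_hasDerivWithinAt h.deriv h.lower hx hy hxy

lemma strictMonoOn : StrictMonoOn φ (Icc a b) := fun x hx y hy hxy => by
  have := h.mul_sub_le hx hy hxy.le
  have := mul_pos h.pos (sub_pos.2 hxy)
  linarith

lemma mapsTo : MapsTo φ (Icc a b) (Icc c d) := fun x hx => by
  rw [← h.map_left, ← h.map_right]
  exact ⟨h.strictMonoOn.monotoneOn (left_mem_Icc.2 h.lt.le) hx hx.1,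
    h.strictMonoOn.monotoneOn hx (right_mem_Icc.2 h.lt.le) hx.2⟩

lemma left_inv {x : ℝ} (hx : x ∈ Icc a b) : ψ (φ x) = x :=
  h.strictMonoOn.injOn (h.mapsTo_inv (h.mapsTo hx)) hx (h.right_inv _ (h.mapsTo hx))

lemma image_eq : φ '' Icc a b = Icc c d :=
  h.mapsTo.image_subset.antisymm fun y hy => ⟨ψ y, h.mapsTo_inv hy, h.right_inv y hy⟩

lemma lt' : c < d := by
  rw [← h.map_left, ← h.map_right]
  exact h.strictMonoOn (left_mem_Icc.2 h.lt.le) (right_mem_Icc.2 h.lt.le) h.lt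

lemma length_le : κ * (b - a) ≤ d - c := by
  rw [← h.map_left, ← h.map_right]
  exact h.mul_sub_le (left_mem_Icc.2 h.lt.le) (right_mem_Icc.2 h.lt.le) h.lt.le

lemma inv_left : ψ c = a := by
  rw [← h.map_left, h.left_inv (left_mem_Icc.2 h.lt.le)]

lemma inv_right : ψ d = b := by
  rw [← h.map_right, h.left_inv (right_mem_Icc.2 h.lt.le)]

lemma abs_inv_sub_le {y z : ℝ} (hy : y ∈ Icc c d) (hz : z ∈ Icc c d) :
    |ψ y - ψ z| ≤ κ⁻¹ * |y - z| := by
  have key : ∀ {x x' : ℝ}, x ∈ Icc a b → x' ∈ Icc a b → x ≤ x' →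
      |x - x'| ≤ κ⁻¹ * |φ x - φ x'| := by
    intro x x' hx hx' hxx
    have h1 := h.mul_sub_le hx hx' hxx
    rw [abs_sub_comm, abs_of_nonneg (sub_nonneg.2 hxx), abs_sub_comm (φ x),
      abs_of_nonneg ((mul_nonneg h.pos.le (sub_nonneg.2 hxx)).trans h1), inv_mul_eq_div,
      le_div_iff₀ h.pos, mul_comm]
    exact h1
  have hy' := h.mapsTo_inv hy
  have hz' := h.mapsTo_inv hz
  rcases le_total (ψ y) (ψ z) with hle | hle
  · have := key hy' hz' hle
    rwa [h.right_inv y hy, h.right_inv z hz] at this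
  · have := key hz' hy' hle
    rwa [h.right_inv y hy, h.right_inv z hz, abs_sub_comm, abs_sub_comm z] at this

lemma continuousOn_inv : ContinuousOn ψ (Icc c d) :=
  (LipschitzOnWith.of_dist_le_mul (K := ⟨κ⁻¹, inv_nonneg.2 h.pos.le⟩) fun _ hy _ hz =>
    h.abs_inv_sub_le hy hz).continuousOn

lemma deriv_inv {y : ℝ} (hy : y ∈ Icc c d) :
    HasDerivWithinAt ψ (φ' (ψ y))⁻¹ (Icc c d) y := by
  have hx := h.mapsTo_inv hy
  have hne : φ' (ψ y) ≠ 0 := (h.pos.trans_le (h.lower _ hx)).ne'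
  have h1 : HasFDerivWithinAt φ
      ((ContinuousLinearEquiv.unitsEquivAut ℝ (Units.mk0 (φ' (ψ y)) hne) : ℝ ≃L[ℝ] ℝ) : ℝ →L[ℝ] ℝ)
      (Icc a b) (ψ y) := (h.deriv _ hx).hasFDerivWithinAt.congr_fderiv (by ext; simp)
  have ht : Filter.Tendsto ψ (nhdsWithin y (Icc c d)) (nhdsWithin (ψ y) (Icc a b)) :=
    (h.continuousOn_inv y hy).tendsto_nhdsWithin h.mapsTo_inv
  have h2 := h1.of_local_left_inverse ht hy
    (Filter.eventually_of_mem self_mem_nhdsWithin fun z hz => h.right_inv z hz)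
  have h3 := h2.hasDerivWithinAt
  refine h3.congr_deriv ?_
  simp

lemma continuousOn_pushDensity (hr : ContinuousOn r (Icc a b)) :
    ContinuousOn (pushDensity φ' ψ r) (Icc c d) :=
  (hr.comp h.continuousOn_inv h.mapsTo_inv).mul
    ((h.cont.comp h.continuousOn_inv h.mapsTo_inv).inv₀ fun _ hy =>
      (h.pos.trans_le (h.lower _ (h.mapsTo_inv hy))).ne')

lemma pushDensity_nonneg (hr : ∀ x ∈ Icc a b, 0 ≤ r x) {y : ℝ} (hy : y ∈ Icc c d) :
    0 ≤ pushDensity φ' ψ r y :=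
  mul_nonneg (hr _ (h.mapsTo_inv hy))
    (inv_nonneg.2 (h.pos.le.trans (h.lower _ (h.mapsTo_inv hy))))

lemma pushDensity_mul {x : ℝ} (hx : x ∈ Icc a b) :
    pushDensity φ' ψ r (φ x) * φ' x = r x := by
  have hne : φ' x ≠ 0 := (h.pos.trans_le (h.lower _ hx)).ne'
  rw [pushDensity, h.left_inv hx]
  field_simp

/-- Change of variables for the transported density. -/
lemma integral_mul_pushDensity (S : ℝ → ℝ) :
    ∫ y in c..d, S y * pushDensity φ' ψ r y = ∫ x in a..b, S (φ x) * r x := by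
  have h1 := intervalIntegral.integral_comp_mul_deriv_of_deriv_nonneg (a := a) (b := b)
    (f := φ) (f' := φ') (g := fun y => S y * pushDensity φ' ψ r y)
    (by rw [uIcc_of_le h.lt.le]; exact h.continuousOn)
    (by
      rw [min_eq_left h.lt.le, max_eq_right h.lt.le]
      exact fun x hx => (h.deriv x (Ioo_subset_Icc_self hx)).hasDerivAt (Icc_mem_nhds hx.1 hx.2))
    (by
      rw [min_eq_left h.lt.le, max_eq_right h.lt.le]
      exact fun x hx => h.pos.le.trans (h.lower x (Ioo_subset_Icc_self hx)))
  rw [h.map_left, h.map_right] at h1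
  rw [← h1]
  refine intervalIntegral.integral_congr fun x hx => ?_
  rw [uIcc_of_le h.lt.le] at hx
  simp only [Function.comp]
  rw [mul_assoc, h.pushDensity_mul hx]

/-- The image under `φ` of a measure with density `r` has density `pushDensity φ' ψ r`. -/
lemma map_withDensity (r : ℝ → ℝ) :
    ((volume.restrict (Icc a b)).withDensity fun x => ENNReal.ofReal (r x)).map φ =
      (volume.restrict (Icc c d)).withDensity fun y => ENNReal.ofReal (pushDensity φ' ψ r y) := by
  have hm : AEMeasurable φ ((volume.restrict (Icc a b)).withDensity fun x => ENNReal.ofReal (r x)) :=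
    (h.continuousOn.aemeasurable measurableSet_Icc).mono_ac (withDensity_absolutelyContinuous _ _)
  ext s hs
  set φc : ℝ → ℝ := IccExtend h.lt.le (domRestrict (Icc a b) φ) with hφc
  have hφc_cont : Continuous φc := (continuousOn_iff_continuous_domRestrict.1 h.continuousOn).Icc_extend'
  have hφe : ∀ x ∈ Icc a b, φc x = φ x := fun x hx => by rw [hφc, IccExtend_of_mem _ _ hx]; rfl
  set P : Set ℝ := φc ⁻¹' s ∩ Icc a b with hP
  have hPm : MeasurableSet P := (hφc_cont.measurable hs).inter measurableSet_Icc
  have hPφ : φ ⁻¹' s ∩ Icc a b = P := by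
    ext x
    simp only [hP, mem_inter_iff, mem_preimage]
    exact ⟨fun hx => ⟨by rw [hφe x hx.2]; exact hx.1, hx.2⟩,
      fun hx => ⟨by rw [← hφe x hx.2]; exact hx.1, hx.2⟩⟩
  have himg : φ '' P = s ∩ Icc c d := by
    rw [← hPφ]
    ext y
    constructor
    · rintro ⟨x, hx, rfl⟩
      exact ⟨hx.1, h.mapsTo hx.2⟩
    · rintro ⟨hy1, hy2⟩
      exact ⟨ψ y, ⟨by rw [mem_preimage, h.right_inv y hy2]; exact hy1, h.mapsTo_inv hy2⟩,
        h.right_inv y hy2⟩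
  have hPsub : P ⊆ Icc a b := inter_subset_right
  rw [Measure.map_apply_of_aemeasurable hm hs, withDensity_apply _ hs,
    withDensity_apply' _, Measure.restrict_restrict hs]
  have e1 : (volume.restrict (Icc a b)).restrict (φ ⁻¹' s) = volume.restrict P := by
    rw [Measure.restrict_restrict' measurableSet_Icc, hPφ]
  rw [e1, ← himg, lintegral_image_eq_lintegral_abs_deriv_mul hPm
    (fun x hx => (h.deriv x (hPsub hx)).mono hPsub) (h.strictMonoOn.injOn.mono hPsub)]
  refine setLIntegral_congr_fun hPm fun x hx => ?_
  have hx' := hPsub hx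
  have hp : 0 < φ' x := h.pos.trans_le (h.lower x hx')
  rw [← ENNReal.ofReal_mul (abs_nonneg _), abs_of_pos hp, mul_comm, h.pushDensity_mul hx']

end IsIncreasingDiffeo

/-- The density function of a measure given by a continuous nonnegative density on a compact
interval. -/
lemma pdfOf_withDensity_ae_eq {c d : ℝ} {ρ : ℝ → ℝ} (hρ : ContinuousOn ρ (Icc c d))
    (h0 : ∀ y ∈ Icc c d, 0 ≤ ρ y) :
    pdfOf ((volume.restrict (Icc c d)).withDensity fun y => ENNReal.ofReal (ρ y))
      =ᵐ[volume] (Icc c d).indicator ρ := by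
  have hm : AEMeasurable ((Icc c d).indicator fun y => ENNReal.ofReal (ρ y)) volume :=
    (aemeasurable_indicator_iff measurableSet_Icc).2
      (hρ.aemeasurable measurableSet_Icc).ennreal_ofReal
  rw [← withDensity_indicator measurableSet_Icc]
  filter_upwards [Measure.rnDeriv_withDensity₀ volume hm] with y hy
  rw [pdfOf, hy]
  by_cases hyc : y ∈ Icc c d
  · rw [indicator_of_mem hyc, indicator_of_mem hyc, ENNReal.toReal_ofReal (h0 y hyc)]
  · rw [indicator_of_notMem hyc, indicator_of_notMem hyc, ENNReal.toReal_zero]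

/-- `W^{m,1}` bounds are preserved by transport of densities. -/
lemma exists_sobolevBound_pushDensity (m : ℕ) (κ B : ℝ) (hκ : 0 < κ) :
    ∃ C : ℝ, 0 ≤ C ∧ ∀ (a b c d : ℝ) (φ φ' ψ r : ℝ → ℝ) (N : ℝ),
      IsIncreasingDiffeo κ a b c d φ φ' ψ → SmoothBound a b m φ' B → SobolevBound a b m r N →
      SobolevBound c d m (pushDensity φ' ψ r) (C * N) := by
  obtain ⟨C1, hC1⟩ := exists_smoothBound_inverse m κ B hκ
  have hB' : 0 < (max B 1)⁻¹ := by positivity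
  obtain ⟨C2, hC20, hC2⟩ := exists_sobolevBound_comp m (max B 1)⁻¹ C1 hB'
  refine ⟨2 ^ m * (C2 * max C1 0), by positivity, fun a b c d φ φ' ψ r N h hs hr => ?_⟩
  have hcd := h.lt'
  have h1 := hC1 a b c d φ' ψ h.lt.le hcd.le hs h.lower h.mapsTo_inv fun y hy => h.deriv_inv hy
  have h2 := hC2 c d a b r ψ _ N hcd.le hr h.mapsTo_inv h.inv_left h.inv_right
    (fun y hy => h.deriv_inv hy) (fun y hy => by
      have hx := h.mapsTo_inv hy
      have hp : 0 < φ' (ψ y) := h.pos.trans_le (h.lower _ hx)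
      exact inv_anti₀ hp (((le_abs_self _).trans (hs.bound _ hx)).trans (le_max_left _ _))) h1
  have h3 := h2.mul hcd.le (h1.mono (le_max_left C1 0))
  refine h3.mono (le_of_eq ?_)
  ring

/-- The density on the source is bounded in `W^{m,1}` by the transported density. -/
lemma exists_sobolevBound_of_pushDensity (m : ℕ) (κ B : ℝ) (hκ : 0 < κ) :
    ∃ C : ℝ, 0 ≤ C ∧ ∀ (a b c d : ℝ) (φ φ' ψ r : ℝ → ℝ) (N : ℝ),
      IsIncreasingDiffeo κ a b c d φ φ' ψ → SmoothBound a b m φ' B →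
      SobolevBound c d m (pushDensity φ' ψ r) N → SobolevBound a b m r (C * N) := by
  obtain ⟨C2, hC20, hC2⟩ := exists_sobolevBound_comp m κ B hκ
  refine ⟨2 ^ m * (C2 * max B 0), by positivity, fun a b c d φ φ' ψ r N h hs hr => ?_⟩
  have h2 := hC2 a b c d _ φ φ' N h.lt.le hr h.mapsTo h.map_left h.map_right h.deriv h.lower hs
  have h3 := (h2.mul h.lt.le (hs.mono (le_max_left B 0))).congr h.lt.le
    (u' := r) fun x hx => (h.pushDensity_mul hx).symm
  refine h3.mono (le_of_eq ?_)
  ring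

/-! ### Comparison of the densities of two nearby diffeomorphisms -/

lemma SobolevBound.neg {a b : ℝ} {k : ℕ} {u : ℝ → ℝ} {N : ℝ} (h : SobolevBound a b k u N) :
    SobolevBound a b k (fun x => -u x) N := by
  induction k generalizing u with
  | zero => exact ⟨h.1.neg, by simpa only [abs_neg] using h.2⟩
  | succ k ih =>
    obtain ⟨h1, v, hv, h2⟩ := h
    refine ⟨by simpa only [abs_neg] using h1, fun x => -v x, ⟨hv.1.neg, fun x hx => ?_⟩, ih h2⟩
    have := hv.2 x hx
    rw [intervalIntegral.integral_neg]
    simp only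
    linarith

/-- Duality: an antiderivative `H` of `D` vanishing at both ends has `L¹` norm at most `δ` if `D`
is bounded by `δ` as a functional on `1`-Lipschitz functions. The test function is an
antiderivative of the sign of `H`. -/
lemma IsPrimitiveOn.integral_abs_le_of_lipschitz {c d δ : ℝ} (hcd : c ≤ d) {H D : ℝ → ℝ}
    (hH : IsPrimitiveOn c d H D) (hc : H c = 0) (hd : H d = 0)
    (hS : ∀ S : ℝ → ℝ, (∀ y ∈ Icc c d, ∀ z ∈ Icc c d, |S y - S z| ≤ |y - z|) →
      |∫ y in c..d, S y * D y| ≤ δ) :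
    ∫ y in c..d, |H y| ≤ δ := by
  have hHc := hH.continuousOn hcd
  set s : ℝ → ℝ := fun y => H y / |H y| with hs
  have hs1 : ∀ y, |s y| ≤ 1 := fun y => by
    rw [hs]; simp only
    rw [abs_div, abs_abs]
    exact div_self_le_one _
  have hsi : IntervalIntegrable s volume c d := by
    refine (intervalIntegrable_const (c := (1 : ℝ))).mono_fun (g := s) ?_
      (Filter.Eventually.of_forall fun y => by
        simpa [Real.norm_eq_abs] using hs1 y)
    rw [uIoc_of_le hcd]
    have h1 := (hHc.mono Ioc_subset_Icc_self).aemeasurable (μ := volume) measurableSet_Ioc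
    exact (h1.div h1.norm).aestronglyMeasurable
  set S : ℝ → ℝ := fun y => ∫ t in c..y, s t with hSdef
  have hSp : IsPrimitiveOn c d S s := ⟨hsi, fun y _ => by simp [hSdef]⟩
  have hSl : ∀ y ∈ Icc c d, ∀ z ∈ Icc c d, |S y - S z| ≤ |y - z| := fun y hy z hz => by
    rw [hSp.sub_eq hz hy]
    have := intervalIntegral.norm_integral_le_of_norm_le_const (f := s) (a := z) (b := y) (C := 1)
      fun t _ => hs1 t
    rwa [one_mul] at this
  have hmul := hH.mul hcd hSp
  have h1 := hmul.2 d (right_mem_Icc.2 hcd)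
  simp only [hc, hd, zero_mul, zero_add] at h1
  have i1 : IntervalIntegrable (fun y => D y * S y) volume c d :=
    hH.1.mul_continuousOn (by rw [uIcc_of_le hcd]; exact hSp.continuousOn hcd)
  have i2 : IntervalIntegrable (fun y => H y * s y) volume c d :=
    hsi.continuousOn_mul (by rwa [uIcc_of_le hcd])
  rw [intervalIntegral.integral_add i1 i2] at h1
  have h2 : ∫ y in c..d, H y * s y = ∫ y in c..d, |H y| := by
    refine intervalIntegral.integral_congr fun y _ => ?_
    simp only [hs]
    rcases eq_or_ne (H y) 0 with h0 | h0
    · simp [h0]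
    · have : |H y| ≠ 0 := abs_ne_zero.2 h0
      rw [← mul_div_assoc, div_eq_iff this, abs_mul_abs_self]
  have h3 : ∫ y in c..d, D y * S y = ∫ y in c..d, S y * D y :=
    intervalIntegral.integral_congr fun y _ => mul_comm _ _
  have h4 := hS S hSl
  have h5 := neg_abs_le (∫ y in c..d, S y * D y)
  rw [h2, h3] at h1
  linarith

/-- Two transported densities are close in `L¹` when the maps are uniformly close: their
difference has a small antiderivative and bounded derivatives. -/
lemma exists_integral_abs_pushDensity_sub_le (m : ℕ) (κ B : ℝ) (hκ : 0 < κ) :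
    ∃ C : ℝ, 0 ≤ C ∧ ∀ (a b c d : ℝ) (f f' ψ g g' χ r : ℝ → ℝ) (K δ h : ℝ),
      IsIncreasingDiffeo κ a b c d f f' ψ → IsIncreasingDiffeo κ a b c d g g' χ →
      SmoothBound a b m f' B → SmoothBound a b m g' B → ContinuousOn r (Icc a b) →
      (∀ x ∈ Icc a b, 0 ≤ r x) → ∫ x in a..b, r x = 1 →
      SobolevBound c d m (pushDensity f' ψ r) K → (∀ x ∈ Icc a b, |f x - g x| ≤ δ) →
      0 < h → h ≤ (d - c) / 2 →
      ∫ y in c..d, |pushDensity f' ψ r y - pushDensity g' χ r y| ≤ C * (h⁻¹ * δ + h ^ m * K) := by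
  obtain ⟨C1, hC10, hC1⟩ := exists_sobolevBound_of_pushDensity m κ B hκ
  obtain ⟨C2, hC20, hC2⟩ := exists_sobolevBound_pushDensity m κ B hκ
  obtain ⟨C3, hC31, hC3⟩ := exists_integral_abs_deriv_le m
  have hC30 : 0 ≤ C3 := zero_le_one.trans hC31
  refine ⟨C3 * (1 + C2 * C1), by positivity, ?_⟩
  intro a b c d f f' ψ g g' χ r K δ h hf hg hf' hg' hrc hr0 hr1 hK hδ hh hhcd
  have hab := hf.lt.le
  have hcd := hf.lt'.le
  have hδ0 : 0 ≤ δ := (abs_nonneg _).trans (hδ a (left_mem_Icc.2 hab))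
  have hK0 := hK.nonneg hcd
  set p := pushDensity f' ψ r with hp
  set q := pushDensity g' χ r with hq
  have hqK : SobolevBound c d m q (C2 * (C1 * K)) :=
    hC2 a b c d g g' χ r _ hg hg' (hC1 a b c d f f' ψ r K hf hf' hK)
  have hD : SobolevBound c d m (fun y => p y + -q y) (K + C2 * (C1 * K)) := hK.add hcd hqK.neg
  have hpi := hK.intervalIntegrable hcd
  have hqi := hqK.intervalIntegrable hcd
  have hDi := hpi.add hqi.neg
  set H : ℝ → ℝ := fun y => ∫ t in c..y, (p t + -q t) with hH
  have hHp : IsPrimitiveOn c d H (fun y => p y + -q y) := ⟨hDi, fun y _ => by simp [hH]⟩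
  have hri : IntervalIntegrable r volume a b := by
    rw [← uIcc_of_le hab] at hrc
    exact hrc.intervalIntegrable
  -- change of variables in both densities
  have hint : ∀ S : ℝ → ℝ, ContinuousOn S (Icc c d) →
      ∫ y in c..d, S y * (p y + -q y) = ∫ x in a..b, (S (f x) - S (g x)) * r x := by
    intro S hSc
    have hSc' : ContinuousOn S (uIcc c d) := by rwa [uIcc_of_le hcd]
    have e1 : ∀ x, (S (f x) - S (g x)) * r x = S (f x) * r x - S (g x) * r x := fun x => by ring
    have e2 : ∀ y, S y * (p y + -q y) = S y * p y - S y * q y := fun y => by ring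
    simp only [e1, e2]
    rw [intervalIntegral.integral_sub (hpi.continuousOn_mul hSc') (hqi.continuousOn_mul hSc'),
      intervalIntegral.integral_sub
        (hri.continuousOn_mul (by
          rw [uIcc_of_le hab]; exact hSc.comp hf.continuousOn hf.mapsTo))
        (hri.continuousOn_mul (by
          rw [uIcc_of_le hab]; exact hSc.comp hg.continuousOn hg.mapsTo)),
      hp, hq, hf.integral_mul_pushDensity, hg.integral_mul_pushDensity]
  have hHd : H d = 0 := by
    have := hint (fun _ => 1) continuousOn_const
    simpa using this
  have hHδ : ∫ y in c..d, |H y| ≤ δ := by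
    refine hHp.integral_abs_le_of_lipschitz hcd (by simp [hH]) hHd fun S hS => ?_
    have hSc : ContinuousOn S (Icc c d) :=
      (LipschitzOnWith.of_dist_le_mul (K := 1) fun y hy z hz => by
        rw [NNReal.coe_one, one_mul]; exact hS y hy z hz).continuousOn
    rw [hint S hSc]
    have i1 : IntervalIntegrable (fun x => (S (f x) - S (g x)) * r x) volume a b :=
      hri.continuousOn_mul (by
        rw [uIcc_of_le hab]
        exact (hSc.comp hf.continuousOn hf.mapsTo).sub (hSc.comp hg.continuousOn hg.mapsTo))
    calc |∫ x in a..b, (S (f x) - S (g x)) * r x|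
        ≤ ∫ x in a..b, |(S (f x) - S (g x)) * r x| :=
          intervalIntegral.abs_integral_le_integral_abs hab
      _ ≤ ∫ x in a..b, δ * r x := by
          refine intervalIntegral.integral_mono_on hab i1.abs (hri.const_mul δ) fun x hx => ?_
          rw [abs_mul, abs_of_nonneg (hr0 x hx)]
          exact mul_le_mul_of_nonneg_right
            ((hS _ (hf.mapsTo hx) _ (hg.mapsTo hx)).trans (hδ x hx)) (hr0 x hx)
      _ = δ := by rw [intervalIntegral.integral_const_mul, hr1, mul_one]
  obtain ⟨w, hw0, hw1, hw2⟩ := hD.exists_chain hcd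
  -- the chain `H, D, D', …` of successive derivatives
  have key := hC3 c d h (fun j => Nat.casesOn j H w) hh hhcd (by
    rintro (_ | j) hj
    · simpa [hw0] using hHp
    · exact hw1 j (by omega))
  change ∫ x in c..d, |w 0 x| ≤
    C3 * (h⁻¹ * (∫ x in c..d, |H x|) + h ^ m * ∫ x in c..d, |w m x|) at key
  rw [hw0] at key
  have e3 : ∫ y in c..d, |p y - q y| = ∫ y in c..d, |p y + -q y| := by simp only [sub_eq_add_neg]
  rw [e3]
  refine key.trans ?_
  have h6 := (hw2 m le_rfl).2
  calc C3 * (h⁻¹ * (∫ y in c..d, |H y|) + h ^ m * ∫ y in c..d, |w m y|)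
      ≤ C3 * (h⁻¹ * δ + h ^ m * (K + C2 * (C1 * K))) := by gcongr
    _ ≤ C3 * ((1 + C2 * C1) * (h⁻¹ * δ) + (1 + C2 * C1) * (h ^ m * K)) := by
        refine mul_le_mul_of_nonneg_left (add_le_add ?_ (le_of_eq (by ring))) hC30
        have : 0 ≤ C2 * C1 := by positivity
        exact le_mul_of_one_le_left (by positivity) (by linarith)
    _ = C3 * (1 + C2 * C1) * (h⁻¹ * δ + h ^ m * K) := by ring

/-! ### Absolute continuity of images -/

/-- The preimage of a null set is null near a point where the derivative does not vanish, so a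
nonconstant polynomial pulls null sets back to null sets. -/
lemma volume_preimage_eval_eq_zero {p : Polynomial ℝ} (hp : Polynomial.derivative p ≠ 0)
    {s : Set ℝ} (hsm : MeasurableSet s) (hs : volume s = 0) :
    volume ((fun x => p.eval x) ⁻¹' s) = 0 := by
  set Z : Set ℝ := {x | (Polynomial.derivative p).eval x = 0} with hZ
  have hZfin : Z.Finite := by
    refine ((Polynomial.derivative p).roots.toFinset.finite_toSet).subset fun x hx => ?_
    exact by simpa [hp] using (show (Polynomial.derivative p).eval x = 0 from hx)
  have hcover : (fun x => p.eval x) ⁻¹' s ⊆ ((fun x => p.eval x) ⁻¹' s ∩ Zᶜ) ∪ Z := fun x hx => by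
    by_cases hz : x ∈ Z
    · exact Or.inr hz
    · exact Or.inl ⟨hx, hz⟩
  refine measure_mono_null hcover (measure_union_null ?_ (hZfin.measure_zero _))
  refine measure_null_of_locally_null _ fun x hx => ?_
  have hne : (Polynomial.derivative p).eval x ≠ 0 := hx.2
  have hd : HasStrictDerivAt (fun x => p.eval x) ((Polynomial.derivative p).eval x) x :=
    p.hasStrictDerivAt x
  obtain ⟨U, hUinv, hUo, hxU⟩ := eventually_nhds_iff.1 (hd.eventually_left_inverse hne)
  set A : Set ℝ := (fun x => p.eval x) ⁻¹' s ∩ Zᶜ ∩ U with hA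
  have hAm : MeasurableSet A :=
    ((p.continuous.measurable hsm).inter hZfin.measurableSet.compl).inter hUo.measurableSet
  have hinj : InjOn (fun x => p.eval x) A := fun y hy z hz hyz => by
    have h1 := hUinv y hy.2
    have h2 := hUinv z hz.2
    rw [← h1, ← h2]
    exact congrArg _ hyz
  -- by the area formula the integral of `|p'|` over `A` is the measure of the null set `p(A)`
  have harea := lintegral_image_eq_lintegral_abs_deriv_mul hAm
    (fun y _ => (p.hasDerivAt y).hasDerivWithinAt) hinj fun _ => 1
  have himg : volume ((fun x => p.eval x) '' A) = 0 :=
    measure_mono_null (by rintro _ ⟨y, hy, rfl⟩; exact hy.1.1) hs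
  rw [setLIntegral_const, himg, mul_zero] at harea
  simp only [mul_one] at harea
  refine ⟨A, inter_mem_nhdsWithin _ (hUo.mem_nhds hxU), ?_⟩
  have hae := (lintegral_eq_zero_iff
    (p.derivative.continuous.measurable.abs.ennreal_ofReal)).1 harea.symm
  have hae' := (ae_restrict_iff' hAm).1 hae
  refine measure_mono_null ?_ (ae_iff.1 hae')
  intro y hy
  simp only [mem_ofPred_eq, Classical.not_imp]
  refine ⟨hy, ?_⟩
  simp only [Pi.zero_apply, ENNReal.ofReal_eq_zero, not_le, abs_pos]
  exact hy.1.2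

lemma map_polynomial_absolutelyContinuous {p : Polynomial ℝ} (hp : Polynomial.derivative p ≠ 0)
    {μ : Measure ℝ} (hμ : μ ≪ volume) : μ.map (fun x => p.eval x) ≪ volume := by
  refine Measure.AbsolutelyContinuous.mk fun s hs h0 => ?_
  rw [Measure.map_apply p.continuous.measurable hs]
  exact hμ (volume_preimage_eval_eq_zero hp hs h0)

/-! ### Densities of the images of the input measure -/

lemma SobolevBound.continuousOn {a b : ℝ} (hab : a ≤ b) {k : ℕ} (hk : 1 ≤ k) {u : ℝ → ℝ} {N : ℝ}
    (h : SobolevBound a b k u N) : ContinuousOn u (Icc a b) := by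
  obtain ⟨k, rfl⟩ := Nat.exists_eq_add_of_le' hk
  obtain ⟨-, v, hv, -⟩ := h
  exact hv.continuousOn hab

lemma neg_mem_Icc_neg_one_one {x : ℝ} (hx : x ∈ Icc (-1 : ℝ) 1) : -x ∈ Icc (-1 : ℝ) 1 :=
  ⟨by linarith [hx.2], by linarith [hx.1]⟩

lemma HasDerivWithinAt.reflect {f : ℝ → ℝ} {f' x : ℝ}
    (h : HasDerivWithinAt f f' (Icc (-1) 1) (-x)) :
    HasDerivWithinAt (fun x => f (-x)) (-f') (Icc (-1) 1) x := by
  have h1 : HasDerivWithinAt (fun x : ℝ => -x) (-1) (Icc (-1) 1) x :=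
    (hasDerivAt_neg x).hasDerivWithinAt
  have := h.comp x h1 fun y hy => neg_mem_Icc_neg_one_one hy
  simpa [Function.comp_def] using this

lemma SmoothBound.reflect {k : ℕ} {g : ℝ → ℝ} {B : ℝ} (h : SmoothBound (-1) 1 k g B) :
    SmoothBound (-1) 1 k (fun x => g (-x)) B := by
  induction k generalizing g with
  | zero =>
    exact ⟨h.1.comp continuous_neg.continuousOn fun x hx => neg_mem_Icc_neg_one_one hx,
      fun x hx => h.2 _ (neg_mem_Icc_neg_one_one hx)⟩
  | succ k ih =>
    obtain ⟨h1, g', hd, h2⟩ := h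
    exact ⟨fun x hx => h1 _ (neg_mem_Icc_neg_one_one hx), fun x => -g' (-x),
      fun x hx => (hd _ (neg_mem_Icc_neg_one_one hx)).reflect, (ih h2).neg⟩

lemma SobolevBound.reflect {k : ℕ} {u : ℝ → ℝ} {N : ℝ} (h : SobolevBound (-1) 1 k u N) :
    SobolevBound (-1) 1 k (fun x => u (-x)) N := by
  have hI : ∀ u : ℝ → ℝ, ∫ x in (-1 : ℝ)..1, |u (-x)| = ∫ x in (-1 : ℝ)..1, |u x| := fun u => by
    rw [intervalIntegral.integral_comp_neg (fun x => |u x|), neg_neg]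
  induction k generalizing u with
  | zero =>
    refine ⟨?_, by rw [hI]; exact h.2⟩
    have := (h.1.comp_sub_left 0).symm
    simpa using this
  | succ k ih =>
    obtain ⟨h1, v, hv, h2⟩ := h
    refine ⟨by rw [hI]; exact h1, fun x => -v (-x), ?_, (ih h2).neg⟩
    simpa using hv.reflect

lemma inputMeasure_absolutelyContinuous (r : ℝ → ℝ) : inputMeasure r ≪ volume :=
  (withDensity_absolutelyContinuous _ _).trans Measure.restrict_le_self.absolutelyContinuous

lemma aemeasurable_inputMeasure {f : ℝ → ℝ} (hf : ContinuousOn f (Icc (-1) 1)) (r : ℝ → ℝ) :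
    AEMeasurable f (inputMeasure r) :=
  (hf.aemeasurable measurableSet_Icc).mono_ac (withDensity_absolutelyContinuous _ _)

lemma inputMeasure_congr {r r' : ℝ → ℝ} (h : ∀ᵐ x, x ∈ Ioo (-1 : ℝ) 1 → r x = r' x) :
    inputMeasure r = inputMeasure r' := by
  refine withDensity_congr_ae ?_
  rw [← restrict_Ioo_eq_restrict_Icc]
  refine (ae_restrict_iff' measurableSet_Ioo).2 ?_
  filter_upwards [h] with x hx hm
  rw [hx hm]

lemma map_neg_inputMeasure (r : ℝ → ℝ) :
    (inputMeasure fun x => r (-x)).map (fun x => -x) = inputMeasure r := by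
  ext s hs
  rw [Measure.map_apply measurable_neg hs, inputMeasure, inputMeasure,
    withDensity_apply _ (measurable_neg hs), withDensity_apply _ hs,
    Measure.restrict_restrict (measurable_neg hs), Measure.restrict_restrict hs]
  have hp : (fun x : ℝ => -x) ⁻¹' s ∩ Icc (-1) 1 = (fun x : ℝ => -x) ⁻¹' (s ∩ Icc (-1) 1) := by
    ext x
    simp only [mem_inter_iff, mem_preimage]
    refine and_congr_right fun _ => ⟨neg_mem_Icc_neg_one_one, fun h => ?_⟩
    have := neg_mem_Icc_neg_one_one h
    rwa [neg_neg] at this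
  rw [hp]
  exact (Measure.measurePreserving_neg (volume : Measure ℝ)).setLIntegral_comp_preimage_emb
    (MeasurableEquiv.neg ℝ).measurableEmbedding (fun x => ENNReal.ofReal (r x)) _

/-- Reflecting both the map and the density leaves the image measure unchanged. -/
lemma map_inputMeasure_reflect {f : ℝ → ℝ} (hf : ContinuousOn f (Icc (-1) 1)) (r : ℝ → ℝ) :
    (inputMeasure r).map f = (inputMeasure fun x => r (-x)).map fun x => f (-x) := by
  have h := map_neg_inputMeasure r
  have hm := aemeasurable_inputMeasure hf r
  rw [← h] at hm ⊢
  rw [AEMeasurable.map_map_of_aemeasurable hm measurable_neg.aemeasurable]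
  rfl

lemma image_reflect (f : ℝ → ℝ) : (fun x => f (-x)) '' Icc (-1) 1 = f '' Icc (-1) 1 := by
  ext y
  constructor
  · rintro ⟨x, hx, rfl⟩
    exact ⟨-x, neg_mem_Icc_neg_one_one hx, rfl⟩
  · rintro ⟨x, hx, rfl⟩
    exact ⟨-x, neg_mem_Icc_neg_one_one hx, by simp⟩

/-- A `W^{m,1}` density on `[-1,1]` may be replaced by its continuous representative. -/
lemma exists_continuous_density {m : ℕ} (hm : 1 ≤ m) {r : ℝ → ℝ}
    (hr : MemSobolevOn (Ioo (-1) 1) m 1 r)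
    (hr0 : ∀ᵐ x ∂(volume.restrict (Icc (-1 : ℝ) 1)), 0 ≤ r x)
    (hr1 : ∫ x in Icc (-1 : ℝ) 1, r x = 1) :
    ∃ (r' : ℝ → ℝ) (N : ℝ), inputMeasure r = inputMeasure r' ∧ SobolevBound (-1) 1 m r' N ∧
      (∀ x ∈ Icc (-1 : ℝ) 1, 0 ≤ r' x) ∧ ∫ x in (-1 : ℝ)..1, r' x = 1 := by
  have h11 : (-1 : ℝ) < 1 := by norm_num
  set N := (sobolevENorm (Ioo (-1) 1) m 1 r).toReal + 1 with hN
  have hlt : sobolevENorm (Ioo (-1) 1) m 1 r < ENNReal.ofReal N := by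
    rw [ENNReal.lt_ofReal_iff_toReal_lt hr.ne]
    linarith
  obtain ⟨r', hrr, hr'⟩ := exists_sobolevBound_of_sobolevENorm_lt h11
    (by rw [hN]; positivity) hlt
  have hc := hr'.continuousOn h11.le hm
  have hae : ∀ᵐ x ∂(volume.restrict (Icc (-1 : ℝ) 1)), r x = r' x := by
    rw [← restrict_Ioo_eq_restrict_Icc]
    exact (ae_restrict_iff' measurableSet_Ioo).2 hrr
  refine ⟨r', N, inputMeasure_congr hrr, hr', fun x hx => ?_, ?_⟩
  · have h1 : r' =ᵐ[volume.restrict (Icc (-1 : ℝ) 1)] fun x => |r' x| := by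
      filter_upwards [hr0, hae] with y h2 h3
      rw [← h3, abs_of_nonneg h2]
    have h2 := Measure.eqOn_Icc_of_ae_eq volume h11.ne h1 hc hc.abs hx
    rw [h2]
    exact abs_nonneg _
  · rw [intervalIntegral.integral_of_le h11.le, ← integral_Icc_eq_integral_Ioc]
    refine Eq.trans ?_ hr1
    refine integral_congr_ae ?_
    filter_upwards [hae] with x hx
    exact hx.symm

namespace IsIncreasingDiffeo

variable {κ c d : ℝ} {φ φ' ψ r : ℝ → ℝ}

lemma map_inputMeasure (h : IsIncreasingDiffeo κ (-1) 1 c d φ φ' ψ) (r : ℝ → ℝ) :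
    (inputMeasure r).map φ =
      (volume.restrict (Icc c d)).withDensity fun y => ENNReal.ofReal (pushDensity φ' ψ r y) :=
  h.map_withDensity r

lemma pdfOf_ae_eq (h : IsIncreasingDiffeo κ (-1) 1 c d φ φ' ψ) (hrc : ContinuousOn r (Icc (-1) 1))
    (hr0 : ∀ x ∈ Icc (-1 : ℝ) 1, 0 ≤ r x) :
    pdfOf ((inputMeasure r).map φ) =ᵐ[volume] (Icc c d).indicator (pushDensity φ' ψ r) := by
  rw [h.map_inputMeasure]
  exact pdfOf_withDensity_ae_eq (h.continuousOn_pushDensity hrc) fun y hy =>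
    h.pushDensity_nonneg hr0 hy

lemma pdfOf_ae_eq_Ioo (h : IsIncreasingDiffeo κ (-1) 1 c d φ φ' ψ)
    (hrc : ContinuousOn r (Icc (-1) 1)) (hr0 : ∀ x ∈ Icc (-1 : ℝ) 1, 0 ≤ r x) :
    ∀ᵐ y, y ∈ Ioo c d → pdfOf ((inputMeasure r).map φ) y = pushDensity φ' ψ r y := by
  filter_upwards [h.pdfOf_ae_eq hrc hr0] with y hy hm
  rw [hy, indicator_of_mem (Ioo_subset_Icc_self hm)]

lemma interior_image (h : IsIncreasingDiffeo κ (-1) 1 c d φ φ' ψ) :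
    interior (φ '' Icc (-1) 1) = Ioo c d := by
  rw [h.image_eq, interior_Icc]

/-- A Sobolev bound for the density function is a bound for its continuous representative. -/
lemma sobolevBound_of_sobolevENorm_lt {m : ℕ} (hm : 1 ≤ m) {K : ℝ}
    (h : IsIncreasingDiffeo κ (-1) 1 c d φ φ' ψ) (hrc : ContinuousOn r (Icc (-1) 1))
    (hr0 : ∀ x ∈ Icc (-1 : ℝ) 1, 0 ≤ r x)
    (hK : sobolevENorm (interior (φ '' Icc (-1) 1)) m 1 (pdfOf ((inputMeasure r).map φ))
      < ENNReal.ofReal K) :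
    SobolevBound c d m (pushDensity φ' ψ r) K := by
  rw [h.interior_image] at hK
  have hcd := h.lt'
  have hK0 : 0 ≤ K := (ENNReal.ofReal_pos.1 (bot_le.trans_lt hK)).le
  obtain ⟨p, hp1, hp2⟩ := exists_sobolevBound_of_sobolevENorm_lt hcd hK0 hK
  refine hp2.congr hcd.le (Measure.eqOn_Icc_of_ae_eq volume hcd.ne ?_
    (h.continuousOn_pushDensity hrc) (hp2.continuousOn hcd.le hm))
  rw [← restrict_Ioo_eq_restrict_Icc]
  refine (ae_restrict_iff' measurableSet_Ioo).2 ?_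
  filter_upwards [hp1, h.pdfOf_ae_eq_Ioo hrc hr0] with y h1 h2 hy
  rw [← h2 hy, h1 hy]

lemma integral_abs_pdf_sub_eq {g g' χ : ℝ → ℝ} (h : IsIncreasingDiffeo κ (-1) 1 c d φ φ' ψ)
    (hg : IsIncreasingDiffeo κ (-1) 1 c d g g' χ) (hrc : ContinuousOn r (Icc (-1) 1))
    (hr0 : ∀ x ∈ Icc (-1 : ℝ) 1, 0 ≤ r x) :
    ∫ y, |pdfOf ((inputMeasure r).map φ) y - pdfOf ((inputMeasure r).map g) y| =
      ∫ y in c..d, |pushDensity φ' ψ r y - pushDensity g' χ r y| := by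
  rw [intervalIntegral.integral_of_le h.lt'.le, ← integral_Icc_eq_integral_Ioc,
    ← integral_indicator measurableSet_Icc]
  refine integral_congr_ae ?_
  filter_upwards [h.pdfOf_ae_eq hrc hr0, hg.pdfOf_ae_eq hrc hr0] with y h1 h2
  rw [h1, h2]
  by_cases hy : y ∈ Icc c d
  · simp only [indicator_of_mem hy]
  · simp only [indicator_of_notMem hy, sub_zero, abs_zero]

lemma absolutelyContinuous_map (h : IsIncreasingDiffeo κ (-1) 1 c d φ φ' ψ) (r : ℝ → ℝ) :
    (inputMeasure r).map φ ≪ volume := by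
  rw [h.map_inputMeasure]
  exact (withDensity_absolutelyContinuous _ _).trans Measure.restrict_le_self.absolutelyContinuous

lemma memSobolevOn_pdfOf {m : ℕ} (hm : 1 ≤ m) {B N : ℝ}
    (h : IsIncreasingDiffeo κ (-1) 1 c d φ φ' ψ) (hs : SmoothBound (-1) 1 m φ' B)
    (hr : SobolevBound (-1) 1 m r N) (hr0 : ∀ x ∈ Icc (-1 : ℝ) 1, 0 ≤ r x) :
    MemSobolevOn (interior (φ '' Icc (-1) 1)) m 1 (pdfOf ((inputMeasure r).map φ)) := by
  obtain ⟨C, -, hC⟩ := exists_sobolevBound_pushDensity m κ B h.pos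
  rw [h.interior_image]
  exact ((hC _ _ _ _ _ _ _ _ _ h hs hr).sobolevENorm_le h.lt' (h.pdfOf_ae_eq_Ioo
    (hr.continuousOn h.lt.le hm) hr0)).trans_lt ENNReal.ofReal_lt_top

/-- The density has total mass one, so its Sobolev norm, which dominates its `L¹` norm, is at least
one. -/
lemma one_le_sobolevNorm {m : ℕ} (hm : 1 ≤ m)
    (h : IsIncreasingDiffeo κ (-1) 1 c d φ φ' ψ) (hrc : ContinuousOn r (Icc (-1) 1))
    (hr0 : ∀ x ∈ Icc (-1 : ℝ) 1, 0 ≤ r x) (hr1 : ∫ x in (-1 : ℝ)..1, r x = 1)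
    (hmem : MemSobolevOn (interior (φ '' Icc (-1) 1)) m 1 (pdfOf ((inputMeasure r).map φ))) :
    1 ≤ sobolevNorm (interior (φ '' Icc (-1) 1)) m 1 (pdfOf ((inputMeasure r).map φ)) := by
  refine le_of_forall_gt_imp_ge_of_dense fun K hK => ?_
  have h1 := h.sobolevBound_of_sobolevENorm_lt hm hrc hr0
    ((ENNReal.lt_ofReal_iff_toReal_lt hmem.ne).2 hK)
  have h2 := h1.integral_le
  have h3 := h.integral_mul_pushDensity (r := r) fun _ => 1
  simp only [one_mul, hr1] at h3
  have h4 := intervalIntegral.abs_integral_le_integral_abs (f := pushDensity φ' ψ r) (μ := volume)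
    h.lt'.le
  rw [h3, abs_one] at h4
  linarith

end IsIncreasingDiffeo

/-- Regularity of the density of the image under a monotone map. -/
lemma pdfOf_map_regularity {m : ℕ} (hm : 1 ≤ m) {κ B N : ℝ} (hκ : 0 < κ) {f f' r : ℝ → ℝ}
    (hd : ∀ x ∈ Icc (-1 : ℝ) 1, HasDerivWithinAt f (f' x) (Icc (-1) 1) x)
    (hs : SmoothBound (-1) 1 m f' B)
    (hl : (∀ x ∈ Icc (-1 : ℝ) 1, κ ≤ f' x) ∨ ∀ x ∈ Icc (-1 : ℝ) 1, f' x ≤ -κ)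
    (hr : SobolevBound (-1) 1 m r N) (hr0 : ∀ x ∈ Icc (-1 : ℝ) 1, 0 ≤ r x)
    (hr1 : ∫ x in (-1 : ℝ)..1, r x = 1) :
    (inputMeasure r).map f ≪ volume ∧
      MemSobolevOn (interior (f '' Icc (-1) 1)) m 1 (pdfOf ((inputMeasure r).map f)) ∧
      1 ≤ sobolevNorm (interior (f '' Icc (-1) 1)) m 1 (pdfOf ((inputMeasure r).map f)) := by
  have h11 : (-1 : ℝ) < 1 := by norm_num
  have key : ∀ {f f' r : ℝ → ℝ},
      (∀ x ∈ Icc (-1 : ℝ) 1, HasDerivWithinAt f (f' x) (Icc (-1) 1) x) →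
      SmoothBound (-1) 1 m f' B → (∀ x ∈ Icc (-1 : ℝ) 1, κ ≤ f' x) → SobolevBound (-1) 1 m r N →
      (∀ x ∈ Icc (-1 : ℝ) 1, 0 ≤ r x) → (∫ x in (-1 : ℝ)..1, r x = 1) →
      (inputMeasure r).map f ≪ volume ∧
      MemSobolevOn (interior (f '' Icc (-1) 1)) m 1 (pdfOf ((inputMeasure r).map f)) ∧
      1 ≤ sobolevNorm (interior (f '' Icc (-1) 1)) m 1 (pdfOf ((inputMeasure r).map f)) := by
    intro f f' r hd hs hl hr hr0 hr1
    obtain ⟨ψ, h⟩ := IsIncreasingDiffeo.mk' h11 hκ hd hs.continuousOn hl rfl rfl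
    have hmem := h.memSobolevOn_pdfOf hm hs hr hr0
    exact ⟨h.absolutelyContinuous_map r, hmem,
      h.one_le_sobolevNorm hm (hr.continuousOn h11.le hm) hr0 hr1 hmem⟩
  rcases hl with hl | hl
  · exact key hd hs hl hr hr0 hr1
  · have hc : ContinuousOn f (Icc (-1) 1) := fun x hx => (hd x hx).continuousWithinAt
    rw [map_inputMeasure_reflect hc, ← image_reflect f]
    refine key (f' := fun x => -f' (-x)) (fun x hx => (hd _ (neg_mem_Icc_neg_one_one hx)).reflect)
      hs.reflect.neg (fun x hx => ?_) hr.reflect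
      (fun x hx => hr0 _ (neg_mem_Icc_neg_one_one hx)) ?_
    · have := hl _ (neg_mem_Icc_neg_one_one hx)
      linarith
    · rw [intervalIntegral.integral_comp_neg, neg_neg, hr1]

/-- Stability of the density of the image under a perturbation of a monotone map. -/
lemma exists_integral_abs_pdf_sub_le {m : ℕ} (hm : 1 ≤ m) (κ B : ℝ) (hκ : 0 < κ) :
    ∃ C : ℝ, 0 ≤ C ∧ ∀ (f f' g g' r : ℝ → ℝ) (K δ h : ℝ),
      (∀ x ∈ Icc (-1 : ℝ) 1, HasDerivWithinAt f (f' x) (Icc (-1) 1) x) →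
      (∀ x ∈ Icc (-1 : ℝ) 1, HasDerivWithinAt g (g' x) (Icc (-1) 1) x) →
      SmoothBound (-1) 1 m f' B → SmoothBound (-1) 1 m g' B →
      ((∀ x ∈ Icc (-1 : ℝ) 1, κ ≤ f' x ∧ κ ≤ g' x) ∨
        ∀ x ∈ Icc (-1 : ℝ) 1, f' x ≤ -κ ∧ g' x ≤ -κ) →
      f (-1) = g (-1) → f 1 = g 1 →
      ContinuousOn r (Icc (-1) 1) → (∀ x ∈ Icc (-1 : ℝ) 1, 0 ≤ r x) →
      (∫ x in (-1 : ℝ)..1, r x = 1) → (∀ x ∈ Icc (-1 : ℝ) 1, |f x - g x| ≤ δ) →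
      0 < h → h ≤ κ →
      sobolevENorm (interior (f '' Icc (-1) 1)) m 1 (pdfOf ((inputMeasure r).map f))
        < ENNReal.ofReal K →
      ∫ y, |pdfOf ((inputMeasure r).map f) y - pdfOf ((inputMeasure r).map g) y|
        ≤ C * (h⁻¹ * δ + h ^ m * K) := by
  have h11 : (-1 : ℝ) < 1 := by norm_num
  obtain ⟨C, hC0, hC⟩ := exists_integral_abs_pushDensity_sub_le m κ B hκ
  have key : ∀ (f f' g g' r : ℝ → ℝ) (K δ h : ℝ),
      (∀ x ∈ Icc (-1 : ℝ) 1, HasDerivWithinAt f (f' x) (Icc (-1) 1) x) →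
      (∀ x ∈ Icc (-1 : ℝ) 1, HasDerivWithinAt g (g' x) (Icc (-1) 1) x) →
      SmoothBound (-1) 1 m f' B → SmoothBound (-1) 1 m g' B →
      (∀ x ∈ Icc (-1 : ℝ) 1, κ ≤ f' x ∧ κ ≤ g' x) →
      f (-1) = g (-1) → f 1 = g 1 →
      ContinuousOn r (Icc (-1) 1) → (∀ x ∈ Icc (-1 : ℝ) 1, 0 ≤ r x) →
      (∫ x in (-1 : ℝ)..1, r x = 1) → (∀ x ∈ Icc (-1 : ℝ) 1, |f x - g x| ≤ δ) →
      0 < h → h ≤ κ →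
      sobolevENorm (interior (f '' Icc (-1) 1)) m 1 (pdfOf ((inputMeasure r).map f))
        < ENNReal.ofReal K →
      ∫ y, |pdfOf ((inputMeasure r).map f) y - pdfOf ((inputMeasure r).map g) y|
        ≤ C * (h⁻¹ * δ + h ^ m * K) := by
    intro f f' g g' r K δ h hf hg hsf hsg hl e1 e2 hrc hr0 hr1 hδ hh hhκ hK
    obtain ⟨ψ, hF⟩ := IsIncreasingDiffeo.mk' h11 hκ hf hsf.continuousOn
      (fun x hx => (hl x hx).1) rfl rfl
    obtain ⟨χ, hG⟩ := IsIncreasingDiffeo.mk' h11 hκ hg hsg.continuousOn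
      (fun x hx => (hl x hx).2) e1.symm e2.symm
    rw [hF.integral_abs_pdf_sub_eq hG hrc hr0]
    have hlen := hF.length_le
    exact hC _ _ _ _ _ _ _ _ _ _ _ K δ h hF hG hsf hsg hrc hr0 hr1
      (hF.sobolevBound_of_sobolevENorm_lt hm hrc hr0 hK) hδ hh (by linarith)
  refine ⟨C, hC0, fun f f' g g' r K δ h hf hg hsf hsg hl e1 e2 hrc hr0 hr1 hδ hh hhκ hK => ?_⟩
  rcases hl with hl | hl
  · exact key f f' g g' r K δ h hf hg hsf hsg hl e1 e2 hrc hr0 hr1 hδ hh hhκ hK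
  · have hcf : ContinuousOn f (Icc (-1) 1) := fun x hx => (hf x hx).continuousWithinAt
    have hcg : ContinuousOn g (Icc (-1) 1) := fun x hx => (hg x hx).continuousWithinAt
    rw [map_inputMeasure_reflect hcf, ← image_reflect f] at hK
    rw [map_inputMeasure_reflect hcf, map_inputMeasure_reflect hcg]
    refine key _ (fun x => -f' (-x)) _ (fun x => -g' (-x)) _ K δ h
      (fun x hx => (hf _ (neg_mem_Icc_neg_one_one hx)).reflect)
      (fun x hx => (hg _ (neg_mem_Icc_neg_one_one hx)).reflect)
      hsf.reflect.neg hsg.reflect.neg (fun x hx => ?_) (by simpa using e2) (by simpa using e1)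
      (hrc.comp continuous_neg.continuousOn fun x hx => neg_mem_Icc_neg_one_one hx)
      (fun x hx => hr0 _ (neg_mem_Icc_neg_one_one hx)) ?_
      (fun x hx => hδ _ (neg_mem_Icc_neg_one_one hx)) hh hhκ hK
    · have := hl _ (neg_mem_Icc_neg_one_one hx)
      exact ⟨by linarith [this.1], by linarith [this.2]⟩
    · rw [intervalIntegral.integral_comp_neg, neg_neg, hr1]

/-- The `L¹` distance of two probability densities is at most two. -/
lemma integral_abs_pdf_sub_le_two {r : ℝ → ℝ} (hri : IntervalIntegrable r volume (-1) 1)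
    (hr0 : ∀ x ∈ Icc (-1 : ℝ) 1, 0 ≤ r x) (hr1 : ∫ x in (-1 : ℝ)..1, r x = 1) {f g : ℝ → ℝ}
    (hf : ContinuousOn f (Icc (-1) 1)) (hg : ContinuousOn g (Icc (-1) 1)) :
    ∫ y, |pdfOf ((inputMeasure r).map f) y - pdfOf ((inputMeasure r).map g) y| ≤ 2 := by
  have h11 : (-1 : ℝ) ≤ 1 := by norm_num
  have hP : IsProbabilityMeasure (inputMeasure r) := by
    refine ⟨?_⟩
    rw [inputMeasure, withDensity_apply _ MeasurableSet.univ, Measure.restrict_univ,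
      ← restrict_Ioc_eq_restrict_Icc, ← ofReal_integral_eq_lintegral_ofReal hri.1,
      ← intervalIntegral.integral_of_le h11, hr1, ENNReal.ofReal_one]
    exact (ae_restrict_iff' measurableSet_Ioc).2
      (Filter.Eventually.of_forall fun x hx => hr0 x (Ioc_subset_Icc_self hx))
  have h1 : ∀ {f : ℝ → ℝ}, ContinuousOn f (Icc (-1) 1) →
      Integrable (pdfOf ((inputMeasure r).map f)) ∧ ∫ y, pdfOf ((inputMeasure r).map f) y ≤ 1 := by
    intro f hf
    have := Measure.isProbabilityMeasure_map (aemeasurable_inputMeasure hf r)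
    refine ⟨Measure.integrable_toReal_rnDeriv, ?_⟩
    have h2 := Measure.setIntegral_toReal_rnDeriv_le (μ := (inputMeasure r).map f)
      (ν := (volume : Measure ℝ)) (s := univ) (measure_ne_top _ _)
    rw [setIntegral_univ] at h2
    refine h2.trans ?_
    simp
  obtain ⟨i1, b1⟩ := h1 hf
  obtain ⟨i2, b2⟩ := h1 hg
  calc ∫ y, |pdfOf ((inputMeasure r).map f) y - pdfOf ((inputMeasure r).map g) y|
      ≤ ∫ y, (pdfOf ((inputMeasure r).map f) y + pdfOf ((inputMeasure r).map g) y) := by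
        refine integral_mono (i1.sub i2).abs (i1.add i2) fun y => ?_
        have h3 : 0 ≤ pdfOf ((inputMeasure r).map f) y := ENNReal.toReal_nonneg
        have h4 : 0 ≤ pdfOf ((inputMeasure r).map g) y := ENNReal.toReal_nonneg
        rw [abs_le]
        constructor <;> simp only <;> linarith
    _ ≤ 2 := by
        rw [integral_add i1 i2]
        linarith

/-! ### Functions of bounded Sobolev norm -/

/-- A continuous function of finite `W^{σ,2}` norm is the start of a chain of primitives. -/
lemma exists_isSobolevChain {σ : ℕ} {f : ℝ → ℝ} (hf : ContinuousOn f (Icc (-1) 1)) (hσ : 1 ≤ σ)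
    {K : ℝ} (hK : sobolevENorm (Ioo (-1) 1) σ 2 f < ENNReal.ofReal K) :
    ∃ w : ℕ → ℝ → ℝ, IsSobolevChain σ K w ∧ EqOn f (w 0) (Icc (-1) 1) := by
  have h11 : (-1 : ℝ) < 1 := by norm_num
  have hK0 : 0 ≤ K := (ENNReal.ofReal_pos.1 (bot_le.trans_lt hK)).le
  obtain ⟨v, hv, hvK⟩ := exists_family_of_sobolevENorm_lt hK
  have hLp : ∀ j ≤ σ, MemLp (v j) 2 (volume.restrict (Ioo (-1) 1)) := fun j hj =>
    ⟨(hv j hj).2.1.aestronglyMeasurable, (hvK j hj).trans ENNReal.ofReal_lt_top⟩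
  have hsq : ∀ j ≤ σ, ∫ x in Ioo (-1 : ℝ) 1, v j x ^ 2 ≤ K ^ 2 := by
    intro j hj
    have h1 := (hvK j hj).le
    rw [(hLp j hj).eLpNorm_eq_integral_rpow_norm (by norm_num) (by norm_num),
      ENNReal.ofReal_le_ofReal_iff hK0] at h1
    simp only [ENNReal.toReal_ofNat, Real.rpow_two, Real.norm_eq_abs, sq_abs] at h1
    have h0 : 0 ≤ ∫ x in Ioo (-1 : ℝ) 1, v j x ^ 2 := integral_nonneg fun x => sq_nonneg _
    rw [← one_div, ← Real.sqrt_eq_rpow, Real.sqrt_le_left hK0] at h1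
    exact h1
  obtain ⟨w, hw1, hw2⟩ := exists_isPrimitiveOn_of_hasWeakDerivOn h11 hv
    fun j hj => (hLp j hj).integrable (by norm_num)
  refine ⟨w, ⟨hw1, fun j hj => ?_, fun j hj => ?_⟩, ?_⟩
  · rw [intervalIntegrable_iff_integrableOn_Ioo_of_le h11.le]
    refine (hLp j hj).integrable_sq.congr ((ae_restrict_iff' measurableSet_Ioo).2 ?_)
    filter_upwards [hw2 j hj] with x hx hm
    rw [hx hm]
  · rw [intervalIntegral.integral_of_le h11.le, integral_Ioc_eq_integral_Ioo]
    refine le_trans (le_of_eq ?_) (hsq j hj)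
    refine integral_congr_ae ((ae_restrict_iff' measurableSet_Ioo).2 ?_)
    filter_upwards [hw2 j hj] with x hx hm
    rw [hx hm]
  · refine Measure.eqOn_Icc_of_ae_eq volume h11.ne ?_ hf ((hw1 0 hσ).continuousOn h11.le)
    rw [← restrict_Ioo_eq_restrict_Icc]
    refine (ae_restrict_iff' measurableSet_Ioo).2 ?_
    filter_upwards [(hv 0 (Nat.zero_le _)).ae_eq_of_zero isOpen_Ioo, hw2 0 (Nat.zero_le _)]
      with x h1 h2 hx
    rw [h1 hx, h2 hx]

namespace IsSobolevChain

variable {σ : ℕ} {K : ℝ} {w : ℕ → ℝ → ℝ} {f : ℝ → ℝ}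

lemma hasDerivWithinAt (hw : IsSobolevChain σ K w) (hσ : 2 ≤ σ) (hf : EqOn f (w 0) (Icc (-1) 1))
    {x : ℝ} (hx : x ∈ Icc (-1 : ℝ) 1) : HasDerivWithinAt f (w 1 x) (Icc (-1) 1) x :=
  ((hw.prim 0 (by omega)).hasDerivWithinAt (by norm_num)
    ((hw.prim 1 (by omega)).continuousOn (by norm_num)) hx).congr hf (hf hx)

lemma derivWithin_eq (hw : IsSobolevChain σ K w) (hσ : 2 ≤ σ) (hf : EqOn f (w 0) (Icc (-1) 1))
    {x : ℝ} (hx : x ∈ Icc (-1 : ℝ) 1) : derivWithin f (Icc (-1) 1) x = w 1 x :=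
  (hw.hasDerivWithinAt hσ hf hx).derivWithin (uniqueDiffOn_Icc (by norm_num) x hx)

lemma smoothBound (hw : IsSobolevChain σ K w) {m : ℕ} (hσ : m + 2 ≤ σ) :
    SmoothBound (-1) 1 m (w 1) (2 * (1 + K ^ 2)) :=
  smoothBound_of_chain (w := fun j => w (j + 1)) (by norm_num)
    (fun j hj => hw.prim (j + 1) (by omega))
    fun j hj => ⟨(hw.prim (j + 1) (by omega)).continuousOn (by norm_num),
      fun x hx => hw.abs_le (by omega) hx⟩

end IsSobolevChain

/-- The Sobolev norm of a function dominates a lower bound for its derivative. -/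
lemma le_sobolevNorm {σ : ℕ} {f : ℝ → ℝ} (hf : ContinuousOn f (Icc (-1) 1)) (hσ : 2 ≤ σ)
    (hmem : MemSobolevOn (Ioo (-1) 1) σ 2 f) {κ : ℝ} (hκ : 0 < κ)
    (hκf : ∀ x ∈ Icc (-1 : ℝ) 1, κ ≤ |derivWithin f (Icc (-1) 1) x|) :
    κ ≤ sobolevNorm (Ioo (-1) 1) σ 2 f := by
  refine le_of_forall_gt_imp_ge_of_dense fun K hK => ?_
  have hK0 : 0 ≤ K := ENNReal.toReal_nonneg.trans hK.le
  obtain ⟨w, hw, hfw⟩ := exists_isSobolevChain hf (by omega)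
    ((ENNReal.lt_ofReal_iff_toReal_lt hmem.ne).2 hK)
  have h1 := hw.sq_le 1 (by omega)
  have h2 : ∫ _ in (-1 : ℝ)..1, κ ^ 2 ≤ ∫ x in (-1 : ℝ)..1, w 1 x ^ 2 := by
    refine intervalIntegral.integral_mono_on (by norm_num) intervalIntegrable_const
      (hw.sq_integrable 1 (by omega)) fun x hx => ?_
    have := hκf x hx
    rw [hw.derivWithin_eq hσ hfw hx] at this
    rw [← sq_abs (w 1 x)]
    gcongr
  rw [intervalIntegral.integral_const, smul_eq_mul] at h2
  exact abs_le_of_sq_le_sq' (by nlinarith [sq_nonneg κ]) hK0 |>.2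

lemma smoothBound_polynomial {a b : ℝ} {k : ℕ} {p : Polynomial ℝ} {B : ℝ}
    (h : ∀ j ≤ k, ∀ x ∈ Icc a b, |(Polynomial.derivative^[j] p).eval x| ≤ B) :
    SmoothBound a b k (fun x => p.eval x) B := by
  induction k generalizing p with
  | zero => exact ⟨p.continuous.continuousOn, fun x hx => h 0 le_rfl x hx⟩
  | succ k ih =>
    refine ⟨fun x hx => h 0 (Nat.zero_le _) x hx, fun x => (Polynomial.derivative p).eval x,
      fun x _ => (p.hasDerivAt x).hasDerivWithinAt, ih fun j hj x hx => ?_⟩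
    exact h (j + 1) (by omega) x hx

/-- A continuous function bounded away from zero on an interval has constant sign. -/
lemma le_or_le_neg_of_le_abs {κ : ℝ} (hκ : 0 < κ) {u : ℝ → ℝ} (hu : ContinuousOn u (Icc (-1) 1))
    (h : ∀ x ∈ Icc (-1 : ℝ) 1, κ ≤ |u x|) :
    (∀ x ∈ Icc (-1 : ℝ) 1, κ ≤ u x) ∨ ∀ x ∈ Icc (-1 : ℝ) 1, u x ≤ -κ := by
  by_contra! hcon
  obtain ⟨⟨x, hx, hx'⟩, y, hy, hy'⟩ := hcon
  have h1 : u x ≤ 0 := by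
    rcases abs_cases (u x) with ⟨h2, h3⟩ | ⟨h2, h3⟩
    · linarith [h x hx]
    · exact h3.le
  have h2 : 0 ≤ u y := by
    rcases abs_cases (u y) with ⟨h2, h3⟩ | ⟨h2, h3⟩
    · exact h3
    · linarith [h y hy]
  obtain ⟨z, hz, hz0⟩ := isPreconnected_Icc.intermediate_value hx hy hu ⟨h1, h2⟩
  have := h z hz
  rw [hz0, abs_zero] at this
  linarith

lemma gaussLobattoInterpolant_eq_of_mem {n : ℕ} (f : ℝ → ℝ) {x : ℝ}
    (hx : x ∈ gaussLobattoNodes n) : gaussLobattoInterpolant n f x = f x :=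
  Lagrange.eval_interpolate_at_node (v := id) f (injOn_id _) hx

/-! ### The convergence rate -/

/-- The choice of scale balancing the two contributions `h⁻¹ δ` and `h ^ m K`. -/
lemma exists_scale (m : ℕ) {κ D E K x : ℝ} (hκ : 0 < κ) (hD : 0 ≤ D) (hK : 1 ≤ K) (hx : 1 ≤ x)
    (hE : 0 ≤ E) :
    ∃ h, 0 < h ∧ h ≤ κ ∧ h⁻¹ * (D * x ^ (-E)) + h ^ m * K ≤
      (D / κ + κ ^ m) * (K ^ ((1 : ℝ) / ((m : ℝ) + 1)) * x ^ (-((m : ℝ) / ((m : ℝ) + 1)) * E)) := by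
  have hx0 : 0 < x := by linarith
  have hK0 : 0 < K := by linarith
  set q : ℝ := 1 / ((m : ℝ) + 1) with hq
  have hm1 : (0 : ℝ) < (m : ℝ) + 1 := by positivity
  have hq0 : 0 < q := by positivity
  have hqm : (m : ℝ) * q = 1 - q := by rw [hq]; field_simp; ring
  -- `κ t` is the scale at which both terms are comparable: `x ^ (-E) = t ^ (m + 1) K`
  set t : ℝ := x ^ (-E * q) * K ^ (-q) with ht
  have ht0 : 0 < t := by positivity
  have ht1 : t ≤ 1 := mul_le_one₀
    (Real.rpow_le_one_of_one_le_of_nonpos hx (by nlinarith)) (by positivity)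
    (Real.rpow_le_one_of_one_le_of_nonpos hK (by linarith))
  have htm : t ^ m * K = K ^ q * x ^ (-((m : ℝ) / ((m : ℝ) + 1)) * E) := by
    rw [ht, mul_pow, ← Real.rpow_mul_natCast hx0.le, ← Real.rpow_mul_natCast hK0.le, mul_assoc,
      ← Real.rpow_add_one hK0.ne', mul_comm]
    congr 2
    · linarith
    · rw [hq]; field_simp
  have htx : x ^ (-E) = t * (t ^ m * K) := by
    have e1 : t * (t ^ m * K) = t ^ (m + 1) * K := by ring
    rw [e1, ht, mul_pow, ← Real.rpow_mul_natCast hx0.le, ← Real.rpow_mul_natCast hK0.le, mul_assoc,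
      ← Real.rpow_add_one hK0.ne']
    have e2 : -E * q * ((m + 1 : ℕ) : ℝ) = -E := by rw [hq]; push_cast; field_simp
    have e3 : -q * ((m + 1 : ℕ) : ℝ) + 1 = 0 := by rw [hq]; push_cast; field_simp; ring
    rw [e2, e3, Real.rpow_zero, mul_one]
  refine ⟨κ * t, by positivity, mul_le_of_le_one_right hκ.le ht1, ?_⟩
  rw [htx, ← htm]
  clear_value t
  rw [mul_pow, mul_inv]
  refine le_of_eq ?_
  field_simp

/-- The rate of convergence of the densities, up to the factor involving the norm of `f`. -/
lemma exists_integral_abs_pdf_sub_interpolant_le {m : ℕ} (hm : 1 ≤ m) {σ : ℕ} (hσ : 2 * m + 4 ≤ σ)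
    {κ : ℝ} (hκ : 0 < κ) (M : ℝ) :
    ∃ C : ℝ, 0 ≤ C ∧ ∀ (f r : ℝ → ℝ) (w : ℕ → ℝ → ℝ), IsSobolevChain σ M w →
      EqOn f (w 0) (Icc (-1) 1) →
      ((∀ x ∈ Icc (-1 : ℝ) 1, κ ≤ w 1 x) ∨ ∀ x ∈ Icc (-1 : ℝ) 1, w 1 x ≤ -κ) →
      ContinuousOn r (Icc (-1) 1) → (∀ x ∈ Icc (-1 : ℝ) 1, 0 ≤ r x) →
      (∫ x in (-1 : ℝ)..1, r x = 1) →
      MemSobolevOn (interior (f '' Icc (-1) 1)) m 1 (pdfOf ((inputMeasure r).map f)) →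
      1 ≤ sobolevNorm (interior (f '' Icc (-1) 1)) m 1 (pdfOf ((inputMeasure r).map f)) →
      ∀ n : ℕ, 1 ≤ n →
        ∫ y, |pdfOf ((inputMeasure r).map f) y
            - pdfOf ((inputMeasure r).map (gaussLobattoInterpolant n f)) y|
          ≤ C * (sobolevNorm (interior (f '' Icc (-1) 1)) m 1
                  (pdfOf ((inputMeasure r).map f)) ^ ((1 : ℝ) / ((m : ℝ) + 1))
              * (n : ℝ) ^ (-((m : ℝ) / ((m : ℝ) + 1)) * ((σ : ℝ) - 5 / 6))) := by
  obtain ⟨s, rfl⟩ := Nat.exists_eq_add_of_le' (show 1 ≤ σ by omega)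
  obtain ⟨C1, hC10, hC1⟩ := exists_interpolation_bounds m s (by omega) M
  set B := max (2 * (1 + M ^ 2)) C1 with hB
  have hκ2 : 0 < κ / 2 := by positivity
  obtain ⟨C2, hC20, hC2⟩ := exists_integral_abs_pdf_sub_le hm (κ / 2) B hκ2
  set E : ℝ := ((s + 1 : ℕ) : ℝ) - 5 / 6 with hE
  have hE0 : 0 ≤ E := by
    have : (1 : ℝ) ≤ ((s + 1 : ℕ) : ℝ) := by exact_mod_cast Nat.le_add_left 1 s
    rw [hE]; linarith
  -- from the order `n0` on, the derivatives of `f` and of the interpolant differ by at most `κ / 2`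
  obtain ⟨n1, hn1⟩ := exists_nat_gt (C1 / (κ / 2) ^ 2)
  set n0 := max (2 * s) n1 with hn0
  set e : ℝ := (m : ℝ) / ((m : ℝ) + 1) * E with he
  have he0 : 0 ≤ e := by positivity
  set CA := C2 * (2 * (Real.sqrt C1 / (κ / 2) + (κ / 2) ^ m)) with hCA
  have hCA0 : 0 ≤ CA := by positivity
  set CB := 2 * (n0 : ℝ) ^ e with hCB
  have hCB0 : 0 ≤ CB := by positivity
  refine ⟨CA + CB, by positivity, fun f r w hw hfw hl hrc hr0 hr1 hmem hK1 n hn => ?_⟩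
  set K := sobolevNorm (interior (f '' Icc (-1) 1)) m 1 (pdfOf ((inputMeasure r).map f)) with hK
  have h11 : (-1 : ℝ) < 1 := by norm_num
  have hnR : (1 : ℝ) ≤ n := by exact_mod_cast hn
  have hnpos : (0 : ℝ) < n := by linarith
  have hKq : 1 ≤ K ^ ((1 : ℝ) / ((m : ℝ) + 1)) := Real.one_le_rpow hK1 (by positivity)
  have hexp : -((m : ℝ) / ((m : ℝ) + 1)) * E = -e := by rw [he]; ring
  have hfd : ∀ x ∈ Icc (-1 : ℝ) 1, HasDerivWithinAt f (w 1 x) (Icc (-1) 1) x := fun x hx =>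
    hw.hasDerivWithinAt (by omega) hfw hx
  have hfc : ContinuousOn f (Icc (-1) 1) := fun x hx => (hfd x hx).continuousWithinAt
  rw [add_mul]
  rcases lt_or_ge n n0 with hlt | hge
  · -- finitely many orders: the trivial bound
    have hri : IntervalIntegrable r volume (-1) 1 := by
      rw [← uIcc_of_le h11.le] at hrc
      exact hrc.intervalIntegrable
    have h1 := integral_abs_pdf_sub_le_two hri hr0 hr1 hfc
      (g := gaussLobattoInterpolant n f) (Polynomial.continuous _).continuousOn
    refine h1.trans ?_
    have h2 : (1 : ℝ) ≤ (n0 : ℝ) ^ e * (n : ℝ) ^ (-e) := by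
      rw [Real.rpow_neg hnpos.le, ← div_eq_mul_inv, one_le_div (by positivity)]
      exact Real.rpow_le_rpow hnpos.le (by exact_mod_cast hlt.le) he0
    have h3 : 0 ≤ CA * (K ^ ((1 : ℝ) / ((m : ℝ) + 1)) * (n : ℝ) ^ (-e)) := by positivity
    have h4 : 2 ≤ CB * (K ^ ((1 : ℝ) / ((m : ℝ) + 1)) * (n : ℝ) ^ (-e)) := by
      calc (2 : ℝ) ≤ 2 * (1 * ((n0 : ℝ) ^ e * (n : ℝ) ^ (-e))) := by linarith
        _ ≤ 2 * (K ^ ((1 : ℝ) / ((m : ℝ) + 1)) * ((n0 : ℝ) ^ e * (n : ℝ) ^ (-e))) := by gcongr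
        _ = CB * (K ^ ((1 : ℝ) / ((m : ℝ) + 1)) * (n : ℝ) ^ (-e)) := by rw [hCB]; ring
    rw [hexp]
    linarith
  · have hG : Lagrange.interpolate (gaussLobattoNodes n) id f
        = Lagrange.interpolate (gaussLobattoNodes n) id (w 0) :=
      Lagrange.interpolate_eq_of_values_eq_on _ _ fun x hx =>
        hfw (gaussLobattoNodes_mem_Icc hn hx)
    have hbds := hC1 w hw n hn ((le_max_left _ _).trans hge)
    rw [← hG] at hbds
    set G := Lagrange.interpolate (gaussLobattoNodes n) id f with hGdef
    have hGe : ∀ x, gaussLobattoInterpolant n f x = G.eval x := fun x => rfl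
    have hclose : ∀ x ∈ Icc (-1 : ℝ) 1,
        |w 1 x - (Polynomial.derivative G).eval x| ≤ κ / 2 := by
      intro x hx
      refine abs_le_of_sq_le_sq ((hbds x hx).2.1.trans ?_) hκ2.le
      have h1 : C1 / (κ / 2) ^ 2 ≤ n :=
        hn1.le.trans (by exact_mod_cast (le_max_right _ _).trans hge)
      rw [div_le_iff₀ (by positivity)] at h1 ⊢
      linarith
    have hδ : ∀ x ∈ Icc (-1 : ℝ) 1, |f x - gaussLobattoInterpolant n f x|
        ≤ Real.sqrt C1 * (n : ℝ) ^ (-E) := by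
      intro x hx
      refine abs_le_of_sq_le_sq ?_ (by positivity)
      rw [hfw hx, hGe]
      refine (hbds x hx).1.trans ?_
      rw [mul_pow, Real.sq_sqrt hC10, div_eq_mul_inv]
      refine mul_le_mul_of_nonneg_left ?_ hC10
      rw [← pow_succ, ← Real.rpow_natCast, ← Real.rpow_neg hnpos.le,
        ← Real.rpow_mul_natCast hnpos.le]
      refine Real.rpow_le_rpow_of_exponent_le hnR ?_
      rw [hE]; push_cast; linarith
    have hsf : SmoothBound (-1) 1 m (w 1) B := (hw.smoothBound (by omega)).mono (le_max_left _ _)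
    have hsg : SmoothBound (-1) 1 m (fun x => (Polynomial.derivative G).eval x) B :=
      (smoothBound_polynomial fun j hj x hx => (hbds x hx).2.2 j hj).mono (le_max_right _ _)
    have hl' : (∀ x ∈ Icc (-1 : ℝ) 1, κ / 2 ≤ w 1 x ∧
          κ / 2 ≤ (Polynomial.derivative G).eval x) ∨
        ∀ x ∈ Icc (-1 : ℝ) 1, w 1 x ≤ -(κ / 2) ∧
          (Polynomial.derivative G).eval x ≤ -(κ / 2) := by
      refine hl.imp (fun h x hx => ?_) fun h x hx => ?_
      · have h1 := abs_le.1 (hclose x hx)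
        have h2 := h x hx
        exact ⟨by linarith, by linarith⟩
      · have h1 := abs_le.1 (hclose x hx)
        have h2 := h x hx
        exact ⟨by linarith, by linarith⟩
    obtain ⟨h, hh0, hhκ, hh⟩ := exists_scale m (κ := κ / 2) (D := Real.sqrt C1) (E := E) (K := K)
      (x := n) hκ2 (Real.sqrt_nonneg _) hK1 hnR hE0
    -- the Sobolev norm is an infimum that need not be attained by a chosen family: take `2 K > K`
    have hK2 : sobolevENorm (interior (f '' Icc (-1) 1)) m 1 (pdfOf ((inputMeasure r).map f))
        < ENNReal.ofReal (2 * K) := by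
      rw [ENNReal.lt_ofReal_iff_toReal_lt hmem.ne]
      change K < 2 * K
      linarith
    have key := hC2 f (w 1) (gaussLobattoInterpolant n f)
      (fun x => (Polynomial.derivative G).eval x) r (2 * K) (Real.sqrt C1 * (n : ℝ) ^ (-E)) h hfd
      (fun x _ => (G.hasDerivAt x).hasDerivWithinAt) hsf hsg hl'
      (gaussLobattoInterpolant_eq_of_mem f (mem_gaussLobattoNodes.2 (Or.inl rfl))).symm
      (gaussLobattoInterpolant_eq_of_mem f (mem_gaussLobattoNodes.2 (Or.inr (Or.inl rfl)))).symm
      hrc hr0 hr1 hδ hh0 hhκ hK2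
    have h3 : 0 ≤ CB * (K ^ ((1 : ℝ) / ((m : ℝ) + 1))
        * (n : ℝ) ^ (-((m : ℝ) / ((m : ℝ) + 1)) * E)) := by positivity
    have h4 : h⁻¹ * (Real.sqrt C1 * (n : ℝ) ^ (-E)) + h ^ m * (2 * K)
        ≤ 2 * (h⁻¹ * (Real.sqrt C1 * (n : ℝ) ^ (-E)) + h ^ m * K) := by
      have : 0 ≤ h⁻¹ * (Real.sqrt C1 * (n : ℝ) ^ (-E)) := by positivity
      linarith
    have h5 : C2 * (h⁻¹ * (Real.sqrt C1 * (n : ℝ) ^ (-E)) + h ^ m * (2 * K))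
        ≤ CA * (K ^ ((1 : ℝ) / ((m : ℝ) + 1)) * (n : ℝ) ^ (-((m : ℝ) / ((m : ℝ) + 1)) * E)) := by
      rw [hCA, mul_assoc, mul_assoc]
      exact mul_le_mul_of_nonneg_left
        (h4.trans (mul_le_mul_of_nonneg_left hh zero_le_two)) hC20
    linarith

/-- The interpolant is never constant, because it takes the different values `f (-1)` and `f 1`. -/
lemma map_gaussLobattoInterpolant_absolutelyContinuous {f f' : ℝ → ℝ} {κ : ℝ} (hκ : 0 < κ)
    (hd : ∀ x ∈ Icc (-1 : ℝ) 1, HasDerivWithinAt f (f' x) (Icc (-1) 1) x)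
    (hl : (∀ x ∈ Icc (-1 : ℝ) 1, κ ≤ f' x) ∨ ∀ x ∈ Icc (-1 : ℝ) 1, f' x ≤ -κ)
    (r : ℝ → ℝ) (n : ℕ) :
    (inputMeasure r).map (gaussLobattoInterpolant n f) ≪ volume := by
  refine map_polynomial_absolutelyContinuous ?_ (inputMeasure_absolutelyContinuous r)
  intro h0
  have h1 : gaussLobattoInterpolant n f (-1) = gaussLobattoInterpolant n f 1 := by
    simp only [gaussLobattoInterpolant]
    rw [Polynomial.eq_C_of_derivative_eq_zero h0, Polynomial.eval_C, Polynomial.eval_C]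
  rw [gaussLobattoInterpolant_eq_of_mem f (mem_gaussLobattoNodes.2 (Or.inl rfl)),
    gaussLobattoInterpolant_eq_of_mem f (mem_gaussLobattoNodes.2 (Or.inr (Or.inl rfl)))] at h1
  have hm1 : (-1 : ℝ) ∈ Icc (-1 : ℝ) 1 := by norm_num
  have hp1 : (1 : ℝ) ∈ Icc (-1 : ℝ) 1 := by norm_num
  rcases hl with hl | hl
  · have := mul_sub_le_of_le_hasDerivWithinAt hd hl hm1 hp1 (by norm_num)
    linarith
  · have := mul_sub_le_of_le_hasDerivWithinAt (fun x hx => (hd x hx).neg)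
      (fun x hx => by simpa using neg_le_neg (hl x hx)) hm1 hp1 (by norm_num)
    simp only [Pi.neg_apply] at this
    linarith

theorem theorem5p1 (m : ℕ) (hm : 1 ≤ m) (σ : ℕ) (hσ : 2 * m + 4 ≤ σ)
    (κ : ℝ) (hκ : 0 < κ) (M : ℝ) :
    ∃ C : ℝ, ∀ f r : ℝ → ℝ,
      -- `f ∈ W^{σ,2}(-1,1)`, represented by its continuous version, of norm at most `M`
      ContinuousOn f (Icc (-1) 1) →
      MemSobolevOn (Ioo (-1) 1) σ 2 f →
      sobolevNorm (Ioo (-1) 1) σ 2 f ≤ M →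
      (∀ x ∈ Icc (-1 : ℝ) 1, κ ≤ |derivWithin f (Icc (-1) 1) x|) →
      -- `r ∈ W^{m,1}(-1,1)` is the density of a probability measure on `[-1,1]`
      MemSobolevOn (Ioo (-1) 1) m 1 r →
      (∀ᵐ x ∂(volume.restrict (Icc (-1 : ℝ) 1)), 0 ≤ r x) →
      ∫ x in Icc (-1 : ℝ) 1, r x = 1 →
      -- both pushforwards have densities, and the first is in `W^{m,1}(A)`, `A = f([-1,1])`
      (inputMeasure r).map f ≪ volume ∧
      MemSobolevOn (interior (f '' Icc (-1) 1)) m 1 (pdfOf ((inputMeasure r).map f)) ∧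
      ∀ n : ℕ, 1 ≤ n →
        (inputMeasure r).map (gaussLobattoInterpolant n f) ≪ volume ∧
        ∫ y, |pdfOf ((inputMeasure r).map f) y
            - pdfOf ((inputMeasure r).map (gaussLobattoInterpolant n f)) y|
          ≤ C * sobolevNorm (interior (f '' Icc (-1) 1)) m 1
                  (pdfOf ((inputMeasure r).map f)) ^ ((1 : ℝ) / ((m : ℝ) + 1))
              * sobolevNorm (Ioo (-1) 1) σ 2 f ^ ((1 : ℝ) / ((m : ℝ) + 1))
              * (n : ℝ) ^ (-((m : ℝ) / ((m : ℝ) + 1)) * ((σ : ℝ) - 5 / 6)) := by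
  -- `|M| + 1` is a strict upper bound for the norm of `f`, and is positive for every `M`
  obtain ⟨C, hC0, hC⟩ := exists_integral_abs_pdf_sub_interpolant_le hm hσ hκ (|M| + 1)
  set q : ℝ := (1 : ℝ) / ((m : ℝ) + 1) with hq
  refine ⟨C * κ ^ (-q), fun f r hfc hfm hfM hfκ hrm hr0 hr1 => ?_⟩
  obtain ⟨w, hw, hfw⟩ := exists_isSobolevChain (σ := σ) hfc (by omega) (K := |M| + 1) (by
    rw [ENNReal.lt_ofReal_iff_toReal_lt hfm.ne]
    exact (hfM.trans (le_abs_self M)).trans_lt (lt_add_one _))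
  obtain ⟨r', N, hrr, hr'N, hr'0, hr'1⟩ := exists_continuous_density hm hrm hr0 hr1
  have hr'c := hr'N.continuousOn (by norm_num) hm
  have hfd : ∀ x ∈ Icc (-1 : ℝ) 1, HasDerivWithinAt f (w 1 x) (Icc (-1) 1) x := fun x hx =>
    hw.hasDerivWithinAt (by omega) hfw hx
  have hl : (∀ x ∈ Icc (-1 : ℝ) 1, κ ≤ w 1 x) ∨ ∀ x ∈ Icc (-1 : ℝ) 1, w 1 x ≤ -κ :=
    le_or_le_neg_of_le_abs hκ ((hw.prim 1 (by omega)).continuousOn (by norm_num)) fun x hx => by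
      rw [← hw.derivWithin_eq (by omega) hfw hx]
      exact hfκ x hx
  rw [hrr]
  obtain ⟨hac, hmem, hK1⟩ := pdfOf_map_regularity hm hκ hfd (hw.smoothBound (m := m) (by omega)) hl
    hr'N hr'0 hr'1
  refine ⟨hac, hmem, fun n hn =>
    ⟨map_gaussLobattoInterpolant_absolutelyContinuous hκ hfd hl r' n, ?_⟩⟩
  refine (hC f r' w hw hfw hl hr'c hr'0 hr'1 hmem hK1 n hn).trans ?_
  set K := sobolevNorm (interior (f '' Icc (-1) 1)) m 1 (pdfOf ((inputMeasure r').map f))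
  set F := sobolevNorm (Ioo (-1) 1) σ 2 f with hF
  set X := (n : ℝ) ^ (-((m : ℝ) / ((m : ℝ) + 1)) * ((σ : ℝ) - 5 / 6))
  -- the norm of `f` is bounded below by `κ`
  have hκF : κ ≤ F := le_sobolevNorm hfc (by omega) hfm hκ hfκ
  have hX : 0 ≤ X := by positivity
  have hKq : 0 ≤ K ^ q := by positivity
  have h1 : 1 ≤ κ ^ (-q) * F ^ q := by
    rw [Real.rpow_neg hκ.le, inv_mul_eq_div, one_le_div (by positivity)]
    exact Real.rpow_le_rpow hκ.le hκF (by positivity)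
  calc C * (K ^ q * X) ≤ C * (K ^ q * X) * (κ ^ (-q) * F ^ q) :=
        le_mul_of_one_le_right (by positivity) h1
    _ = C * κ ^ (-q) * K ^ q * F ^ q * X := by ring
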